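/- Let $\mathfrak g$ be a compact simple real Lie algebra, $\mathfrak t$ a maximal abelian subalgebra of $\mathfrak g$, $\varPi=\{\alpha_1,\dots,\alpha_n\}$ a set of simple roots of the root system $\varDelta(\mathfrak g_{\mathbb C},\mathfrak t_{\mathbb C})$, $\delta=\sum_j m_j\alpha_j$ the highest root, $\alpha_0=-\delta$, and let $K_j\in\mathfrak t_{\mathbb C}$ be defined by $\alpha_l(K_j)=\delta_{lj}$. Fix $i$ with $m_i\in\{3,4\}$, put $\sigma=\mathrm{Ad}(\exp\frac{\pi}{2}\sqrt{-1}K_i)$, an automorphism of $\mathfrak g$ of order $4$, let $\mathfrak h=\mathfrak g^\sigma$ be its fixed-point algebra and $\mathfrak z$ the center of $\mathfrak h$. Let $\varPi(\mathfrak h)$ be the fundamental root system $\{\alpha_0,\alpha_1,\dots,\alpha_n\}\setminus\{\alpha_i\}$ of $\mathfrak h$ if $m_i=4$, and $\{\alpha_1,\dots,\alpha_n\}\setminus\{\alpha_i\}$ if $m_i=3$. An automorphism $\tau$ with $\tau(\mathfrak t)=\mathfrak t$ acts on linear forms on $\mathfrak t_{\mathbb C}$ by $\tau(\alpha)=\alpha\circ\tau^{-1}$.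 Suppose $\dim\mathfrak z=0$. Consider the involutive automorphisms $\tau$ of $\mathfrak g$ with $\tau(\mathfrak h)=\mathfrak h$, $\tau(\mathfrak t)=\mathfrak t$, $\tau(\varPi(\mathfrak h))=\varPi(\mathfrak h)$ and $\tau|_{\mathfrak t}\neq\mathrm{Id}_{\mathfrak t}$. Then a linear automorphism of $\mathfrak t$ is the restriction $\tau|_{\mathfrak t}$ of such a $\tau$ if and only if, in Bourbaki's numbering of the simple roots, it is one of the following: * Type I ($\mathfrak g=\mathfrak e_7$, $i=4$): $\alpha_1\leftrightarrow\alpha_6$, $\alpha_2\mapsto\alpha_2$, $\alpha_3\leftrightarrow\alpha_5$, $\alpha_4\mapsto\alpha_4$, $\alpha_7\mapsto\alpha_0$; * Type II ($\mathfrak e_7$, $i=4$): $\alpha_1\mapsto\alpha_1$, $\alpha_2\mapsto\alpha_2$, $\alpha_3\mapsto\alpha_0$, $\alpha_5\leftrightarrow\alpha_7$, $\alpha_6\mapsto\alpha_6$, $\alpha_4\mapsto\alpha_1+\alpha_2+2\alpha_3+3\alpha_4+2\alpha_5+\alpha_6$; * Type III ($\mathfrak e_7$, $i=4$): $\alpha_1\leftrightarrow\alpha_6$,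 $\alpha_2\mapsto\alpha_2$, $\alpha_3\leftrightarrow\alpha_7$, $\alpha_5\mapsto\alpha_0$, $\alpha_4\mapsto\alpha_1+\alpha_2+2\alpha_3+3\alpha_4+2\alpha_5+\alpha_6$; * Type IV ($\mathfrak e_8$, $i=3$): $\alpha_1\mapsto\alpha_1$, $\alpha_2\mapsto\alpha_0$, $\alpha_4\leftrightarrow\alpha_8$, $\alpha_5\leftrightarrow\alpha_7$, $\alpha_6\mapsto\alpha_6$, $\alpha_3\mapsto\alpha_1+2\alpha_2+3\alpha_3+4\alpha_4+3\alpha_5+2\alpha_6+\alpha_7$; * Type V ($\mathfrak e_8$, $i=6$): $\alpha_1\mapsto\alpha_1$, $\alpha_2\leftrightarrow\alpha_5$, $\alpha_3\mapsto\alpha_3$, $\alpha_4\mapsto\alpha_4$, $\alpha_7\mapsto\alpha_0$, $\alpha_8\mapsto\alpha_8$, $\alpha_6\mapsto\alpha_1+\alpha_2+2\alpha_3+3\alpha_4+3\alpha_5+3\alpha_6+2\alpha_7+\alpha_8$; * Type VI ($\mathfrak f_4$, $i=3$): $\alpha_1\mapsto\alpha_1$, $\alpha_2\mapsto\alpha_0$,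 $\alpha_4\mapsto\alpha_4$, $\alpha_3\mapsto\alpha_1+2\alpha_2+3\alpha_3+\alpha_4$. If $\tau|_{\mathfrak t}$ is of Type I, then $\tau\circ\sigma=\sigma\circ\tau$; if it is of one of the Types II–VI, then $\tau\circ\sigma=\sigma^{-1}\circ\tau$. -/

import Mathlib

open scoped TensorProduct

noncomputable section

namespace FourSymmetric

/-- A real Lie algebra is compact (and semisimple) if its Killing form is negative definite. -/
class IsCompactLie (g : Type*) [LieRing g] [LieAlgebra ℝ g] : Prop where
  killing_neg : ∀ x : g, x ≠ 0 → killingForm ℝ g x x < 0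

/-- `t` is a maximal abelian subalgebra: it is abelian, and every element commuting with all of
`t` lies in `t`. -/
class IsMaximalAbelian {g : Type*} [LieRing g] [LieAlgebra ℝ g] (t : LieSubalgebra ℝ g) :
    Prop where
  abelian : ∀ x ∈ t, ∀ y ∈ t, ⁅x, y⁆ = 0
  maximal : ∀ x : g, (∀ y ∈ t, ⁅x, y⁆ = 0) → x ∈ t

section Complexification

variable {g : Type*} [LieRing g] [LieAlgebra ℝ g]

/-- The complexification `t_ℂ ⊆ g_ℂ = ℂ ⊗ g` of a subalgebra `t` of `g`. -/
def complexify (t : LieSubalgebra ℝ g) : LieSubalgebra ℂ (ℂ ⊗[ℝ] g) where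
  toSubmodule := t.toSubmodule.baseChange ℂ
  lie_mem' {x y} hx hy := by
    simp only [AddSubsemigroup.mem_carrier, AddSubmonoid.mem_toSubsemigroup,
      Submodule.mem_toAddSubmonoid, Submodule.baseChange_eq_span] at hx hy ⊢
    refine Submodule.span_induction₂ 
      (p := fun x y _ _ ↦ LieRing.toBracket.bracket x y ∈ Submodule.span ℂ _)
      ?_ ?_ ?_ ?_ ?_ ?_ ?_ hx hy
    · rintro - - ⟨x, hx, rfl⟩ ⟨y, hy, rfl⟩
      exact Submodule.subset_span ⟨⁅x, y⁆, t.lie_mem hx hy, by simp⟩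
    · intro x _; rw [zero_lie]; exact Submodule.zero_mem _
    · intro x _
      have h0 := LieAlgebra.lie_smul (0 : ℂ) x (0 : ℂ ⊗[ℝ] g)
      rw [zero_smul, zero_smul] at h0
      exact (congrArg (· ∈ Submodule.span ℂ _) h0).mpr (Submodule.zero_mem _)
    · intro x y z _ _ _ h1 h2; rw [add_lie]; exact Submodule.add_mem _ h1 h2
    · intro x y z _ _ _ h1 h2; rw [LieRing.lie_add]; exact Submodule.add_mem _ h1 h2
    · intro r x y _ _ h; rw [smul_lie]; exact Submodule.smul_mem _ _ h
    · intro r x y _ _ h; rw [LieAlgebra.lie_smul]; exact Submodule.smul_mem _ _ h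

theorem tmul_mem_complexify (t : LieSubalgebra ℝ g) {x : g} (hx : x ∈ t) (c : ℂ) :
    c ⊗ₜ[ℝ] x ∈ complexify t :=
  Submodule.tmul_mem_baseChange_of_mem (p := t.toSubmodule) c hx

/-- Every `ℝ`-linear map `ℂ → ℝ` gives a map `g_ℂ → g`, `c ⊗ x ↦ ℓ(c) x`. -/
def part (g : Type*) [LieRing g] [LieAlgebra ℝ g] (l : ℂ →ₗ[ℝ] ℝ) : ℂ ⊗[ℝ] g →ₗ[ℝ] g :=
  (TensorProduct.lid ℝ g).toLinearMap ∘ₗ TensorProduct.map l LinearMap.id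

theorem part_tmul (l : ℂ →ₗ[ℝ] ℝ) (c : ℂ) (x : g) : part g l (c ⊗ₜ[ℝ] x) = l c • x := by
  simp [part]

theorem part_mem (t : LieSubalgebra ℝ g) (l : ℂ →ₗ[ℝ] ℝ) {y : ℂ ⊗[ℝ] g}
    (hy : y ∈ complexify t) : part g l y ∈ t := by
  have hy' : y ∈ t.toSubmodule.baseChange ℂ := hy
  rw [Submodule.baseChange_eq_span] at hy'
  have key : ∀ (c : ℂ), part g l (c • y) ∈ t := by
    refine Submodule.span_induction (p := fun y _ ↦ ∀ c : ℂ, part g l (c • y) ∈ t)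
      ?_ ?_ ?_ ?_ hy'
    · rintro - ⟨x, hx, rfl⟩ c
      have : c • (TensorProduct.mk ℝ ℂ g 1) x = c ⊗ₜ[ℝ] x := by
        simp [TensorProduct.smul_tmul']
      rw [this, part_tmul]
      exact t.smul_mem _ hx
    · intro c; simp
    · intro a b _ _ ha hb c
      rw [smul_add, map_add]; exact t.add_mem (ha c) (hb c)
    · intro a b _ hb c
      rw [smul_smul]; exact hb _
  simpa using key 1

theorem eq_re_add_im (y : ℂ ⊗[ℝ] g) :
    y = (1 : ℂ) ⊗ₜ[ℝ] part g Complex.reLm y + Complex.I ⊗ₜ[ℝ] part g Complex.imLm y := by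
  induction y using TensorProduct.induction_on with
  | zero => simp
  | tmul c x =>
    rw [part_tmul, part_tmul, ← TensorProduct.smul_tmul, ← TensorProduct.smul_tmul,
      ← TensorProduct.add_tmul]
    congr 1
    apply Complex.ext <;> simp
  | add a b ha hb =>
    rw [map_add, map_add, TensorProduct.tmul_add, TensorProduct.tmul_add]
    nth_rewrite 1 [ha, hb]
    abel

theorem part_lie (l : ℂ →ₗ[ℝ] ℝ) (y : ℂ ⊗[ℝ] g) (h : g) :
    part g l ⁅y, (1 : ℂ) ⊗ₜ[ℝ] h⁆ = ⁅part g l y, h⁆ := by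
  induction y using TensorProduct.induction_on with
  | zero => simp
  | tmul c x => simp [part_tmul]
  | add a b ha hb => simp [ha, hb]

end Complexification

section Instances

variable {g : Type*} [LieRing g] [LieAlgebra ℝ g] [FiniteDimensional ℝ g] [IsCompactLie g]

instance isKilling_real : LieAlgebra.IsKilling ℝ g where
  killingCompl_top_eq_bot := by
    rw [eq_bot_iff]
    intro x hx
    rw [LieIdeal.mem_killingCompl] at hx
    by_contra hne
    have h1 := IsCompactLie.killing_neg x (by simpa using hne)
    have h2 := hx x (by simp)
    exact h1.ne h2

instance isKilling_complexification : LieAlgebra.IsKilling ℂ (ℂ ⊗[ℝ] g) where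
  killingCompl_top_eq_bot := by
    rw [eq_bot_iff]
    intro y hy
    rw [LieIdeal.mem_killingCompl] at hy
    have hz : ∀ h : g, killingForm ℂ (ℂ ⊗[ℝ] g) ((1 : ℂ) ⊗ₜ[ℝ] h) y = 0 := fun h ↦ hy _ (by simp)
    have hbc : ∀ (h x : g) (c : ℂ), killingForm ℂ (ℂ ⊗[ℝ] g) ((1 : ℂ) ⊗ₜ[ℝ] h) (c ⊗ₜ[ℝ] x)
        = c * (killingForm ℝ g h x : ℂ) := by
      intro h x c
      have := LieModule.traceForm_baseChange (R := ℝ) (A := ℂ) (L := g) (M := g)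
      rw [killingForm, this]
      simp [mul_comm]
    set a := part g Complex.reLm y
    set b := part g Complex.imLm y
    have hab := eq_re_add_im y
    have h3 : ∀ h : g, killingForm ℝ g h a = 0 ∧ killingForm ℝ g h b = 0 := by
      intro h
      have := hz h
      rw [hab, map_add, hbc, hbc] at this
      have hre := congrArg Complex.re this
      have him := congrArg Complex.im this
      simp only [Complex.add_re, Complex.add_im, Complex.mul_re, Complex.mul_im, Complex.one_re,
        Complex.one_im, Complex.I_re, Complex.I_im, Complex.ofReal_re, Complex.ofReal_im,
        Complex.zero_re, Complex.zero_im] at hre him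
      constructor <;> linarith
    have ha : a = 0 := by
      by_contra hne
      exact (IsCompactLie.killing_neg a hne).ne (h3 a).1
    have hb : b = 0 := by
      by_contra hne
      exact (IsCompactLie.killing_neg b hne).ne (h3 b).2
    change y = 0
    rw [hab]
    change (1 : ℂ) ⊗ₜ[ℝ] a + Complex.I ⊗ₜ[ℝ] b = 0
    rw [ha, hb]; simp

set_option linter.unusedSectionVars false in
theorem mem_of_lie_mem (t : LieSubalgebra ℝ g) [IsMaximalAbelian t] {x : g}
    (hx : ∀ h ∈ t, ⁅x, h⁆ ∈ t) : x ∈ t := by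
  refine IsMaximalAbelian.maximal x fun h hh ↦ ?_
  by_contra hne
  have h1 := IsCompactLie.killing_neg _ hne
  have h2 : killingForm ℝ g ⁅x, h⁆ ⁅x, h⁆ = killingForm ℝ g x ⁅h, ⁅x, h⁆⁆ :=
    LieModule.traceForm_apply_lie_apply ℝ g g x h ⁅x, h⁆
  rw [IsMaximalAbelian.abelian h hh _ (hx h hh), map_zero] at h2
  exact h1.ne h2

instance isCartan_complexify (t : LieSubalgebra ℝ g) [IsMaximalAbelian t] :
    (complexify t).IsCartanSubalgebra where
  nilpotent := by
    have : IsLieAbelian (complexify t) := by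
      refine ⟨fun x y ↦ Subtype.ext ?_⟩
      change ⁅(x : ℂ ⊗[ℝ] g), (y : ℂ ⊗[ℝ] g)⁆ = 0
      have hx := part_mem t Complex.reLm x.2
      have hx' := part_mem t Complex.imLm x.2
      have hy := part_mem t Complex.reLm y.2
      have hy' := part_mem t Complex.imLm y.2
      rw [eq_re_add_im (x : ℂ ⊗[ℝ] g), eq_re_add_im (y : ℂ ⊗[ℝ] g)]
      simp [IsMaximalAbelian.abelian _ hx _ hy, IsMaximalAbelian.abelian _ hx' _ hy,
        IsMaximalAbelian.abelian _ hx _ hy', IsMaximalAbelian.abelian _ hx' _ hy']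
    infer_instance
  self_normalizing := by
    refine le_antisymm (fun y hy ↦ ?_) (LieSubalgebra.le_normalizer _)
    rw [LieSubalgebra.mem_normalizer_iff'] at hy
    have key : ∀ l : ℂ →ₗ[ℝ] ℝ, part g l y ∈ t := fun l ↦
      mem_of_lie_mem t fun h hh ↦ by
        rw [← part_lie, ← lie_skew, map_neg]
        exact t.neg_mem (part_mem t l (hy _ (tmul_mem_complexify t hh 1)))
    rw [eq_re_add_im y]
    exact add_mem (tmul_mem_complexify t (key _) _) (tmul_mem_complexify t (key _) _)

end Instances

/-- `F = exp(ad x) = ∑ (ad x)ⁿ / n!` on a (finite-dimensional) complex Lie algebra; convergence in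
a finite-dimensional space is convergence of all linear functionals. -/
def IsExpAd {L : Type*} [LieRing L] [LieAlgebra ℂ L] (x : L) (F : L →ₗ[ℂ] L) : Prop :=
  ∀ (φ : Module.Dual ℂ L) (y : L),
    HasSum (fun n : ℕ ↦ (n.factorial : ℂ)⁻¹ * φ (((LieAlgebra.ad ℂ L x) ^ n) y)) (φ (F y))

/-- The subalgebra `g^σ` of fixed points of an automorphism `σ`. -/
def fixedPoints {g : Type*} [LieRing g] [LieAlgebra ℝ g] (σ : g ≃ₗ⁅ℝ⁆ g) :
    LieSubalgebra ℝ g where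
  carrier := {x | σ x = x}
  add_mem' {x y} hx hy := by simp_all
  zero_mem' := by simp
  smul_mem' c x hx := by simp_all
  lie_mem' {x y} hx hy := by
    change σ ⁅x, y⁆ = ⁅x, y⁆
    rw [LieEquiv.map_lie, show σ x = x from hx, show σ y = y from hy]

section Roots

variable {g : Type*} [LieRing g] [LieAlgebra ℝ g] [FiniteDimensional ℝ g] [IsCompactLie g]
  (t : LieSubalgebra ℝ g) [IsMaximalAbelian t]

/-- The root system `Δ(g_ℂ, t_ℂ)`. -/
abbrev roots : RootPairing (complexify t).root ℂ (Module.Dual ℂ (complexify t)) (complexify t) :=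
  LieAlgebra.IsKilling.rootSystem (complexify t)

variable {t}

/-- The restriction to `t` of a linear form on `t_ℂ` (which it determines). -/
def onT (φ : Module.Dual ℂ (complexify t)) : t →ₗ[ℝ] ℂ where
  toFun h := φ ⟨(1 : ℂ) ⊗ₜ[ℝ] (h : g), tmul_mem_complexify t h.2 1⟩
  map_add' x y := by
    rw [← map_add]; congr 1; ext; simp [TensorProduct.tmul_add]
  map_smul' c x := by
    have : (⟨(1 : ℂ) ⊗ₜ[ℝ] ((c • x : t) : g), tmul_mem_complexify t (c • x).2 1⟩ : complexify t)
        = (c : ℂ) • ⟨(1 : ℂ) ⊗ₜ[ℝ] (x : g), tmul_mem_complexify t x.2 1⟩ := by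
      ext
      simp [TensorProduct.smul_tmul']
    rw [this, map_smul]; simp

/-- The action of `f : t → t` on linear forms on `t`: `(f λ)(H) = λ(f⁻¹ H)`. -/
def act (f : t ≃ₗ[ℝ] t) (φ : t →ₗ[ℝ] ℂ) : t →ₗ[ℝ] ℂ := φ ∘ₗ f.symm.toLinearMap

/-- `δ` is the highest root: `δ - β` is a sum of simple roots for every root `β`. -/
def IsHighestRoot (b : (roots t).Base) (δ : (complexify t).root) : Prop :=
  ∀ β, (roots t).root δ - (roots t).root β ∈
    AddSubmonoid.closure ((roots t).root '' (b.support : Set (complexify t).root))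

/-- The fundamental root system `Π(h)` of `h = g^σ`, `σ = Ad(exp (π/2)√-1 Kᵢ)`: it is obtained from
the extended system `{α₀ = -δ, α₁, …, αₙ}` by removing `αᵢ` if `mᵢ = 4`, and by removing `α₀` and
`αᵢ` if `mᵢ = 3`. Its members are regarded as linear forms on `t`. -/
def fundamentalRootsH (b : (roots t).Base) (δ : (complexify t).root) (m : b.support → ℕ)
    (i : b.support) : Set (t →ₗ[ℝ] ℂ) :=
  {φ | (∃ j : b.support, j ≠ i ∧ φ = onT ((roots t).root j)) ∨
    (m i = 4 ∧ φ = -onT ((roots t).root δ))}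

/-- `τ` is an automorphism of `g` with `τ² = 1`, `τ(h) = h` for `h = g^σ`, `τ(t) = t`, `τ|_t = f`
and `τ(Π(h)) = Π(h)`. -/
structure IsAdmissible (b : (roots t).Base) (δ : (complexify t).root) (m : b.support → ℕ)
    (i : b.support) (σ τ : g ≃ₗ⁅ℝ⁆ g) (f : t ≃ₗ[ℝ] t) : Prop where
  involutive : ∀ x, τ (τ x) = x
  map_h : (fixedPoints σ).map τ.toLieHom = fixedPoints σ
  restrict : ∀ x : t, τ (x : g) = (f x : g)
  map_fundamental : act f '' fundamentalRootsH b δ m i = fundamentalRootsH b δ m i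

/-- With respect to some numbering `α₁, …, αₙ` of the simple roots with Cartan matrix `C`, the
simple root `αᵢ` has number `k + 1` and `f` maps `αₚ` to `image a p` where `a 0 = α₀ = -δ` and
`a p = αₚ` for `1 ≤ p ≤ n` (the list `image a` starts with the image of `α₁`). -/
def HasRow (b : (roots t).Base) (δ : (complexify t).root) (i : b.support) (f : t ≃ₗ[ℝ] t)
    {n : ℕ} (C : Matrix (Fin n) (Fin n) ℤ) (k : Fin n)
    (image : (Fin (n + 1) → (t →ₗ[ℝ] ℂ)) → Fin n → (t →ₗ[ℝ] ℂ)) : Prop :=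
  ∃ e : Fin n ≃ b.support,
    (∀ p q, b.cartanMatrix (e p) (e q) = C p q) ∧ e k = i ∧
    ∀ p : Fin n, act f (onT ((roots t).root (e p))) =
      image (Fin.cons (-onT ((roots t).root δ)) fun q ↦ onT ((roots t).root (e q))) p

/-- The six types. -/
inductive RowType
  | I | II | III | IV | V | VI

/-- The six rows of the table (Bourbaki's numbering of the simple roots). -/
def IsOfType (b : (roots t).Base) (δ : (complexify t).root) (i : b.support) (f : t ≃ₗ[ℝ] t) :
    RowType → Prop
  | .I => HasRow b δ i f CartanMatrix.E₇ 3 fun a ↦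
      ![a 6, a 2, a 5, a 4, a 3, a 1, a 0]
  | .II => HasRow b δ i f CartanMatrix.E₇ 3 fun a ↦
      ![a 1, a 2, a 0,
        a 1 + a 2 + 2 • a 3 + 3 • a 4 + 2 • a 5 + a 6,
        a 7, a 6, a 5]
  | .III => HasRow b δ i f CartanMatrix.E₇ 3 fun a ↦
      ![a 6, a 2, a 7,
        a 1 + a 2 + 2 • a 3 + 3 • a 4 + 2 • a 5 + a 6,
        a 0, a 1, a 3]
  | .IV => HasRow b δ i f CartanMatrix.E₈ 2 fun a ↦
      ![a 1, a 0,
        a 1 + 2 • a 2 + 3 • a 3 + 4 • a 4 + 3 • a 5 + 2 • a 6 + a 7,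
        a 8, a 7, a 6, a 5, a 4]
  | .V => HasRow b δ i f CartanMatrix.E₈ 5 fun a ↦
      ![a 1, a 5, a 3, a 4, a 2,
        a 1 + a 2 + 2 • a 3 + 3 • a 4 + 3 • a 5 + 3 • a 6 + 2 • a 7 + a 8,
        a 0, a 8]
  | .VI => HasRow b δ i f CartanMatrix.F₄ 2 fun a ↦
      ![a 1, a 0,
        a 1 + 2 • a 2 + 3 • a 3 + a 4,
        a 4]

end Roots

end FourSymmetric

end

open FourSymmetric

/-! The whole statement is reduced to integer matrices written in the basis of simple roots.

The condition on the center rules out mᵢ = 3. If mᵢ = 3, every root takes an integer value of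
absolute value at most 3 on K, so σ fixes a root vector only when its root vanishes on K. Hence 𝔥
centralizes √-1·K, which is a nonzero element of g lying in 𝔥, and the center is not zero
(`mark_ne_three`). So mᵢ = 4.

Pairing the relation α₀ + ∑ mⱼαⱼ = 0 with all coroots shows that the marks 1, m₁, …, mₙ are
annihilated by the extended Cartan matrix. The extended diagram is connected because δ involves
every simple root. An elementary study of such diagrams with mark 1 at the base vertex and some mark
4 leaves only E₇, E₈ and F₄, with one, two and one possible positions of i
(`IsMarkedDiagram.classification`, `exists_isMarkedNumbering`).

An admissible τ permutes the roots and preserves their pairings, so it induces an involution of {α₀,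
…, αₙ} without αᵢ that preserves orthogonality. The image of αᵢ is then forced: the relation above
determines 4·τ(αᵢ), and the result must be integral. A finite search lists the candidate
involutions, and divisibility by 4 leaves exactly the identity and the rows of the table
(`exists_matrix_of_involution`, `IsExtMatrix.dvd`, `isExtMatrix_E7` and its analogues).

Conversely, each row is a Weyl group element w·s₁⋯sᵣ·w⁻¹ with mutually orthogonal simple reflections
sⱼ. The usual lifts nⱼ of simple reflections are not involutive, but the torus element D that acts
by (-1)^height satisfies nⱼDnⱼ = D and D² = 1. So D·n₁⋯nᵣ is an involution with the same action on
the Cartan subalgebra, and so are its conjugates. With sl₂-triples adapted to the compact form, all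
these lifts commute with complex conjugation and descend to g (`exists_involutive_lift`,
`exists_eq_one_tmul_of_conj_comm`).

Finally, στ = τσ or στσ = τ holds as soon as τ⁻¹K - K, respectively τ⁻¹K + K, takes values in 4ℤ on
the simple roots. This is a congruence modulo 4 on one column of the matrix. It gives the
commutation rules, and in the converse also τ(𝔥) = 𝔥. -/

namespace FourSymmetric

/-! ### Exponentials of nilpotent derivations and lifts of reflections. -/

section ExpAd

variable {L : Type*} [LieRing L] [LieAlgebra ℂ L]

theorem isNilpotent_ad_neg {x : L} (hx : IsNilpotent (LieAlgebra.ad ℂ L x)) :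
    IsNilpotent (LieAlgebra.ad ℂ L (-x)) := by
  rw [map_neg]; exact hx.neg

variable [LieAlgebra ℚ L]

/-- The automorphism `exp (ad x)` for an ad-nilpotent element `x`. -/
noncomputable def expAd {x : L} (hx : IsNilpotent (LieAlgebra.ad ℂ L x)) : L ≃ₗ⁅ℂ⁆ L :=
  LieDerivation.exp ⟨LieAlgebra.ad ℂ L x, fun a b ↦ by
    rw [LieAlgebra.ad_apply, LieAlgebra.ad_apply, LieAlgebra.ad_apply, leibniz_lie x a b,
      ← lie_skew b]; abel⟩ hx

theorem expAd_apply {x : L} (hx : IsNilpotent (LieAlgebra.ad ℂ L x)) (y : L) :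
    expAd hx y = IsNilpotent.exp (LieAlgebra.ad ℂ L x) y :=
  rfl

theorem expAd_symm_apply {x : L} (hx : IsNilpotent (LieAlgebra.ad ℂ L x))
    (hx' : IsNilpotent (LieAlgebra.ad ℂ L (-x))) (y : L) :
    (expAd hx).symm y = expAd hx' y := by
  rw [expAd_apply, map_neg]
  rfl

theorem expAd_apply_of_cube {x y : L} (hx : IsNilpotent (LieAlgebra.ad ℂ L x))
    (h : ⁅x, ⁅x, ⁅x, y⁆⁆⁆ = 0) :
    expAd hx y = y + ⁅x, y⁆ + (2⁻¹ : ℂ) • ⁅x, ⁅x, y⁆⁆ := by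
  have h3 : (LieAlgebra.ad ℂ L x ^ 3) • y = 0 := by
    simpa [pow_succ] using h
  have := IsNilpotent.exp_smul_eq_sum h3 hx
  rw [expAd_apply]
  have h2 : ((2⁻¹ : ℚ) • ⁅x, ⁅x, y⁆⁆ : L) = (2⁻¹ : ℂ) • ⁅x, ⁅x, y⁆⁆ := by
    have e : (2 : ℂ) • ((2⁻¹ : ℚ) • ⁅x, ⁅x, y⁆⁆ : L) = ⁅x, ⁅x, y⁆⁆ := by
      rw [two_smul, ← add_smul, show (2⁻¹ + 2⁻¹ : ℚ) = 1 by norm_num, one_smul]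
    rw [← smul_right_inj (two_ne_zero (α := ℂ)), e, smul_smul]; norm_num
  simpa [Finset.sum_range_succ, pow_succ, h2] using this

/-- The exponential series has rational coefficients, so an additive bracket-preserving map
transports it. Complex linearity must not be required: the lemma is applied to the antilinear
conjugation as well as to automorphisms. -/
theorem map_expAd {x x' : L} (hx : IsNilpotent (LieAlgebra.ad ℂ L x))
    (hx' : IsNilpotent (LieAlgebra.ad ℂ L x')) (θ : L →+ L)
    (hθ : ∀ y z, θ ⁅y, z⁆ = ⁅θ y, θ z⁆) (h : θ x = x') (y : L) :
    θ (expAd hx y) = expAd hx' (θ y) := by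
  obtain ⟨k, hk⟩ := id hx
  obtain ⟨l, hl⟩ := id hx'
  have hk' := pow_eq_zero_of_le (le_max_left k l) hk
  have hl' := pow_eq_zero_of_le (le_max_right k l) hl
  have hp (i : ℕ) : θ ((LieAlgebra.ad ℂ L x ^ i) y) = (LieAlgebra.ad ℂ L x' ^ i) (θ y) := by
    induction i with
    | zero => simp
    | succ i ih => simp [pow_succ', hθ, ih, h]
  rw [expAd_apply, expAd_apply, IsNilpotent.exp_eq_sum hk', IsNilpotent.exp_eq_sum hl']
  simp [map_rat_smul, hp]

theorem expAd_expAd_neg {x : L} (hx : IsNilpotent (LieAlgebra.ad ℂ L x)) (y : L) :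
    expAd hx (expAd (isNilpotent_ad_neg hx) y) = y := by
  rw [← expAd_symm_apply hx, LieEquiv.apply_symm_apply]

/-- The automorphism `exp (ad e) exp (-ad f) exp (ad e)`. -/
noncomputable def weylLift {e f : L} (he : IsNilpotent (LieAlgebra.ad ℂ L e))
    (hf : IsNilpotent (LieAlgebra.ad ℂ L f)) : L ≃ₗ⁅ℂ⁆ L :=
  ((expAd he).trans (expAd (isNilpotent_ad_neg hf))).trans (expAd he)

theorem weylLift_apply {e f : L} (he : IsNilpotent (LieAlgebra.ad ℂ L e))
    (hf : IsNilpotent (LieAlgebra.ad ℂ L f)) (y : L) :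
    weylLift he hf y = expAd he (expAd (isNilpotent_ad_neg hf) (expAd he y)) := rfl

theorem map_weylLift {e f e' f' : L} (he : IsNilpotent (LieAlgebra.ad ℂ L e))
    (hf : IsNilpotent (LieAlgebra.ad ℂ L f)) (he' : IsNilpotent (LieAlgebra.ad ℂ L e'))
    (hf' : IsNilpotent (LieAlgebra.ad ℂ L f')) (θ : L →+ L)
    (hθ : ∀ y z, θ ⁅y, z⁆ = ⁅θ y, θ z⁆) (h : θ e = e') (h' : θ f = f') (y : L) :
    θ (weylLift he hf y) = weylLift he' hf' (θ y) := by
  rw [weylLift_apply, weylLift_apply, map_expAd he he' θ hθ h,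
    map_expAd (isNilpotent_ad_neg hf) (isNilpotent_ad_neg hf') θ hθ (by simp [h']),
    map_expAd he he' θ hθ h]

theorem weylLift_apply_neg_neg {e f : L} (he : IsNilpotent (LieAlgebra.ad ℂ L e))
    (hf : IsNilpotent (LieAlgebra.ad ℂ L f)) (y : L) :
    weylLift he hf (weylLift (isNilpotent_ad_neg he) (isNilpotent_ad_neg hf) y) = y := by
  rw [weylLift_apply, weylLift_apply, expAd_expAd_neg, expAd_expAd_neg, expAd_expAd_neg]

theorem expAd_apply_of_lie_eq_zero {x y : L} (hx : IsNilpotent (LieAlgebra.ad ℂ L x))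
    (h : ⁅x, y⁆ = 0) : expAd hx y = y := by
  rw [expAd_apply_of_cube hx (by simp [h])]; simp [h]

theorem weylLift_apply_of_lie_eq_zero {e f y : L} (he : IsNilpotent (LieAlgebra.ad ℂ L e))
    (hf : IsNilpotent (LieAlgebra.ad ℂ L f)) (h : ⁅e, y⁆ = 0) (h' : ⁅f, y⁆ = 0) :
    weylLift he hf y = y := by
  rw [weylLift_apply, expAd_apply_of_lie_eq_zero he h,
    expAd_apply_of_lie_eq_zero (isNilpotent_ad_neg hf) (by simp [h']),
    expAd_apply_of_lie_eq_zero he h]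

variable {h e f : L}

theorem weylLift_apply_e (t : IsSl2Triple h e f) (he : IsNilpotent (LieAlgebra.ad ℂ L e))
    (hf : IsNilpotent (LieAlgebra.ad ℂ L f)) : weylLift he hf e = -f := by
  have h1 : ⁅e, f⁆ = h := t.lie_e_f
  have h2 : ⁅h, e⁆ = (2 : ℂ) • e := t.lie_h_e_smul ℂ
  have h3 : ⁅h, f⁆ = -((2 : ℂ) • f) := t.lie_lie_smul_f ℂ
  have h4 : ⁅f, e⁆ = -h := by rw [← h1, lie_skew]
  have h5 : ⁅e, h⁆ = -((2 : ℂ) • e) := by rw [← h2, lie_skew]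
  have h6 : ⁅f, h⁆ = (2 : ℂ) • f := by rw [← neg_neg ((2 : ℂ) • f), ← h3, lie_skew]
  have ef : expAd he f = f + h - e := by
    rw [expAd_apply_of_cube he (by simp [h1, h5])]
    simp only [h1, h5]; module
  have eh : expAd he h = h - (2 : ℂ) • e := by
    rw [expAd_apply_of_cube he (by simp [h5])]
    simp only [h5, lie_neg, lie_smul, lie_self]; module
  have ee : expAd he e = e := expAd_apply_of_lie_eq_zero he (lie_self e)
  have fe : expAd (isNilpotent_ad_neg hf) e = e + h - f := by
    rw [expAd_apply_of_cube _ (by simp [h4, h6])]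
    simp only [neg_lie, lie_neg, h4, h6]; module
  rw [weylLift_apply, ee, fe, map_sub, map_add, ee, eh, ef]
  module

/-- This is why the product of three exponentials lifts a reflection: for x in the Cartan subalgebra
and c = α(x), h the coroot, the right-hand side is the coreflection of x. -/
theorem weylLift_apply_of_weight (t : IsSl2Triple h e f) (he : IsNilpotent (LieAlgebra.ad ℂ L e))
    (hf : IsNilpotent (LieAlgebra.ad ℂ L f)) {x : L} {c : ℂ} (hxe : ⁅x, e⁆ = c • e)
    (hxf : ⁅x, f⁆ = -(c • f)) : weylLift he hf x = x - c • h := by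
  have h1 : ⁅e, f⁆ = h := t.lie_e_f
  have h2 : ⁅h, e⁆ = (2 : ℂ) • e := t.lie_h_e_smul ℂ
  have h3 : ⁅h, f⁆ = -((2 : ℂ) • f) := t.lie_lie_smul_f ℂ
  have h4 : ⁅f, e⁆ = -h := by rw [← h1, lie_skew]
  have h5 : ⁅e, h⁆ = -((2 : ℂ) • e) := by rw [← h2, lie_skew]
  have h6 : ⁅f, h⁆ = (2 : ℂ) • f := by rw [← neg_neg ((2 : ℂ) • f), ← h3, lie_skew]
  have h7 : ⁅e, x⁆ = -(c • e) := by rw [← hxe, lie_skew]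
  have h8 : ⁅f, x⁆ = c • f := by rw [← neg_neg (c • f), ← hxf, lie_skew]
  have ex : expAd he x = x - c • e := by
    rw [expAd_apply_of_cube he (by simp [h7])]
    simp only [h7, lie_neg, lie_smul, lie_self]; module
  have ee : expAd he e = e := expAd_apply_of_lie_eq_zero he (lie_self e)
  have ef : expAd he f = f + h - e := by
    rw [expAd_apply_of_cube he (by simp [h1, h5])]
    simp only [h1, h5]; module
  have eh : expAd he h = h - (2 : ℂ) • e := by
    rw [expAd_apply_of_cube he (by simp [h5])]
    simp only [h5, lie_neg, lie_smul, lie_self]; module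
  have fx : expAd (isNilpotent_ad_neg hf) x = x - c • f := by
    rw [expAd_apply_of_cube _ (by simp [h8])]
    simp only [h8, neg_lie, lie_neg, lie_smul, lie_self]; module
  have fe : expAd (isNilpotent_ad_neg hf) e = e + h - f := by
    rw [expAd_apply_of_cube _ (by simp [h4, h6])]
    simp only [neg_lie, lie_neg, h4, h6]; module
  rw [weylLift_apply, ex, map_sub, map_smul, fx, fe]
  simp only [map_sub, map_add, map_smul, ex, ee, ef, eh]
  module

/-- Write W for the lift. Since W e = -f, conjugation by W turns exp(ad e) into exp(-ad f).
Comparing both sides on y = exp(ad e) z gives the identity. It makes W commute with a conjugation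
that exchanges e and -f. -/
theorem weylLift_neg_f_neg_e (t : IsSl2Triple h e f) (he : IsNilpotent (LieAlgebra.ad ℂ L e))
    (hf : IsNilpotent (LieAlgebra.ad ℂ L f)) (y : L) :
    weylLift (isNilpotent_ad_neg hf) (isNilpotent_ad_neg he) y = weylLift he hf y := by
  have key (z : L) : weylLift he hf (expAd he z) =
      expAd (isNilpotent_ad_neg hf) (weylLift he hf z) :=
    map_expAd he (isNilpotent_ad_neg hf) ((weylLift he hf).toLieHom : L →+ L)
      (fun y z ↦ LieEquiv.map_lie (weylLift he hf) y z) (weylLift_apply_e t he hf) z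
  obtain ⟨z, rfl⟩ := (expAd he).surjective y
  have hz (w : L) : expAd (isNilpotent_ad_neg (isNilpotent_ad_neg he)) w = expAd he w := by
    rw [expAd_apply, expAd_apply, neg_neg]
  change weylLift _ _ (expAd he z) = weylLift he hf (expAd he z)
  rw [key, weylLift_apply, weylLift_apply, hz]

end ExpAd

open LieAlgebra LieModule

/-! ### Root space decomposition and torus automorphisms. -/

section RootDecomposition

variable {L : Type*} [LieRing L] [LieAlgebra ℂ L] {H : LieSubalgebra ℂ L}
  [H.IsCartanSubalgebra]

theorem mem_rootSpace_of_forall {α : H → ℂ} {x : L} (h : ∀ y : H, ⁅(y : L), x⁆ = α y • x) :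
    x ∈ rootSpace H α := by
  apply weightSpace_le_genWeightSpace
  rw [mem_weightSpace]
  exact h

variable [FiniteDimensional ℂ L]

/-- An additive predicate on `L` that holds on all weight spaces holds everywhere. -/
theorem induction_rootSpace {p : L → Prop} (hadd : ∀ x y, p x → p y → p (x + y))
    (hw : ∀ (α : Weight ℂ H L), ∀ x ∈ rootSpace H α, p x) (h0 : p 0) (x : L) : p x := by
  have hx : x ∈ ⨆ α : Weight ℂ H L, (rootSpace H α).toSubmodule := by
    rw [← LieSubmodule.iSup_toSubmodule, iSup_genWeightSpace_eq_top' ℂ H L]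
    trivial
  exact Submodule.iSup_induction (motive := p) _ hx (fun α x hx ↦ hw α x hx) h0 hadd

theorem mem_rootSpace_zero_iff {x : L} : x ∈ rootSpace H (0 : H → ℂ) ↔ x ∈ H := by
  rw [rootSpace_zero_eq]; rfl

variable [IsKilling ℂ L]

theorem lie_eq_smul_of_mem {α : Weight ℂ H L} {x : L} (hx : x ∈ rootSpace H α) (y : H) :
    ⁅(y : L), x⁆ = α y • x :=
  IsKilling.lie_eq_smul_of_mem_rootSpace hx y

/-- Functional calculus for `ad u`. -/
theorem exists_map_eq_smul (G : ℂ → ℂ) (u : H) : ∃ D : L →ₗ[ℂ] L,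
    ∀ α : Weight ℂ H L, ∀ x ∈ rootSpace H α, D x = G (α u) • x := by
  classical
  have := Fintype.ofFinite (Weight ℂ H L)
  set s : Finset ℂ := Finset.univ.image fun α : Weight ℂ H L ↦ α u
  -- ad u is diagonalizable with finitely many eigenvalues α(u), so a polynomial interpolating G at
  -- these values realizes G(ad u).
  refine ⟨Polynomial.aeval (ad ℂ L (u : L)) (Lagrange.interpolate s id G),
    fun α x hx ↦ ?_⟩
  have he : (ad ℂ L (u : L)).HasEigenvector (α u) x ∨ x = 0 := by
    rcases eq_or_ne x 0 with h | h
    · exact Or.inr h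
    · exact Or.inl ⟨Module.End.mem_eigenspace_iff.mpr (lie_eq_smul_of_mem hx u), h⟩
  rcases he with he | rfl
  · rw [Module.End.aeval_apply_of_hasEigenvector he]
    congr 1
    exact Lagrange.eval_interpolate_at_node (v := id) _ (Set.injOn_id _)
      (Finset.mem_image_of_mem _ (Finset.mem_univ α))
  · simp

/-- The linear map that acts on the root space of `α` as multiplication by `exp (α u)`. -/
noncomputable def torusMap (u : H) : L →ₗ[ℂ] L := (exists_map_eq_smul Complex.exp u).choose

theorem torusMap_apply {u : H} {α : Weight ℂ H L} {x : L} (hx : x ∈ rootSpace H α) :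
    torusMap u x = Complex.exp (α u) • x :=
  (exists_map_eq_smul Complex.exp u).choose_spec α x hx

theorem torusMap_neg_apply (u : H) (x : L) : torusMap (-u) (torusMap u x) = x := by
  induction x using induction_rootSpace (H := H) with
  | hadd x y hx hy => simp [hx, hy]
  | h0 => simp
  | hw α x hx =>
    rw [torusMap_apply hx, map_smul, torusMap_apply hx, smul_smul, ← Complex.exp_add]
    simp

/-- The bracket of root vectors for α and β is either zero or lies in the root space of a genuine
weight α + β, and the exponential turns the sum into a product. -/
theorem torusMap_lie (u : H) (x y : L) : torusMap u ⁅x, y⁆ = ⁅torusMap u x, torusMap u y⁆ := by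
  induction x using induction_rootSpace (H := H) with
  | hadd x x' hx hx' => simp [hx, hx']
  | h0 => simp
  | hw α x hx =>
    induction y using induction_rootSpace (H := H) with
    | hadd y y' hy hy' => simp [hy, hy']
    | h0 => simp
    | hw β y hy =>
      rw [torusMap_apply hx, torusMap_apply hy, smul_lie, lie_smul, smul_smul, ← Complex.exp_add]
      have hxy : ⁅x, y⁆ ∈ rootSpace H (α + β : H → ℂ) :=
        lie_mem_genWeightSpace_of_mem_genWeightSpace hx hy
      rcases eq_or_ne ⁅x, y⁆ 0 with h | h
      · simp [h]
      · let γ : Weight ℂ H L := ⟨α + β, fun hb ↦ h (by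
          rw [rootSpace, hb] at hxy; simpa using hxy)⟩
        exact torusMap_apply (α := γ) hxy

/-- The automorphism that acts on the root space of `α` as multiplication by `exp (α u)`. -/
noncomputable def torusAut (u : H) : L ≃ₗ⁅ℂ⁆ L :=
  { torusMap u with
    map_lie' := torusMap_lie u _ _
    invFun := torusMap (-u)
    left_inv := torusMap_neg_apply u
    right_inv := fun x ↦ by simpa using torusMap_neg_apply (-u) x }

theorem torusAut_apply {u : H} {α : Weight ℂ H L} {x : L} (hx : x ∈ rootSpace H α) :
    torusAut u x = Complex.exp (α u) • x :=
  torusMap_apply hx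

theorem torusAut_apply_of_mem {u : H} {x : L} (hx : x ∈ H) : torusAut u x = x := by
  rcases eq_or_ne x 0 with rfl | h
  · simp
  have hx' : x ∈ rootSpace H (0 : H → ℂ) := mem_rootSpace_zero_iff.mpr hx
  let γ : Weight ℂ H L := ⟨0, fun hb ↦ h (by rw [rootSpace, hb] at hx'; simpa using hx')⟩
  rw [torusAut_apply (α := γ) hx']
  change Complex.exp 0 • x = x
  simp

end RootDecomposition

/-! ### Conjugation with respect to a compact real form. -/

section CompactConjugation

variable {L : Type*} [LieRing L] [LieAlgebra ℂ L]

/-- `θ` is the conjugation of `L` with respect to a compact real form, and it preserves `H`. -/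
structure IsCompactConj (H : LieSubalgebra ℂ L) (θ : L →+ L) : Prop where
  conj_lie : ∀ x y, θ ⁅x, y⁆ = ⁅θ x, θ y⁆
  conj_smul : ∀ (c : ℂ) (x), θ (c • x) = starRingEnd ℂ c • θ x
  invol : ∀ x, θ (θ x) = x
  map_mem : ∀ x ∈ H, θ x ∈ H
  killing_neg : ∀ x, x ≠ 0 → ∃ r : ℝ, r < 0 ∧ killingForm ℂ L x (θ x) = r

namespace IsCompactConj

variable [FiniteDimensional ℂ L] [IsKilling ℂ L]
  {H : LieSubalgebra ℂ L} [H.IsCartanSubalgebra] {θ : L →+ L}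

theorem lie_conj_of_mem (hθ : IsCompactConj H θ) {α : Weight ℂ H L} {e : L}
    (he : e ∈ rootSpace H α) (y : H) :
    ⁅(y : L), θ e⁆ = starRingEnd ℂ (α ⟨θ y, hθ.map_mem y y.2⟩) • θ e := by
  rw [← hθ.conj_smul, ← lie_eq_smul_of_mem he, hθ.conj_lie, hθ.invol]

/-- Invariance of the Killing form on the pair e, θe compares the eigenvalues of y on e and on θe,
and κ(e, θe) ≠ 0 by definiteness. In other words, roots are imaginary on the real form. -/
theorem star_apply (hθ : IsCompactConj H θ) (α : Weight ℂ H L) (y : H) :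
    starRingEnd ℂ (α ⟨θ y, hθ.map_mem y y.2⟩) = -α y := by
  obtain ⟨e, he, he0⟩ := α.exists_ne_zero
  obtain ⟨r, hr, hre⟩ := hθ.killing_neg e he0
  have h3 : killingForm ℂ L ⁅e, (y : L)⁆ (θ e) = killingForm ℂ L e ⁅(y : L), θ e⁆ :=
    LieModule.traceForm_apply_lie_apply ℂ _ _ _ _ _
  rw [← lie_skew, lie_eq_smul_of_mem he, hθ.lie_conj_of_mem he] at h3
  simp only [map_neg, map_smul, LinearMap.neg_apply, LinearMap.smul_apply, hre, smul_eq_mul] at h3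
  have hr' : (r : ℂ) ≠ 0 := by exact_mod_cast hr.ne
  apply mul_right_cancel₀ hr'
  linear_combination -h3

theorem mem_rootSpace_neg (hθ : IsCompactConj H θ) {α : Weight ℂ H L} {e : L}
    (he : e ∈ rootSpace H α) : θ e ∈ rootSpace H (-α : H → ℂ) :=
  mem_rootSpace_of_forall fun y ↦ by
    rw [hθ.lie_conj_of_mem he, hθ.star_apply]; rfl

/-- The conjugation exchanges the root spaces of α and -α, so f can be taken proportional to θe.
Negativity of κ(x, θx) gives the sign that lets a real rescaling of e achieve f = -θe exactly. -/
theorem exists_isSl2Triple (hθ : IsCompactConj H θ) {α : Weight ℂ H L} (hα : α.IsNonZero) :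
    ∃ e ∈ rootSpace H α, IsSl2Triple (IsKilling.coroot α : L) e (-θ e) := by
  obtain ⟨e, he, he0⟩ := α.exists_ne_zero
  obtain ⟨r, hr, hre⟩ := hθ.killing_neg e he0
  have hr' : (r : ℂ) ≠ 0 := by exact_mod_cast hr.ne
  have hf := hθ.mem_rootSpace_neg he
  have hef := IsKilling.lie_eq_killingForm_smul_of_mem_rootSpace_of_mem_rootSpace_neg he hf
  set a : H := (IsKilling.cartanEquivDual H).symm α with ha
  have haa : α a ≠ 0 := IsKilling.root_apply_cartanEquivDual_symm_ne_zero hα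
  have ha0 : (a : L) ≠ 0 := by
    intro h
    exact haa (by rw [show a = 0 from Subtype.ext h, map_zero])
  rw [hre] at hef
  have hta : θ a = -(a : L) := by
    have h1 : θ ⁅e, θ e⁆ = -⁅e, θ e⁆ := by rw [hθ.conj_lie, hθ.invol, lie_skew]
    rw [hef, hθ.conj_smul, ← smul_neg, Complex.conj_ofReal] at h1
    exact (smul_right_inj hr').mp h1
  obtain ⟨s, hs, hsa⟩ := hθ.killing_neg a ha0
  have hsa' : α a = ((-s : ℝ) : ℂ) := by
    have h1 : killingForm ℂ L ⁅e, θ e⁆ a = killingForm ℂ L e ⁅θ e, (a : L)⁆ :=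
      LieModule.traceForm_apply_lie_apply ℂ _ _ _ _ _
    have h2 : ⁅θ e, (a : L)⁆ = α a • θ e := by
      rw [← lie_skew, hθ.lie_conj_of_mem he, hθ.star_apply, neg_smul, neg_neg]
    rw [h2, hef, map_smul, map_smul, LinearMap.smul_apply, hre, smul_eq_mul, smul_eq_mul] at h1
    rw [hta, map_neg] at hsa
    have h3 : killingForm ℂ L a a = -(s : ℂ) := by linear_combination -hsa
    rw [h3] at h1
    apply mul_right_cancel₀ hr'
    push_cast
    linear_combination -h1
  have hpos : 0 < 2 / (r * s) := div_pos two_pos (mul_pos_of_neg_of_neg hr hs)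
  -- After scaling e by c the bracket becomes h = -c²r·a. As α(a) = -s, the condition α(h) = 2 reads
  -- c²rs = 2, and rs > 0.
  set c : ℝ := Real.sqrt (2 / (r * s)) with hc
  have hcc : (c : ℂ) * c * (r * s) = 2 := by
    have : c * c * (r * s) = 2 := by
      rw [Real.mul_self_sqrt hpos.le]
      field_simp [hr.ne, hs.ne]
    exact_mod_cast this
  have hc0 : (c : ℂ) ≠ 0 := by rintro h; rw [h] at hcc; simp at hcc
  have hθc : θ ((c : ℂ) • e) = (c : ℂ) • θ e := by rw [hθ.conj_smul, Complex.conj_ofReal]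
  have hmem : (c : ℂ) • e ∈ rootSpace H α := Submodule.smul_mem _ _ he
  have hmem' : -θ ((c : ℂ) • e) ∈ rootSpace H (-α : H → ℂ) := by
    rw [hθc]; exact neg_mem (Submodule.smul_mem _ _ hf)
  have hlie : ⁅(c : ℂ) • e, -θ ((c : ℂ) • e)⁆ = (-(c * c * r) : ℂ) • (a : L) := by
    rw [hθc, lie_neg, lie_smul, smul_lie, hef]; module
  have h2 : α ((-(c * c * r) : ℂ) • a) = 2 := by
    rw [map_smul, hsa', smul_eq_mul]; push_cast; linear_combination hcc
  have ht : IsSl2Triple (((-(c * c * r) : ℂ) • a : H) : L) ((c : ℂ) • e) (-θ ((c : ℂ) • e)) := by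
    refine ⟨?_, hlie, ?_, ?_⟩
    · intro h
      rw [show (-(c * c * r) : ℂ) • a = 0 from Subtype.ext h] at h2
      simp at h2
    · rw [lie_eq_smul_of_mem hmem, h2, ofNat_smul_eq_nsmul]
    · rw [lie_neg, hθ.lie_conj_of_mem hmem, hθ.star_apply, h2, neg_smul, ofNat_smul_eq_nsmul,
        smul_neg, neg_neg]
  exact ⟨_, hmem, by rwa [← ht.h_eq_coroot hα hmem hmem']⟩

theorem torusAut_comm (hθ : IsCompactConj H θ) {u : H}
    (hu : ∀ α : Weight ℂ H L, starRingEnd ℂ (Complex.exp (α u)) = Complex.exp (-α u)) (x : L) :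
    θ (torusAut u x) = torusAut u (θ x) := by
  induction x using induction_rootSpace (H := H) with
  | hadd x y hx hy => simp [hx, hy]
  | h0 => simp
  | hw α x hx =>
    rw [torusAut_apply hx, torusAut_apply (α := -α) (hθ.mem_rootSpace_neg hx), hθ.conj_smul, hu]
    rfl

end IsCompactConj

end CompactConjugation

/-! ### Involutive lifts of Weyl group elements. -/

open LieAlgebra LieModule

section Lifts

variable {L : Type*} [LieRing L] [LieAlgebra ℂ L] [FiniteDimensional ℂ L]
  {H : LieSubalgebra ℂ L} [H.IsCartanSubalgebra]

theorem isNilpotent_ad_of_mem_rootSpace {α : Weight ℂ H L} (hα : α.IsNonZero) {x : L}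
    (hx : x ∈ rootSpace H α) : IsNilpotent (ad ℂ L x) :=
  LieAlgebra.isNilpotent_ad_of_mem_rootSpace H (fun h ↦ hα h) hx

variable [IsKilling ℂ L] {θ : L →+ L}

/-- The root space of a nonzero linear form that is not a root is zero. -/
theorem eq_zero_of_mem_rootSpace {φ : Module.Dual ℂ H} (h0 : φ ≠ 0)
    (hφ : φ ∉ Set.range (IsKilling.rootSystem H).root) {x : L} (hx : x ∈ rootSpace H φ) :
    x = 0 := by
  by_contra h
  let γ : Weight ℂ H L := ⟨φ, fun hb ↦ h (by rw [rootSpace, hb] at hx; simpa using hx)⟩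
  have hγ : γ ∈ H.root := by
    simp only [LieSubalgebra.root, Finset.mem_filter, Finset.mem_univ, true_and]
    intro h
    apply h0
    ext y
    exact congrFun h y
  exact hφ ⟨⟨γ, hγ⟩, by ext y; rfl⟩

/-- For distinct simple roots the αₖ-string through αⱼ starts at αⱼ, and its length is the negative
of their Cartan integer. When they are orthogonal the sum is therefore not a root. -/
theorem lie_eq_zero_of_orthogonal (b : (IsKilling.rootSystem H).Base) {j k : b.support}
    (hjk : j ≠ k) (h : b.cartanMatrix j k = 0) {x y : L} (hx : x ∈ rootSpace H j.1.1)
    (hy : y ∈ rootSpace H k.1.1) : ⁅x, y⁆ = 0 := by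
  have hxy : ⁅x, y⁆ ∈ rootSpace H (j.1.1 + k.1.1 : H → ℂ) :=
    lie_mem_genWeightSpace_of_mem_genWeightSpace hx hy
  refine eq_zero_of_mem_rootSpace
    (φ := (IsKilling.rootSystem H).root j + (IsKilling.rootSystem H).root k) ?_ ?_ hxy
  · have := b.root_ne_neg_of_ne j.2 k.2 (fun h ↦ hjk (Subtype.ext h))
    rwa [ne_eq, ← eq_neg_iff_add_eq_zero]
  · have hli := b.linearIndependent_pair_of_ne hjk.symm
    have h1 := RootPairing.root_add_zsmul_mem_range_iff hli (z := 1)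
    rw [one_smul] at h1
    rw [h1, RootPairing.Base.chainBotCoeff_eq_zero]
    have h2 := RootPairing.Base.chainTopCoeff_eq_of_ne (b := b) hjk.symm
    have h3 : (IsKilling.rootSystem H).pairingIn ℤ j k = 0 := h
    rw [h3] at h2
    simp at h2
    simp [h2]

theorem lie_eq_zero_of_neg (b : (IsKilling.rootSystem H).Base) {j k : b.support}
    (hjk : j ≠ k) {x y : L} (hx : x ∈ rootSpace H j.1.1)
    (hy : y ∈ rootSpace H (-k.1.1 : H → ℂ)) : ⁅x, y⁆ = 0 := by
  have hxy : ⁅x, y⁆ ∈ rootSpace H (j.1.1 + -k.1.1 : H → ℂ) :=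
    lie_mem_genWeightSpace_of_mem_genWeightSpace hx hy
  rw [← sub_eq_add_neg] at hxy
  refine eq_zero_of_mem_rootSpace
    (φ := (IsKilling.rootSystem H).root j - (IsKilling.rootSystem H).root k) ?_ ?_ hxy
  · rw [sub_ne_zero]
    exact fun h ↦ hjk (Subtype.ext ((IsKilling.rootSystem H).root.injective h))
  · exact b.sub_notMem_range_root j.2 k.2

/-- An element of the Cartan subalgebra on which the simple roots take given values. -/
theorem exists_apply_simple_eq (b : (IsKilling.rootSystem H).Base) (v : b.support → ℂ) :
    ∃ u : H, ∀ j : b.support, (IsKilling.rootSystem H).root j u = v j := by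
  let ψ : Module.Dual ℂ (Module.Dual ℂ H) := b.toWeightBasis.constr ℂ v
  refine ⟨(Module.evalEquiv ℂ H).symm ψ, fun j ↦ ?_⟩
  have h1 : ψ ((IsKilling.rootSystem H).root j) = v j := by
    rw [← b.toWeightBasis_apply, Module.Basis.constr_basis]
  rw [← h1, Module.apply_evalEquiv_symm_apply]

theorem exists_int_apply (b : (IsKilling.rootSystem H).Base) {u : H} {c : ℂ}
    (hu : ∀ j : b.support, ∃ n : ℤ, (IsKilling.rootSystem H).root j u = n * c)
    (α : Weight ℂ H L) : ∃ n : ℤ, α u = n * c := by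
  by_cases hα : α.IsZero
  · exact ⟨0, by rw [hα]; simp⟩
  have hα' : α ∈ H.root := by simpa [LieSubalgebra.root] using hα
  obtain ⟨f, -, -, hf⟩ := b.exists_root_eq_sum_int ⟨α, hα'⟩
  choose n hn using hu
  have h1 : α u = (IsKilling.rootSystem H).root ⟨α, hα'⟩ u := rfl
  refine ⟨∑ j : b.support, f j * n j, ?_⟩
  rw [h1, hf, ← Finset.sum_coe_sort, LinearMap.sum_apply, Int.cast_sum, Finset.sum_mul]
  refine Finset.sum_congr rfl fun j _ ↦ ?_
  rw [LinearMap.smul_apply, hn, zsmul_eq_mul]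
  push_cast; ring

/-- The maps n lift the simple reflections, and D is trivial on H. The relation n D n = D is a
substitute for n² = 1, which fails in general; it says that D n is an involution. -/
theorem exists_simple_lifts (hθ : IsCompactConj H θ) (b : (IsKilling.rootSystem H).Base) :
    ∃ (n : b.support → L ≃ₗ⁅ℂ⁆ L) (D : L ≃ₗ⁅ℂ⁆ L),
      (∀ j y, θ (n j y) = n j (θ y)) ∧
      (∀ j (y : H), n j y = ((IsKilling.rootSystem H).coreflection j y : H)) ∧
      (∀ j k, j ≠ k → b.cartanMatrix j k = 0 → ∀ y, n j (n k y) = n k (n j y)) ∧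
      (∀ y, θ (D y) = D (θ y)) ∧ (∀ y : H, D y = y) ∧ (∀ y, D (D y) = y) ∧
      ∀ j y, n j (D (n j y)) = D y := by
  let _ : LieAlgebra ℚ L :=
    { Module.compHom L (algebraMap ℚ ℂ) with
      lie_smul := fun c x y ↦ lie_smul (algebraMap ℚ ℂ c) x y }
  -- With the value πi on each simple root, exp(α(u)) is 1 or -1 according to the parity of the
  -- height of α.
  obtain ⟨u, hu⟩ := exists_apply_simple_eq b fun _ ↦ (Real.pi : ℂ) * Complex.I
  have hu_int := exists_int_apply b (u := u) (c := (Real.pi : ℂ) * Complex.I)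
    fun j ↦ ⟨1, by rw [hu]; simp⟩
  have hnz (j : b.support) : j.1.1.IsNonZero := LieSubalgebra.isNonZero_coe_root j.1
  choose e hmem htri using fun j : b.support ↦ hθ.exists_isSl2Triple (hnz j)
  have hfmem (j : b.support) : -θ (e j) ∈ rootSpace H (-j.1.1 : Weight ℂ H L) :=
    neg_mem (hθ.mem_rootSpace_neg (hmem j))
  have hen (j : b.support) := isNilpotent_ad_of_mem_rootSpace (hnz j) (hmem j)
  have hfn (j : b.support) := isNilpotent_ad_of_mem_rootSpace (hnz j).neg (hfmem j)
  have hDe (j : b.support) : torusAut u (e j) = -e j := by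
    rw [torusAut_apply (hmem j), show j.1.1 u = _ from hu j, Complex.exp_pi_mul_I, neg_smul,
      one_smul]
  have hDf (j : b.support) : torusAut u (-θ (e j)) = -(-θ (e j)) := by
    rw [torusAut_apply (hfmem j), show (-j.1.1 : Weight ℂ H L) u = -(Real.pi * Complex.I) from
      congrArg Neg.neg (hu j), Complex.exp_neg, Complex.exp_pi_mul_I, inv_neg, inv_one, neg_smul,
      one_smul]
  refine ⟨fun j ↦ weylLift (hen j) (hfn j), torusAut u, fun j y ↦ ?_, fun j y ↦ ?_,
    fun j k hjk h y ↦ ?_, ?_, fun y ↦ torusAut_apply_of_mem y.2, fun y ↦ ?_, fun j y ↦ ?_⟩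
  · rw [← weylLift_neg_f_neg_e (htri j) (hen j) (hfn j) (θ y)]
    refine map_weylLift _ _ _ _ θ hθ.conj_lie (by simp) ?_ y
    rw [map_neg, hθ.invol]
  · rw [weylLift_apply_of_weight (htri j) (hen j) (hfn j) (x := y) (c := j.1.1 y)
      (lie_eq_smul_of_mem (hmem j) y), RootPairing.coreflection_apply]
    · rfl
    · rw [lie_eq_smul_of_mem (hfmem j) y]
      simp
  · have hkj : b.cartanMatrix k j = 0 := b.cartanMatrix_apply_eq_zero_iff_symm.mp h
    have hf' (k : b.support) : -θ (e k) ∈ rootSpace H (-k.1.1 : H → ℂ) := hfmem k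
    have h1 : ⁅e j, e k⁆ = 0 := lie_eq_zero_of_orthogonal b hjk h (hmem j) (hmem k)
    have h2 : ⁅e j, -θ (e k)⁆ = 0 := lie_eq_zero_of_neg b hjk (hmem j) (hf' k)
    have h3 : ⁅-θ (e j), e k⁆ = 0 := by
      rw [← lie_skew, lie_eq_zero_of_neg b hjk.symm (hmem k) (hf' j), neg_zero]
    have h4 : ⁅-θ (e j), -θ (e k)⁆ = 0 := by
      rw [neg_lie, lie_neg, neg_neg, ← hθ.conj_lie, h1, map_zero]
    exact map_weylLift _ _ _ _ ((weylLift (hen j) (hfn j)).toLieHom : L →+ L)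
      (fun y z ↦ LieEquiv.map_lie _ y z)
      (weylLift_apply_of_lie_eq_zero (hen j) (hfn j) h1 h3)
      (weylLift_apply_of_lie_eq_zero (hen j) (hfn j) h2 h4) y
  · refine hθ.torusAut_comm fun α ↦ ?_
    obtain ⟨n, hn⟩ := hu_int α
    rw [hn, ← Complex.exp_conj]
    simp
  · induction y using induction_rootSpace (H := H) with
    | hadd x y hx hy => simp [hx, hy]
    | h0 => simp
    | hw α x hx =>
      obtain ⟨n, hn⟩ := hu_int α
      rw [torusAut_apply hx, map_smul, torusAut_apply hx, smul_smul, ← Complex.exp_add, hn,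
        show (n * (Real.pi * Complex.I) + n * (Real.pi * Complex.I) : ℂ) =
          n * (2 * Real.pi * Complex.I) by ring, Complex.exp_int_mul_two_pi_mul_I, one_smul]
  -- D negates both root vectors of the triple, so conjugation by D turns n into the lift built from
  -- -e and -f, which is the inverse of n.
  · have h1 := map_weylLift (hen j) (hfn j) (isNilpotent_ad_neg (hen j))
      (isNilpotent_ad_neg (hfn j)) ((torusAut u).toLieHom : L →+ L)
      (fun y z ↦ LieEquiv.map_lie _ y z) (hDe j) (hDf j) y
    have h2 : torusAut u (weylLift (hen j) (hfn j) y) =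
      weylLift (isNilpotent_ad_neg (hen j)) (isNilpotent_ad_neg (hfn j)) (torusAut u y) := h1
    rw [h2, weylLift_apply_neg_neg]

/-- A product of commuting simple reflections, conjugated by a word in the simple reflections,
acting on the Cartan subalgebra. -/
noncomputable def conjWord {b : (IsKilling.rootSystem H).Base} (J : List b.support) :
    List b.support → (H ≃ₗ[ℂ] H)
  | [] => (J.map fun j : b.support ↦ (IsKilling.rootSystem H).coreflection j).prod
  | j :: l => (IsKilling.rootSystem H).coreflection j * conjWord J l *
      (IsKilling.rootSystem H).coreflection j

/-- The lifts of orthogonal simple reflections commute, so their product N inherits N D N = D. Hence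
D N is an involution over the product of reflections, and conjugating it by further n preserves
involutivity and compatibility with θ. -/
theorem exists_involutive_lift (hθ : IsCompactConj H θ) (b : (IsKilling.rootSystem H).Base)
    (J l : List b.support) (hJ : J.Pairwise fun j k ↦ j ≠ k ∧ b.cartanMatrix j k = 0) :
    ∃ φ : L ≃ₗ⁅ℂ⁆ L, (∀ y, θ (φ y) = φ (θ y)) ∧ (∀ y, φ (φ y) = y) ∧
      ∀ y : H, φ y = (conjWord J l y : H) := by
  obtain ⟨n, D, hnθ, hn, hcomm, hDθ, hD, hDD, hnD⟩ := exists_simple_lifts hθ b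
  induction l with
  | nil =>
    -- The third clause, commutation with the lifts of simple reflections orthogonal to all of J, is
    -- carried along only to make the induction on J work.
    have key : ∃ N : L ≃ₗ⁅ℂ⁆ L, (∀ y, θ (N y) = N (θ y)) ∧ (∀ y, N (D (N y)) = D y) ∧
        (∀ k, (∀ j ∈ J, k ≠ j ∧ b.cartanMatrix k j = 0) → ∀ y, n k (N y) = N (n k y)) ∧
        ∀ y : H, N y =
          ((J.map fun j : b.support ↦ (IsKilling.rootSystem H).coreflection j).prod y : H) := by
      induction J with
      | nil => exact ⟨LieEquiv.refl, by simp, by simp, by simp, by simp⟩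
      | cons k J ih =>
        rw [List.pairwise_cons] at hJ
        obtain ⟨N, hNθ, hND, hNc, hN⟩ := ih hJ.2
        have hk := hNc k hJ.1
        refine ⟨N.trans (n k), fun y ↦ ?_, fun y ↦ ?_, fun j hj y ↦ ?_, fun y ↦ ?_⟩
        · simp only [LieEquiv.trans_apply, hnθ, hNθ]
        · simp only [LieEquiv.trans_apply]
          rw [hk (D _), hnD, hND]
        · simp only [LieEquiv.trans_apply]
          rw [← hNc j (fun i hi ↦ hj i (List.mem_cons_of_mem _ hi))]
          have := hj k List.mem_cons_self
          rw [hcomm j k this.1 this.2]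
        · simp only [LieEquiv.trans_apply]
          rw [hN, hn]; rfl
    obtain ⟨N, hNθ, hND, -, hN⟩ := key
    refine ⟨N.trans D, fun y ↦ ?_, fun y ↦ ?_, fun y ↦ ?_⟩
    · simp only [LieEquiv.trans_apply, hDθ, hNθ]
    · simp only [LieEquiv.trans_apply]
      rw [hND, hDD]
    · simp only [LieEquiv.trans_apply]
      rw [hN, hD]; rfl
  | cons j l ih =>
    obtain ⟨φ, hφθ, hφ, hφH⟩ := ih
    have hθs (y) : θ ((n j).symm y) = (n j).symm (θ y) := by
      apply (n j).injective
      change n j (θ ((n j).symm y)) = n j ((n j).symm (θ y))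
      rw [← hnθ, LieEquiv.apply_symm_apply, LieEquiv.apply_symm_apply]
    refine ⟨((n j).symm.trans φ).trans (n j), fun y ↦ ?_, fun y ↦ ?_, fun y ↦ ?_⟩
    · simp only [LieEquiv.trans_apply, hnθ, hφθ, hθs]
    · simp only [LieEquiv.trans_apply]
      rw [LieEquiv.symm_apply_apply, hφ, LieEquiv.apply_symm_apply]
    · simp only [LieEquiv.trans_apply]
      -- A coreflection is its own inverse, so on H the inverse of n acts as n does, although n
      -- itself need not be involutive on L.
      have : (n j).symm y = ((IsKilling.rootSystem H).coreflection j y : H) := by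
        apply (n j).injective
        change n j ((n j).symm y) = n j _
        rw [LieEquiv.apply_symm_apply, hn]
        congr 1
        exact ((IsKilling.rootSystem H).coreflection_same j y).symm
      rw [this, hφH, hn]; rfl

end Lifts

/-! ### Diagrams with marks annihilated by their Cartan matrix. -/

section Marks

/-- A diagram on a finite vertex set, with off-diagonal Cartan integers `-c u v`, together with
positive marks `a` that are annihilated by its (generalized) Cartan matrix. -/
structure IsMarkedDiagram {V : Type*} [Fintype V] (c : V → V → ℕ) (a : V → ℕ) : Prop where
  ne_zero_symm : ∀ u v, c u v ≠ 0 → c v u ≠ 0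
  self : ∀ u, c u u = 0
  pos : ∀ v, 0 < a v
  sum_eq : ∀ u, ∑ v, a v * c v u = 2 * a u

/-- Every vertex is joined to `v₀` by a path of the diagram. -/
def IsConnectedFrom {V : Type*} (c : V → V → ℕ) (v₀ : V) : Prop :=
  ∀ S : Set V, v₀ ∈ S → (∀ u ∈ S, ∀ v, c u v ≠ 0 → v ∈ S) → S = Set.univ

theorem le_mark_mul {V : Type*} {c : V → V → ℕ} {a : V → ℕ} {u v : V} (h : c v u ≠ 0) :
    a v ≤ a v * c v u :=
  Nat.le_mul_of_pos_right _ (Nat.pos_of_ne_zero h)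

namespace IsMarkedDiagram

variable {V : Type*} [Fintype V] {c : V → V → ℕ} {a : V → ℕ}

theorem sum_le (h : IsMarkedDiagram c a) (u : V) (S : Finset V) :
    ∑ v ∈ S, a v * c v u ≤ 2 * a u := by
  rw [← h.sum_eq u]
  exact Finset.sum_le_sum_of_subset (Finset.subset_univ S)

/-- The engine of the classification: as long as the known neighbours of u do not account for the
full weight 2·a u, there is another neighbour. -/
theorem exists_notMem (h : IsMarkedDiagram c a) {u : V} {S : Finset V}
    (hS : ∑ v ∈ S, a v * c v u < 2 * a u) : ∃ v ∉ S, c v u ≠ 0 := by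
  by_contra! hc
  refine hS.ne ?_
  rw [← h.sum_eq u]
  exact Finset.sum_subset (Finset.subset_univ S) fun v _ hv ↦ by simp [hc v hv]

theorem le_two_mul (h : IsMarkedDiagram c a) {u v : V} (huv : c u v ≠ 0) : a v ≤ 2 * a u := by
  have h1 := h.sum_le u {v}
  rw [Finset.sum_singleton] at h1
  exact (Nat.le_mul_of_pos_right _ (Nat.pos_of_ne_zero (h.ne_zero_symm _ _ huv))).trans h1

theorem mul_le (h : IsMarkedDiagram c a) (u v : V) : a v * c v u ≤ 2 * a u := by
  simpa using h.sum_le u {v}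

theorem add_le (h : IsMarkedDiagram c a) {u v w : V} (hvw : v ≠ w) :
    a v * c v u + a w * c w u ≤ 2 * a u := by
  classical
  have := h.sum_le u {v, w}
  rwa [Finset.sum_pair hvw] at this

theorem add_add_le (h : IsMarkedDiagram c a) {u v w x : V} (hvw : v ≠ w) (hvx : v ≠ x)
    (hwx : w ≠ x) : a v * c v u + (a w * c w u + a x * c x u) ≤ 2 * a u := by
  classical
  have := h.sum_le u {v, w, x}
  rwa [Finset.sum_insert (by simp [hvw, hvx]), Finset.sum_pair hwx] at this

theorem add_add_add_le (h : IsMarkedDiagram c a) {u v w x y : V} (hvw : v ≠ w) (hvx : v ≠ x)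
    (hvy : v ≠ y) (hwx : w ≠ x) (hwy : w ≠ y) (hxy : x ≠ y) :
    a v * c v u + (a w * c w u + (a x * c x u + a y * c y u)) ≤ 2 * a u := by
  classical
  have := h.sum_le u {v, w, x, y}
  rwa [Finset.sum_insert (by simp [hvw, hvx, hvy]), Finset.sum_insert (by simp [hwx, hwy]),
    Finset.sum_pair hxy] at this

theorem exists_ne (h : IsMarkedDiagram c a) {u v : V} (hlt : a v * c v u < 2 * a u) :
    ∃ w, w ≠ v ∧ c w u ≠ 0 := by
  obtain ⟨w, hw, hw'⟩ := h.exists_notMem (u := u) (S := {v}) (by simpa using hlt)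
  exact ⟨w, by simpa using hw, hw'⟩

theorem exists_ne_ne (h : IsMarkedDiagram c a) {u v w : V}
    (hlt : a v * c v u + a w * c w u < 2 * a u) : ∃ x, x ≠ v ∧ x ≠ w ∧ c x u ≠ 0 := by
  classical
  obtain ⟨x, hx, hx'⟩ := h.exists_notMem (u := u) (S := {v, w}) (by
    refine lt_of_le_of_lt ?_ hlt
    by_cases hvw : v = w
    · simp [hvw]
    · rw [Finset.sum_pair hvw])
  simp only [Finset.mem_insert, Finset.mem_singleton, not_or] at hx
  exact ⟨x, hx.1, hx.2, hx'⟩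

theorem exists_ne_ne_ne (h : IsMarkedDiagram c a) {u v w x : V} (hvw : v ≠ w) (hvx : v ≠ x)
    (hwx : w ≠ x) (hlt : a v * c v u + (a w * c w u + a x * c x u) < 2 * a u) :
    ∃ y, y ≠ v ∧ y ≠ w ∧ y ≠ x ∧ c y u ≠ 0 := by
  classical
  obtain ⟨y, hy, hy'⟩ := h.exists_notMem (u := u) (S := {v, w, x}) (by
    rwa [Finset.sum_insert (by simp [hvw, hvx]), Finset.sum_pair hwx])
  simp only [Finset.mem_insert, Finset.mem_singleton, not_or] at hy
  exact ⟨y, hy.1, hy.2.1, hy.2.2, hy'⟩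

theorem eq_one_of_lt (h : IsMarkedDiagram c a) {u v : V} (hvu : c v u ≠ 0) (hlt : a u < a v) :
    c v u = 1 := by
  have h1 := h.mul_le u v
  by_contra hne
  have h2 : 2 ≤ c v u := by omega
  have h3 : a v * 2 ≤ a v * c v u := Nat.mul_le_mul_left _ h2
  omega

/-- A non-backtracking path joining two vertices. -/
theorem exists_path (h : IsMarkedDiagram c a) {v₀ : V} (hc : IsConnectedFrom c v₀) (i : V) :
    ∃ (p : ℕ → V) (r : ℕ), p 0 = v₀ ∧ p r = i ∧ (∀ j < r, c (p j) (p (j + 1)) ≠ 0) ∧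
      ∀ j, j + 2 ≤ r → p j ≠ p (j + 2) := by
  let G : SimpleGraph V :=
    { Adj := fun u v ↦ c u v ≠ 0
      symm := ⟨fun u v huv ↦ h.ne_zero_symm u v huv⟩
      loopless := ⟨fun u hu ↦ hu (h.self u)⟩ }
  have hreach : i ∈ {v | G.Reachable v₀ v} := by
    rw [hc {v | G.Reachable v₀ v} (SimpleGraph.Reachable.refl _) fun u hu v huv ↦
      SimpleGraph.Reachable.trans hu (SimpleGraph.Adj.reachable (G := G) huv)]
    trivial
  classical
  obtain ⟨w⟩ := hreach
  -- A walk without repeated vertices does not backtrack.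
  set q := w.bypass
  refine ⟨q.getVert, q.length, q.getVert_zero, q.getVert_length,
    fun j hj ↦ q.adj_getVert_succ hj, fun j hj heq ↦ ?_⟩
  have := w.bypass_isPath.getVert_injOn (show j ∈ {n | n ≤ q.length} by simp; omega)
    (show j + 2 ∈ {n | n ≤ q.length} from hj) heq
  omega

/-- A diagram that has the mark `1` at `v₀` and the mark `4` somewhere starts with a chain with
marks `1, 2, 3, 4`. -/
theorem exists_chain (h : IsMarkedDiagram c a) {v₀ i : V} (hc : IsConnectedFrom c v₀)
    (h0 : a v₀ = 1) (hi : a i = 4) :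
    ∃ x₂ x₃ x₄, a x₂ = 2 ∧ a x₃ = 3 ∧ a x₄ = 4 ∧ c v₀ x₂ ≠ 0 ∧ c x₂ x₃ ≠ 0 ∧ c x₃ x₄ ≠ 0 := by
  obtain ⟨p, r, hp0, hpr, hadj, hne⟩ := h.exists_path hc i
  -- Marks are concave along a path that does not backtrack. Hence once they fail to increase they
  -- never increase again.
  have hstep (j : ℕ) (hj : j + 2 ≤ r) :
      a (p j) + a (p (j + 2)) ≤ 2 * a (p (j + 1)) := by
    have h1 := h.add_le (u := p (j + 1)) (hne j hj)
    have h2 := le_mark_mul (a := a) (hadj j (by omega))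
    have h3 := le_mark_mul (a := a) (h.ne_zero_symm _ _ (hadj (j + 1) (by omega)))
    change a (p (j + 2)) ≤ a (p (j + 2)) * c (p (j + 2)) (p (j + 1)) at h3
    omega
  have hdesc (j : ℕ) (hle : a (p (j + 1)) ≤ a (p j)) (l : ℕ) (hl : j + 1 + l ≤ r) :
      a (p (j + 1 + l)) ≤ a (p (j + l)) ∧ a (p (j + 1 + l)) ≤ a (p (j + 1)) := by
    induction l with
    | zero => exact ⟨hle, le_rfl⟩
    | succ l ih =>
      have h1 := ih (by omega)
      have h2 := hstep (j + l) (by omega)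
      rw [show j + 1 + (l + 1) = j + l + 2 by omega, show j + (l + 1) = j + l + 1 by omega]
      rw [show j + 1 + l = j + l + 1 by omega] at h1
      omega
  -- A non-increasing step to a mark below 4 would keep the rest of the path below 4, yet the path
  -- ends at mark 4.
  have hend (j : ℕ) (hj : j + 1 ≤ r) (hlt : a (p (j + 1)) < 4) : a (p j) < a (p (j + 1)) := by
    by_contra! hle
    have := (hdesc j hle (r - (j + 1)) (by omega)).2
    rw [show j + 1 + (r - (j + 1)) = r by omega, hpr, hi] at this
    omega
  have hr (j : ℕ) (hj : j ≤ r) (hlt : a (p j) < 4) : j + 1 ≤ r := by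
    rcases hj.lt_or_eq with hj | hj
    · exact hj
    · rw [hj, hpr] at hlt; omega
  have hp0' : a (p 0) = 1 := by rw [hp0, h0]
  have r1 : 1 ≤ r := hr 0 (by omega) (by omega)
  have a1 : a (p 1) = 2 := by
    have h1 := h.mul_le (p 0) (p 1)
    have h2 := le_mark_mul (a := a) (h.ne_zero_symm _ _ (hadj 0 (by omega)))
    have h3 := hend 0 r1
    simp only [zero_add] at h2 h3
    omega
  have r2 : 2 ≤ r := hr 1 r1 (by omega)
  have a2 : a (p 2) = 3 := by
    have h1 := hstep 0 r2
    have h3 := hend 1 r2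
    simp only [zero_add, Nat.reduceAdd] at h1 h3
    omega
  have r3 : 3 ≤ r := hr 2 r2 (by omega)
  have a3 : a (p 3) = 4 := by
    have h1 := hstep 1 r3
    have h3 := hend 2 r3
    simp only [Nat.reduceAdd] at h1 h3
    omega
  exact ⟨p 1, p 2, p 3, a1, a2, a3, hp0 ▸ hadj 0 (by omega), hadj 1 (by omega), hadj 2 (by omega)⟩

/-- In a chain with increasing marks beyond `7`, the marks go on increasing. -/
theorem exists_succ_of_seven_le (h : IsMarkedDiagram c a) {u v : V} {k : ℕ} (hk : 7 ≤ k)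
    (hu : a u + 1 = k) (hv : a v = k) (huv : c u v ≠ 0) : ∃ w, a w = k + 1 ∧ c v w ≠ 0 := by
  -- The neighbours of v other than u carry weight k + 1 if the edge from u is simple, and each has
  -- mark at least k/2. Without a mark k + 1, this weight must split into two nearly equal halves,
  -- which `hsub` forbids.
  by_contra! hcon
  have hnbr (w : V) (hw : c w v ≠ 0) : a w ≠ k + 1 := fun h' ↦
    h.ne_zero_symm _ _ hw (hcon w h')
  have hhalf (w : V) (hw : c w v ≠ 0) : k ≤ 2 * a w := hv ▸ h.le_two_mul hw
  -- If 2·a w were k + 1 or k + 2, then w would have a further neighbour y with a y ≤ 2·a w - k ≤ 2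
  -- and a w ≤ 2·a y, which is impossible for k ≥ 7. For k = 6 this is the branch 6, 4, 2 of E₈.
  have hsub (w : V) (hw : c w v ≠ 0) : 2 * a w ≤ k ∨ k + 2 < 2 * a w := by
    by_contra! hcon'
    obtain ⟨h1, h2⟩ := hcon'
    have hd : c v w = 1 := by
      have h3 := h.mul_le w v
      by_contra hne
      have h4 : 2 ≤ c v w := by
        have := h.ne_zero_symm _ _ hw
        omega
      have h5 : a v * 2 ≤ a v * c v w := Nat.mul_le_mul_left _ h4
      omega
    obtain ⟨y, hyv, hy⟩ := h.exists_ne (u := w) (v := v) (by rw [hd, hv]; omega)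
    have h3 := h.add_le (u := w) hyv
    have h4 := le_mark_mul (a := a) hy
    have h5 := h.le_two_mul hy
    rw [hd, hv] at h3
    omega
  have hcu : c u v = 1 := by
    by_contra hne
    have h4 : 2 ≤ c u v := by omega
    have h5 : a u * 2 ≤ a u * c u v := Nat.mul_le_mul_left _ h4
    have h6 := h.mul_le v u
    have h8 : c u v = 2 := by
      by_contra hne'
      have h7 : a u * 3 ≤ a u * c u v := Nat.mul_le_mul_left _ (by omega)
      omega
    obtain ⟨w, hwu, hw⟩ := h.exists_ne (u := v) (v := u) (by rw [h8]; omega)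
    have h9 := h.add_le (u := v) hwu
    have h10 := le_mark_mul (a := a) hw
    have h11 := hhalf w hw
    omega
  obtain ⟨w, hwu, hw⟩ := h.exists_ne (u := v) (v := u) (by rw [hcu]; omega)
  have w1 := h.add_le (u := v) hwu
  have w2 := le_mark_mul (a := a) hw
  have w3 := hhalf w hw
  have w4 := hsub w hw
  have w5 := hnbr w hw
  rw [hcu] at w1
  by_cases hcw : c w v = 1
  · rw [hcw] at w1
    obtain ⟨w', hwu', hww', hw'⟩ := h.exists_ne_ne (u := v) (v := u) (w := w)
      (by rw [hcu, hcw]; omega)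
    have v1 := h.add_add_le (u := v) hwu.symm hwu'.symm hww'.symm
    have v2 := le_mark_mul (a := a) hw'
    have v3 := hhalf w' hw'
    have v4 := hsub w' hw'
    rw [hcu, hcw] at v1
    have hcw' : c w' v = 1 := by
      by_contra hne
      have h5 : a w' * 2 ≤ a w' * c w' v := Nat.mul_le_mul_left _ (by omega)
      omega
    obtain ⟨w'', hu'', hw'', hww'', h''⟩ := h.exists_ne_ne_ne (u := v) hwu.symm hwu'.symm
      hww'.symm (by rw [hcu, hcw, hcw']; omega)
    have x1 := h.add_add_add_le (u := v) hwu.symm hwu'.symm hu''.symm hww'.symm hw''.symm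
      hww''.symm
    have x2 := le_mark_mul (a := a) h''
    have x3 := hhalf w'' h''
    rw [hcu, hcw, hcw'] at x1
    omega
  · have h5 : a w * 2 ≤ a w * c w v := Nat.mul_le_mul_left _ (by omega)
    have hcw2 : c w v = 2 := by
      by_contra hne'
      have h7 : a w * 3 ≤ a w * c w v := Nat.mul_le_mul_left _ (by omega)
      omega
    obtain ⟨w', hwu', hww', hw'⟩ := h.exists_ne_ne (u := v) (v := u) (w := w)
      (by rw [hcu, hcw2]; omega)
    have v1 := h.add_add_le (u := v) hwu.symm hwu'.symm hww'.symm
    have v2 := le_mark_mul (a := a) hw'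
    have v3 := hhalf w' hw'
    rw [hcu, hcw2] at v1
    omega

theorem no_chain_of_seven_le (h : IsMarkedDiagram c a) {u v : V} {k : ℕ} (hk : 7 ≤ k)
    (hu : a u + 1 = k) (hv : a v = k) (huv : c u v ≠ 0) : False := by
  have key (n : ℕ) : ∃ u v, a u + 1 = k + n ∧ a v = k + n ∧ c u v ≠ 0 := by
    induction n with
    | zero => exact ⟨u, v, hu, hv, huv⟩
    | succ n ih =>
      obtain ⟨u, v, h1, h2, h3⟩ := ih
      obtain ⟨w, hw, hvw⟩ := h.exists_succ_of_seven_le (by omega) h1 h2 h3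
      exact ⟨v, w, by omega, by omega, hvw⟩
  -- In a finite diagram no mark can exceed the sum of all marks.
  obtain ⟨-, w, -, hw, -⟩ := key (∑ v, a v)
  have := Finset.single_le_sum (f := a) (fun _ _ ↦ Nat.zero_le _) (Finset.mem_univ w)
  omega

/-- A subdiagram whose marks are annihilated by its own Cartan matrix is the whole diagram. -/
theorem bijective_of_subdiagram (h : IsMarkedDiagram c a) {n : ℕ} {x : Fin (n + 1) → V}
    (hc : IsConnectedFrom c (x 0)) (hx : Function.Injective x)
    {M : Matrix (Fin (n + 1)) (Fin (n + 1)) ℕ} {μ : Fin (n + 1) → ℕ} (ha : ∀ p, a (x p) = μ p)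
    (hE : ∀ p q, M p q ≠ 0 → c (x p) (x q) = M p q)
    (hM : ∀ q, ∑ p, μ p * M p q = 2 * μ q) :
    Function.Bijective x ∧ ∀ p q, c (x p) (x q) = M p q := by
  classical
  have hle (p q) : μ p * M p q ≤ a (x p) * c (x p) (x q) := by
    by_cases h0 : M p q = 0
    · simp [h0]
    · rw [ha, hE p q h0]
  -- The relation of the whole diagram at x q bounds from above a sum that the subdiagram alone
  -- already exhausts. Hence there are no extra edges inside the subdiagram, nor any leaving it;
  -- connectedness then gives surjectivity.
  have hsum (q) : ∑ p, a (x p) * c (x p) (x q) = ∑ p, μ p * M p q := by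
    refine le_antisymm ?_ (Finset.sum_le_sum fun p _ ↦ hle p q)
    rw [hM, ← ha, ← Finset.sum_image (s := Finset.univ) (f := fun v ↦ a v * c v (x q))
      (fun p _ q _ h ↦ hx h)]
    exact h.sum_le _ _
  have heq (p q) : c (x p) (x q) = M p q := by
    have := (Finset.sum_eq_sum_iff_of_le fun p _ ↦ hle p q).mp (hsum q).symm p (Finset.mem_univ p)
    rw [ha] at this
    exact (Nat.eq_of_mul_eq_mul_left (ha p ▸ h.pos (x p)) this).symm
  refine ⟨⟨hx, ?_⟩, heq⟩
  rw [← Set.range_eq_univ]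
  refine hc _ ⟨0, rfl⟩ ?_
  rintro - ⟨q, rfl⟩ v hv
  by_contra hv'
  have h1 := h.sum_le (x q) (insert v (Finset.univ.image x))
  rw [Finset.sum_insert (by simpa using hv'), Finset.sum_image (fun p _ q _ h ↦ hx h), hsum, hM,
    ha] at h1
  have h2 := le_mark_mul (a := a) (h.ne_zero_symm _ _ hv)
  have := h.pos v
  omega

end IsMarkedDiagram

/-- The off-diagonal part of the extended Cartan matrix of type `E₇`; the vertex `0` is the
lowest root. -/
def extE7 : Matrix (Fin 8) (Fin 8) ℕ :=
  !![0, 1, 0, 0, 0, 0, 0, 0;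
     1, 0, 0, 1, 0, 0, 0, 0;
     0, 0, 0, 0, 1, 0, 0, 0;
     0, 1, 0, 0, 1, 0, 0, 0;
     0, 0, 1, 1, 0, 1, 0, 0;
     0, 0, 0, 0, 1, 0, 1, 0;
     0, 0, 0, 0, 0, 1, 0, 1;
     0, 0, 0, 0, 0, 0, 1, 0]

/-- The marks of the extended diagram of type `E₇`. -/
def marksE7 : Fin 8 → ℕ := ![1, 2, 2, 3, 4, 3, 2, 1]

/-- The off-diagonal part of the extended Cartan matrix of type `E₈`. -/
def extE8 : Matrix (Fin 9) (Fin 9) ℕ :=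
  !![0, 0, 0, 0, 0, 0, 0, 0, 1;
     0, 0, 0, 1, 0, 0, 0, 0, 0;
     0, 0, 0, 0, 1, 0, 0, 0, 0;
     0, 1, 0, 0, 1, 0, 0, 0, 0;
     0, 0, 1, 1, 0, 1, 0, 0, 0;
     0, 0, 0, 0, 1, 0, 1, 0, 0;
     0, 0, 0, 0, 0, 1, 0, 1, 0;
     0, 0, 0, 0, 0, 0, 1, 0, 1;
     1, 0, 0, 0, 0, 0, 0, 1, 0]

/-- The marks of the extended diagram of type `E₈`. -/
def marksE8 : Fin 9 → ℕ := ![1, 2, 3, 4, 6, 5, 4, 3, 2]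

/-- The off-diagonal part of the extended Cartan matrix of type `F₄`. -/
def extF4 : Matrix (Fin 5) (Fin 5) ℕ :=
  !![0, 1, 0, 0, 0;
     1, 0, 1, 0, 0;
     0, 1, 0, 2, 0;
     0, 0, 1, 0, 1;
     0, 0, 0, 1, 0]

/-- The marks of the extended diagram of type `F₄`. -/
def marksF4 : Fin 5 → ℕ := ![1, 2, 3, 4, 2]

/-- `x` identifies a marked diagram with base vertex `v₀` with the diagram `M` with marks `μ`. -/
def IsNumbering {V : Type*} (c : V → V → ℕ) (a : V → ℕ) (v₀ : V) {n : ℕ}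
    (M : Matrix (Fin (n + 1)) (Fin (n + 1)) ℕ) (μ : Fin (n + 1) → ℕ) (x : Fin (n + 1) → V) :
    Prop :=
  x 0 = v₀ ∧ Function.Bijective x ∧ (∀ p q, c (x p) (x q) = M p q) ∧ ∀ p, a (x p) = μ p

/-- Vertices with different marks are different, so only equal marks need a distinctness hypothesis.
The absence of further edges need not be assumed: `bijective_of_subdiagram` supplies it. The same
holds for E₇ and E₈ below. -/
theorem IsMarkedDiagram.isNumbering_F4 {V : Type*} [Fintype V] {c : V → V → ℕ} {a : V → ℕ}
    (h : IsMarkedDiagram c a) {v₀ x₂ x₃ x₄ w : V} (hc : IsConnectedFrom c v₀)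
    (a0 : a v₀ = 1) (a1 : a x₂ = 2) (a2 : a x₃ = 3) (a3 : a x₄ = 4) (a4 : a w = 2)
    (c01 : c v₀ x₂ = 1) (c10 : c x₂ v₀ = 1) (c12 : c x₂ x₃ = 1) (c21 : c x₃ x₂ = 1)
    (c23 : c x₃ x₄ = 2) (c32 : c x₄ x₃ = 1) (c34 : c x₄ w = 1) (c43 : c w x₄ = 1) (n14 : x₂ ≠ w) :
    IsNumbering c a v₀ extF4 marksF4 ![v₀, x₂, x₃, x₄, w] := by
  have ha : ∀ p, a ((![v₀, x₂, x₃, x₄, w] : Fin 5 → V) p) = marksF4 p := by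
    intro p
    fin_cases p <;> assumption
  have key := h.bijective_of_subdiagram (x := ![v₀, x₂, x₃, x₄, w]) (M := extF4) hc
    (fun p q hpq ↦ by
      have hμ : marksF4 p = marksF4 q := by rw [← ha, ← ha, hpq]
      have hpairs : ∀ p q : Fin 5, marksF4 p = marksF4 q → p = q ∨
          p = 1 ∧ q = 4 ∨ p = 4 ∧ q = 1 := by decide
      rcases hpairs p q hμ with rfl | ⟨rfl, rfl⟩ | ⟨rfl, rfl⟩
      · rfl
      · exact absurd hpq n14
      · exact absurd hpq n14.symm)
    ha (fun p q ↦ by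
      fin_cases p <;> fin_cases q <;>
        simp [extF4, c01, c10, c12, c21, c23, c32, c34, c43])
    (by decide)
  exact ⟨rfl, key.1, key.2, ha⟩

theorem IsMarkedDiagram.isNumbering_E7 {V : Type*} [Fintype V] {c : V → V → ℕ} {a : V → ℕ}
    (h : IsMarkedDiagram c a) {v₀ x₂ w' x₃ x₄ w y z : V} (hc : IsConnectedFrom c v₀)
    (a0 : a v₀ = 1) (a1 : a x₂ = 2) (a2 : a w' = 2) (a3 : a x₃ = 3) (a4 : a x₄ = 4) (a5 : a w = 3)
    (a6 : a y = 2) (a7 : a z = 1) (c01 : c v₀ x₂ = 1) (c10 : c x₂ v₀ = 1) (c13 : c x₂ x₃ = 1)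
    (c31 : c x₃ x₂ = 1) (c34 : c x₃ x₄ = 1) (c43 : c x₄ x₃ = 1) (c24 : c w' x₄ = 1)
    (c42 : c x₄ w' = 1) (c45 : c x₄ w = 1) (c54 : c w x₄ = 1) (c56 : c w y = 1) (c65 : c y w = 1)
    (c67 : c y z = 1) (c76 : c z y = 1) (n07 : v₀ ≠ z) (n12 : x₂ ≠ w') (n16 : x₂ ≠ y)
    (n26 : w' ≠ y) (n35 : x₃ ≠ w) :
    IsNumbering c a v₀ extE7 marksE7 ![v₀, x₂, w', x₃, x₄, w, y, z] := by
  have ha : ∀ p, a ((![v₀, x₂, w', x₃, x₄, w, y, z] : Fin 8 → V) p) = marksE7 p := by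
    intro p
    fin_cases p <;> assumption
  have key := h.bijective_of_subdiagram (x := ![v₀, x₂, w', x₃, x₄, w, y, z]) (M := extE7) hc
    (fun p q hpq ↦ by
      have hμ : marksE7 p = marksE7 q := by rw [← ha, ← ha, hpq]
      have hpairs : ∀ p q : Fin 8, marksE7 p = marksE7 q → p = q ∨
          p = 0 ∧ q = 7 ∨ p = 1 ∧ q = 2 ∨ p = 1 ∧ q = 6 ∨ p = 2 ∧ q = 6 ∨ p = 3 ∧ q = 5 ∨
          p = 7 ∧ q = 0 ∨ p = 2 ∧ q = 1 ∨ p = 6 ∧ q = 1 ∨ p = 6 ∧ q = 2 ∨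
          p = 5 ∧ q = 3 := by decide
      rcases hpairs p q hμ with rfl | ⟨rfl, rfl⟩ | ⟨rfl, rfl⟩ | ⟨rfl, rfl⟩ | ⟨rfl, rfl⟩
        | ⟨rfl, rfl⟩ | ⟨rfl, rfl⟩ | ⟨rfl, rfl⟩ | ⟨rfl, rfl⟩ | ⟨rfl, rfl⟩ | ⟨rfl, rfl⟩
      · rfl
      · exact absurd hpq n07
      · exact absurd hpq n12
      · exact absurd hpq n16
      · exact absurd hpq n26
      · exact absurd hpq n35
      · exact absurd hpq n07.symm
      · exact absurd hpq n12.symm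
      · exact absurd hpq n16.symm
      · exact absurd hpq n26.symm
      · exact absurd hpq n35.symm)
    ha (fun p q ↦ by
      fin_cases p <;> fin_cases q <;>
        simp [extE7, c01, c10, c13, c31, c34, c43, c24, c42, c45, c54, c56, c65, c67, c76])
    (by decide)
  exact ⟨rfl, key.1, key.2, ha⟩

theorem IsMarkedDiagram.isNumbering_E8 {V : Type*} [Fintype V] {c : V → V → ℕ} {a : V → ℕ}
    (h : IsMarkedDiagram c a) {v₀ y w' w x₆ x₅ x₄ x₃ x₂ : V} (hc : IsConnectedFrom c v₀)
    (a0 : a v₀ = 1) (a1 : a y = 2) (a2 : a w' = 3) (a3 : a w = 4) (a4 : a x₆ = 6) (a5 : a x₅ = 5)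
    (a6 : a x₄ = 4) (a7 : a x₃ = 3) (a8 : a x₂ = 2) (c08 : c v₀ x₂ = 1) (c80 : c x₂ v₀ = 1)
    (c87 : c x₂ x₃ = 1) (c78 : c x₃ x₂ = 1) (c76 : c x₃ x₄ = 1) (c67 : c x₄ x₃ = 1)
    (c65 : c x₄ x₅ = 1) (c56 : c x₅ x₄ = 1) (c54 : c x₅ x₆ = 1) (c45 : c x₆ x₅ = 1)
    (c24 : c w' x₆ = 1) (c42 : c x₆ w' = 1) (c34 : c w x₆ = 1) (c43 : c x₆ w = 1)
    (c13 : c y w = 1) (c31 : c w y = 1) (n81 : x₂ ≠ y) (n72 : x₃ ≠ w') (n63 : x₄ ≠ w) :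
    IsNumbering c a v₀ extE8 marksE8 ![v₀, y, w', w, x₆, x₅, x₄, x₃, x₂] := by
  have ha : ∀ p, a ((![v₀, y, w', w, x₆, x₅, x₄, x₃, x₂] : Fin 9 → V) p) = marksE8 p := by
    intro p
    fin_cases p <;> assumption
  have key := h.bijective_of_subdiagram (x := ![v₀, y, w', w, x₆, x₅, x₄, x₃, x₂]) (M := extE8) hc
    (fun p q hpq ↦ by
      have hμ : marksE8 p = marksE8 q := by rw [← ha, ← ha, hpq]
      have hpairs : ∀ p q : Fin 9, marksE8 p = marksE8 q → p = q ∨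
          p = 8 ∧ q = 1 ∨ p = 7 ∧ q = 2 ∨ p = 6 ∧ q = 3 ∨ p = 1 ∧ q = 8 ∨ p = 2 ∧ q = 7 ∨
          p = 3 ∧ q = 6 := by decide
      rcases hpairs p q hμ with rfl | ⟨rfl, rfl⟩ | ⟨rfl, rfl⟩ | ⟨rfl, rfl⟩ | ⟨rfl, rfl⟩
        | ⟨rfl, rfl⟩ | ⟨rfl, rfl⟩
      · rfl
      · exact absurd hpq n81
      · exact absurd hpq n72
      · exact absurd hpq n63
      · exact absurd hpq n81.symm
      · exact absurd hpq n72.symm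
      · exact absurd hpq n63.symm)
    ha (fun p q ↦ by
      fin_cases p <;> fin_cases q <;>
        simp [extE8, c08, c80, c87, c78, c76, c67, c65, c56, c54, c45, c24, c42, c34, c43, c13,
          c31])
    (by decide)
  exact ⟨rfl, key.1, key.2, ha⟩

/-- At each vertex the weighted neighbours add up to twice its mark, and each neighbour has at least
half that mark, so the chain 1, 2, 3, 4 has few continuations. A double edge into 4 leaves weight 8
- 6 = 2 and gives F₄. A simple one leaves 5: the splitting 3 + 2 gives E₇, while a single 5 forces
6. There 7 is excluded, and the remaining weight 12 - 5 = 7 splits as 4 + 3, giving E₈. -/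
theorem IsMarkedDiagram.classification {V : Type*} [Fintype V] {c : V → V → ℕ} {a : V → ℕ}
    (h : IsMarkedDiagram c a) {v₀ i : V} (hc : IsConnectedFrom c v₀)
    (h0 : a v₀ = 1) (hi : a i = 4) :
    (∃ x, IsNumbering c a v₀ extE7 marksE7 x) ∨ (∃ x, IsNumbering c a v₀ extE8 marksE8 x) ∨
      ∃ x, IsNumbering c a v₀ extF4 marksF4 x := by
  obtain ⟨x₂, x₃, x₄, a2, a3, a4, h12, h23, h34⟩ := h.exists_chain hc h0 hi
  have ne_of {u v : V} (huv : a u ≠ a v) : u ≠ v := fun h ↦ huv (h ▸ rfl)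
  have h21 := h.ne_zero_symm _ _ h12
  have h32 := h.ne_zero_symm _ _ h23
  have h43 := h.ne_zero_symm _ _ h34
  have c21 : c x₂ v₀ = 1 := h.eq_one_of_lt h21 (by omega)
  have c32 : c x₃ x₂ = 1 := h.eq_one_of_lt h32 (by omega)
  have c43 : c x₄ x₃ = 1 := h.eq_one_of_lt h43 (by omega)
  have c12 : c v₀ x₂ = 1 := by
    have := h.add_le (u := x₂) (ne_of (u := v₀) (v := x₃) (by omega))
    rw [c32, h0, a3, a2] at this; omega
  have c23 : c x₂ x₃ = 1 := by
    have := h.add_le (u := x₃) (ne_of (u := x₂) (v := x₄) (by omega))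
    rw [c43, a4, a3, a2] at this; omega
  have n1 (v : V) (hv : c v v₀ ≠ 0) : v = x₂ := by
    by_contra hne
    have := h.add_le (u := v₀) hne
    have h2 := le_mark_mul (a := a) hv
    have h3 := h.pos v
    rw [c21, a2, h0] at this; omega
  have n2 (v : V) (hv : c v x₂ ≠ 0) : v = v₀ ∨ v = x₃ := by
    by_contra! hne
    have := h.add_add_le (u := x₂) hne.1 hne.2 (ne_of (by omega))
    have h2 := le_mark_mul (a := a) hv
    have h3 := h.pos v
    rw [c12, c32, a3, h0, a2] at this; omega
  have n3 (v : V) (hv : c v x₃ ≠ 0) : v = x₂ ∨ v = x₄ := by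
    by_contra! hne
    have := h.add_add_le (u := x₃) hne.1 hne.2 (ne_of (by omega))
    have h2 := le_mark_mul (a := a) hv
    have h3 := h.pos v
    rw [c23, c43, a3, a4, a2] at this; omega
  have hw_ge (w : V) (hw : c w x₄ ≠ 0) : 2 ≤ a w := by
    have := h.le_two_mul hw
    omega
  have c24 : c x₂ x₄ = 0 := by
    by_contra h'
    rcases n2 x₄ (h.ne_zero_symm _ _ h') with h' | h' <;> rw [h'] at a4 <;> omega
  have e34 : c x₃ x₄ = 1 ∨ c x₃ x₄ = 2 := by
    have := h.mul_le x₄ x₃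
    rw [a3, a4] at this
    omega
  rcases e34 with c34 | c34
  swap
  · -- type `F₄`
    obtain ⟨w, hw3, hw⟩ := h.exists_ne (u := x₄) (v := x₃) (by rw [c34]; omega)
    have w1 := h.add_le (u := x₄) hw3
    have w2 := hw_ge w hw
    have w3 := le_mark_mul (a := a) hw
    rw [c34] at w1
    have aw : a w = 2 := by omega
    have cw : c w x₄ = 1 := by rw [aw] at w1; omega
    have cw' : c x₄ w = 1 := by
      have := h.mul_le w x₄
      have := h.ne_zero_symm _ _ hw
      rw [a4, aw] at *; omega
    have w_ne : w ≠ x₂ := fun h' ↦ hw (h' ▸ c24)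
    exact Or.inr (Or.inr ⟨_, h.isNumbering_F4 hc h0 a2 a3 a4 aw c12 c21 c23 c32 c34 c43 cw' cw
      w_ne.symm⟩)
  -- the continuation of the chain is of type `E₇`
  have finE7 (w w' : V) (hw3 : w ≠ x₃) (hw : c w x₄ = 1) (hw' : c w' x₄ = 1) (aw : a w = 3)
      (aw' : a w' = 2) : ∃ x, IsNumbering c a v₀ extE7 marksE7 x := by
    have hw0 : c w x₄ ≠ 0 := by omega
    have hw0' : c w' x₄ ≠ 0 := by omega
    have c4w' : c x₄ w' = 1 := by
      have h1 := h.mul_le w' x₄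
      have h2 := h.ne_zero_symm _ _ hw0'
      rw [a4, aw'] at h1; omega
    have c4w : c x₄ w = 1 := h.eq_one_of_lt (h.ne_zero_symm _ _ hw0) (by omega)
    obtain ⟨y, hy4, hy⟩ := h.exists_ne (u := w) (v := x₄) (by rw [c4w]; omega)
    have y1 := h.add_le (u := w) hy4
    have y2 := h.le_two_mul hy
    have y3 := le_mark_mul (a := a) hy
    rw [c4w, a4, aw] at y1
    have ay : a y = 2 := by omega
    have cyw : c y w = 1 := by rw [ay] at y1; omega
    have cwy : c w y = 1 := h.eq_one_of_lt (h.ne_zero_symm _ _ hy) (by omega)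
    obtain ⟨z, hzw, hz⟩ := h.exists_ne (u := y) (v := w) (by rw [cwy]; omega)
    have z1 := h.add_le (u := y) hzw
    have z2 := h.pos z
    have z3 := le_mark_mul (a := a) hz
    rw [cwy, aw, ay] at z1
    have az : a z = 1 := by omega
    have czy : c z y = 1 := by rw [az] at z1; omega
    have cyz : c y z = 1 := h.eq_one_of_lt (h.ne_zero_symm _ _ hz) (by omega)
    have n12 : x₂ ≠ w' := by rintro rfl; exact hw0' c24
    have n16 : x₂ ≠ y := by
      rintro rfl
      rcases n2 w (by omega) with h' | h'
      · rw [h'] at aw; omega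
      · exact hw3 h'
    have n26 : w' ≠ y := by
      rintro rfl
      have := h.add_le (u := w') (ne_of (u := w) (v := x₄) (by omega))
      rw [cwy, c4w', aw, a4, aw'] at this; omega
    have n07 : v₀ ≠ z := by
      rintro rfl
      exact n16 (n1 y (by omega)).symm
    exact ⟨_, h.isNumbering_E7 hc h0 a2 aw' a3 a4 aw ay az c12 c21 c23 c32 c34 c43 hw' c4w' c4w hw
      cwy cyw cyz czy n07 n12 n16 n26 hw3.symm⟩
  -- the chain continues with the mark `5`
  have finE8 (x₅ : V) (h5 : c x₅ x₄ ≠ 0) (a5 : a x₅ = 5) :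
      ∃ x, IsNumbering c a v₀ extE8 marksE8 x := by
    have c54 : c x₅ x₄ = 1 := h.eq_one_of_lt h5 (by omega)
    have h45 := h.ne_zero_symm _ _ h5
    have n4 (v : V) (hv : c v x₄ ≠ 0) : v = x₃ ∨ v = x₅ := by
      by_contra! hne
      have := h.add_add_le (u := x₄) hne.1 hne.2 (ne_of (by omega))
      have h2 := le_mark_mul (a := a) hv
      have h3 := h.pos v
      rw [c34, c54, a3, a4, a5] at this; omega
    have c45 : c x₄ x₅ = 1 := by
      by_contra hne
      have h1 := h.mul_le x₅ x₄
      have h2 : c x₄ x₅ = 2 := by rw [a4, a5] at h1; omega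
      obtain ⟨w, hw4, hw⟩ := h.exists_ne (u := x₅) (v := x₄) (by rw [h2]; omega)
      have w1 := h.add_le (u := x₅) hw4
      have w2 := h.le_two_mul hw
      have w3 := le_mark_mul (a := a) hw
      rw [h2] at w1
      omega
    obtain ⟨x₆, h64, h6⟩ := h.exists_ne (u := x₅) (v := x₄) (by rw [c45]; omega)
    have w1 := h.add_le (u := x₅) h64
    have w2 := h.le_two_mul h6
    have w3 := le_mark_mul (a := a) h6
    rw [c45] at w1
    -- The weight 10 - 4 = 6 is left for neighbours of mark at least 3. Besides a single 6, only
    -- marks 3 could fill it, but a vertex of mark 3 next to 5 has weight 1 left and no neighbour of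
    -- mark 1.
    have a6 : a x₆ = 6 := by
      by_contra hne
      rcases eq_or_ne (a x₆) 3 with a6 | a6
      · have c56 : c x₅ x₆ = 1 := h.eq_one_of_lt (h.ne_zero_symm _ _ h6) (by omega)
        obtain ⟨y, hy5, hy⟩ := h.exists_ne (u := x₆) (v := x₅) (by rw [c56]; omega)
        have y1 := h.add_le (u := x₆) hy5
        have y2 := h.le_two_mul hy
        have y3 := le_mark_mul (a := a) hy
        rw [c56] at y1
        omega
      · have c65 : c x₆ x₅ = 1 := by
          by_contra hne
          have : a x₆ * 2 ≤ a x₆ * c x₆ x₅ := Nat.mul_le_mul_left _ (by omega)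
          omega
        rw [c65] at w1
        obtain ⟨y, hy4, hy6, hy⟩ := h.exists_ne_ne (u := x₅) (v := x₄) (w := x₆)
          (by rw [c45, c65]; omega)
        have y1 := h.add_add_le (u := x₅) hy4 hy6 h64.symm
        have y2 := h.le_two_mul hy
        have y3 := le_mark_mul (a := a) hy
        rw [c45, c65] at y1
        omega
    have c65 : c x₆ x₅ = 1 := h.eq_one_of_lt h6 (by omega)
    have h56 := h.ne_zero_symm _ _ h6
    have c56 : c x₅ x₆ = 1 := by
      by_contra hne
      have h1 := h.mul_le x₆ x₅
      have h2 : c x₅ x₆ = 2 := by rw [a5, a6] at h1; omega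
      obtain ⟨w, hw4, hw⟩ := h.exists_ne (u := x₆) (v := x₅) (by rw [h2]; omega)
      have w1 := h.add_le (u := x₆) hw4
      have w2 := h.le_two_mul hw
      have w3 := le_mark_mul (a := a) hw
      rw [h2] at w1
      omega
    have hnot7 (w : V) (hw : c w x₆ ≠ 0) : a w ≠ 7 := fun h7 ↦
      h.no_chain_of_seven_le le_rfl (by omega) h7 (h.ne_zero_symm _ _ hw)
    have hge (w : V) (hw : c w x₆ ≠ 0) : 3 ≤ a w := by
      have := h.le_two_mul hw
      omega
    -- the two remaining neighbours of the vertex with mark `6`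
    have fin (w w' : V) (hw5 : w ≠ x₅) (cw : c w x₆ = 1) (cw' : c w' x₆ = 1) (aw : a w = 4)
        (aw' : a w' = 3) : ∃ x, IsNumbering c a v₀ extE8 marksE8 x := by
      have hw0 : c w x₆ ≠ 0 := by omega
      have hw0' : c w' x₆ ≠ 0 := by omega
      have c6w' : c x₆ w' = 1 := by
        have h1 := h.mul_le w' x₆
        have h2 := h.ne_zero_symm _ _ hw0'
        rw [a6, aw'] at h1; omega
      have c6w : c x₆ w = 1 := h.eq_one_of_lt (h.ne_zero_symm _ _ hw0) (by omega)
      obtain ⟨y, hy4, hy⟩ := h.exists_ne (u := w) (v := x₆) (by rw [c6w]; omega)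
      have y1 := h.add_le (u := w) hy4
      have y2 := h.le_two_mul hy
      have y3 := le_mark_mul (a := a) hy
      rw [c6w, a6, aw] at y1
      have ay : a y = 2 := by omega
      have cyw : c y w = 1 := by rw [ay] at y1; omega
      have cwy : c w y = 1 := h.eq_one_of_lt (h.ne_zero_symm _ _ hy) (by omega)
      have n72 : x₃ ≠ w' := by
        rintro rfl
        rcases n3 x₆ (by omega) with h' | h' <;> rw [h'] at a6 <;> omega
      have n63 : x₄ ≠ w := by
        rintro rfl
        rcases n4 x₆ (by omega) with h' | h' <;> rw [h'] at a6 <;> omega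
      have n81 : x₂ ≠ y := by
        rintro rfl
        rcases n2 w (by omega) with h' | h' <;> rw [h'] at aw <;> omega
      exact ⟨_, h.isNumbering_E8 hc h0 ay aw' aw a6 a5 a4 a3 a2 c12 c21 c23 c32 c34 c43 c45 c54 c56
        c65 cw' c6w' cw c6w cyw cwy n81 n72 n63⟩
    obtain ⟨w, hw5, hw⟩ := h.exists_ne (u := x₆) (v := x₅) (by rw [c56]; omega)
    have w1 := h.add_le (u := x₆) hw5
    have w2 := hge w hw
    have w3 := le_mark_mul (a := a) hw
    have w4 := hnot7 w hw
    rw [c56] at w1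
    -- The weight 7 cannot be filled by one neighbour: 7 is prime, and the marks 1 and 7 are
    -- excluded. So a second neighbour exists.
    have hw7 : a w * c w x₆ ≠ 7 := fun h7 ↦ by
      rcases (Nat.dvd_prime (by norm_num : Nat.Prime 7)).mp ⟨_, h7.symm⟩ with h' | h' <;> omega
    obtain ⟨w', hw5', hww', hw'⟩ := h.exists_ne_ne (u := x₆) (v := x₅) (w := w)
      (by rw [c56]; omega)
    have v1 := h.add_add_le (u := x₆) hw5.symm hw5'.symm hww'.symm
    have v2 := hge w' hw'
    have v3 := le_mark_mul (a := a) hw'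
    rw [c56] at v1
    have cw : c w x₆ = 1 := by
      by_contra hne
      have : a w * 2 ≤ a w * c w x₆ := Nat.mul_le_mul_left _ (by omega)
      omega
    have cw' : c w' x₆ = 1 := by
      by_contra hne
      have : a w' * 2 ≤ a w' * c w' x₆ := Nat.mul_le_mul_left _ (by omega)
      omega
    rw [cw, cw'] at v1
    have hsum : a w + a w' = 7 := by
      by_contra hne
      obtain ⟨y, hy5, hyw, hyw', hy⟩ := h.exists_ne_ne_ne (u := x₆) hw5.symm hw5'.symm hww'.symm
        (by rw [c56, cw, cw']; omega)
      have y1 := h.add_add_add_le (u := x₆) hw5.symm hw5'.symm hy5.symm hww'.symm hyw.symm hyw'.symm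
      have y2 := hge y hy
      have y3 := le_mark_mul (a := a) hy
      rw [c56, cw, cw'] at y1
      omega
    rcases (by omega : a w = 4 ∧ a w' = 3 ∨ a w' = 4 ∧ a w = 3) with ⟨aw, aw'⟩ | ⟨aw, aw'⟩
    · exact fin w w' hw5 cw cw' aw aw'
    · exact fin w' w hw5' cw' cw aw aw'
  obtain ⟨w, hw3, hw⟩ := h.exists_ne (u := x₄) (v := x₃) (by rw [c34]; omega)
  have w1 := h.add_le (u := x₄) hw3
  have w2 := hw_ge w hw
  have w3 := le_mark_mul (a := a) hw
  rw [c34] at w1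
  rcases eq_or_ne (a w) 5 with aw | aw
  · exact Or.inr (Or.inl (finE8 w hw aw))
  -- Here the remaining weight is 5, again prime, with the marks 1 and 5 excluded.
  have hw7 : a w * c w x₄ ≠ 5 := fun h7 ↦ by
    rcases (Nat.dvd_prime (by norm_num : Nat.Prime 5)).mp ⟨_, h7.symm⟩ with h' | h' <;> omega
  obtain ⟨w', hw3', hww', hw'⟩ := h.exists_ne_ne (u := x₄) (v := x₃) (w := w)
    (by rw [c34]; omega)
  have v1 := h.add_add_le (u := x₄) hw3.symm hw3'.symm hww'.symm
  have v2 := hw_ge w' hw'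
  have v3 := le_mark_mul (a := a) hw'
  rw [c34] at v1
  have cw : c w x₄ = 1 := by
    by_contra hne
    have : a w * 2 ≤ a w * c w x₄ := Nat.mul_le_mul_left _ (by omega)
    omega
  have cw' : c w' x₄ = 1 := by
    by_contra hne
    have : a w' * 2 ≤ a w' * c w' x₄ := Nat.mul_le_mul_left _ (by omega)
    omega
  rw [cw, cw'] at v1
  have hsum : a w + a w' = 5 := by
    by_contra hne
    obtain ⟨y, hy5, hyw, hyw', hy⟩ := h.exists_ne_ne_ne (u := x₄) hw3.symm hw3'.symm hww'.symm
      (by rw [c34, cw, cw']; omega)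
    have y1 := h.add_add_add_le (u := x₄) hw3.symm hw3'.symm hy5.symm hww'.symm hyw.symm hyw'.symm
    have y2 := hw_ge y hy
    have y3 := le_mark_mul (a := a) hy
    rw [c34, cw, cw'] at y1
    omega
  rcases (by omega : a w = 3 ∧ a w' = 2 ∨ a w' = 3 ∧ a w = 2) with ⟨aw, aw'⟩ | ⟨aw, aw'⟩
  · exact Or.inl (finE7 w w' hw3 cw cw' aw aw')
  · exact Or.inl (finE7 w' w hw3' cw' cw aw aw')

end Marks

/-! ### The extended diagram of a highest root. -/

section HighestRoot

set_option linter.unusedSectionVars false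

variable {ι K M N : Type*} [Finite ι] [Field K] [CharZero K] [AddCommGroup M] [Module K M]
  [AddCommGroup N] [Module K N] {P : RootPairing ι K M N} [P.IsRootSystem] {b : P.Base}

theorem exists_nat_repr_of_mem_closure {x : M}
    (hx : x ∈ AddSubmonoid.closure (P.root '' (b.support : Set ι))) (j : b.support) :
    ∃ k : ℕ, b.toWeightBasis.repr x j = k := by
  classical
  induction hx using AddSubmonoid.closure_induction with
  | mem x hx =>
    obtain ⟨k, hk, rfl⟩ := hx
    refine ⟨if (⟨k, hk⟩ : b.support) = j then 1 else 0, ?_⟩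
    have := b.toWeightBasis_repr_root ⟨k, hk⟩
    simp only at this
    rw [this, Finsupp.single_apply]
    simp
  | zero => exact ⟨0, by simp⟩
  | add x y _ _ hx hy =>
    obtain ⟨k, hk⟩ := hx
    obtain ⟨l, hl⟩ := hy
    exact ⟨k + l, by simp [hk, hl]⟩

theorem exists_int_repr_root (β : ι) (j : b.support) :
    ∃ k : ℤ, b.toWeightBasis.repr (P.root β) j = k := by
  rcases b.root_mem_or_neg_mem β with h | h
  · obtain ⟨k, hk⟩ := exists_nat_repr_of_mem_closure h j
    exact ⟨k, by simpa using hk⟩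
  · obtain ⟨k, hk⟩ := exists_nat_repr_of_mem_closure h j
    refine ⟨-k, ?_⟩
    rw [map_neg, Finsupp.neg_apply] at hk
    push_cast
    rw [← hk, neg_neg]

variable [P.IsCrystallographic] [P.IsReduced]

theorem intCast_pairingIn (β γ : ι) : (P.pairingIn ℤ β γ : K) = P.coroot' γ (P.root β) := by
  rw [P.root_coroot'_eq_pairing, ← P.algebraMap_pairingIn ℤ]
  simp

variable {δ : ι} {m : b.support → ℕ}

theorem repr_highestRoot (hm : P.root δ = ∑ j, m j • P.root j) (j : b.support) :
    b.toWeightBasis.repr (P.root δ) j = m j := by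
  classical
  rw [hm]
  simp [Finsupp.single_apply]

/-- The coefficients of the highest root bound the coefficients of all roots. -/
theorem repr_le_mark (hδ : ∀ β, P.root δ - P.root β ∈
      AddSubmonoid.closure (P.root '' (b.support : Set ι)))
    (hm : P.root δ = ∑ j, m j • P.root j) {β : ι} {j : b.support} {k : ℤ}
    (hk : b.toWeightBasis.repr (P.root β) j = k) : k ≤ m j := by
  obtain ⟨l, hl⟩ := exists_nat_repr_of_mem_closure (hδ β) j
  rw [map_sub, Finsupp.sub_apply, repr_highestRoot hm, hk] at hl
  have : (m j : ℤ) - k = l := by exact_mod_cast hl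
  omega

theorem neg_mark_le_repr (hδ : ∀ β, P.root δ - P.root β ∈
      AddSubmonoid.closure (P.root '' (b.support : Set ι)))
    (hm : P.root δ = ∑ j, m j • P.root j) {β : ι} {j : b.support} {k : ℤ}
    (hk : b.toWeightBasis.repr (P.root β) j = k) : -k ≤ m j :=
  -- The index `P.reflectionPerm β β` is that of the root -β.
  repr_le_mark hδ hm (β := P.reflectionPerm β β) (by simp [P.root_reflectionPerm, hk])

theorem mark_pos (hδ : ∀ β, P.root δ - P.root β ∈
      AddSubmonoid.closure (P.root '' (b.support : Set ι)))
    (hm : P.root δ = ∑ j, m j • P.root j) (j : b.support) : 0 < m j := by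
  have := repr_le_mark hδ hm (β := j) (j := j) (k := 1) (by simp)
  omega

/-- Otherwise δ + αⱼ would be a root with coefficient mⱼ + 1 at αⱼ, above the maximum. -/
theorem pairingIn_highestRoot_nonneg (hδ : ∀ β, P.root δ - P.root β ∈
      AddSubmonoid.closure (P.root '' (b.support : Set ι)))
    (hm : P.root δ = ∑ j, m j • P.root j) (j : b.support) : 0 ≤ P.pairingIn ℤ δ j := by
  by_contra! hneg
  have hne : P.root δ ≠ -P.root j := by
    intro h
    have h1 := repr_highestRoot hm j
    rw [h] at h1
    simp only [map_neg, RootPairing.Base.toWeightBasis_repr_root, Finsupp.neg_apply,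
      Finsupp.single_eq_same] at h1
    have : (-1 : ℤ) = m j := by exact_mod_cast h1
    omega
  obtain ⟨β, hβ⟩ := P.root_add_root_mem_of_pairingIn_neg hneg hne
  have := repr_le_mark hδ hm (β := β) (j := j) (k := m j + 1) (by
    rw [hβ, map_add, Finsupp.add_apply, repr_highestRoot hm]; simp)
  omega

theorem pairingIn_highestRoot_nonneg' (hδ : ∀ β, P.root δ - P.root β ∈
      AddSubmonoid.closure (P.root '' (b.support : Set ι)))
    (hm : P.root δ = ∑ j, m j • P.root j) (j : b.support) : 0 ≤ P.pairingIn ℤ j δ := by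
  have := pairingIn_highestRoot_nonneg hδ hm j
  by_contra! hneg
  rw [P.pairingIn_lt_zero_iff] at hneg
  omega

/-- The off-diagonal Cartan integers, up to sign, of the extended system `{-δ, α₁, …, αₙ}`. -/
noncomputable def extendedCartan (b : P.Base) (δ : ι) : Option b.support → Option b.support → ℕ
  | none, none => 0
  | none, some j => (P.pairingIn ℤ δ j).toNat
  | some j, none => (P.pairingIn ℤ j δ).toNat
  | some j, some k => (-b.cartanMatrix j k).toNat

/-- The marks `1, m₁, …, mₙ` of the extended system. -/
def extendedMark (m : b.support → ℕ) : Option b.support → ℕ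
  | none => 1
  | some j => m j

/-- The relation between the marks is -δ + ∑ mⱼαⱼ = 0 paired with the coroots of δ and of the simple
roots, with the diagonal entries 2 moved to the other side. -/
theorem isMarkedDiagram_extendedCartan (hδ : ∀ β, P.root δ - P.root β ∈
      AddSubmonoid.closure (P.root '' (b.support : Set ι)))
    (hm : P.root δ = ∑ j, m j • P.root j) :
    IsMarkedDiagram (extendedCartan b δ) (extendedMark m) where
  ne_zero_symm u v huv := by
    have h1 := pairingIn_highestRoot_nonneg hδ hm
    have h2 := pairingIn_highestRoot_nonneg' hδ hm
    rcases u with _ | j <;> rcases v with _ | k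
    · exact huv
    · have h3 := P.pairingIn_eq_zero_iff (S := ℤ) (i := δ) (j := k)
      have := h1 k
      have := h2 k
      simp only [extendedCartan] at huv ⊢
      omega
    · have h3 := P.pairingIn_eq_zero_iff (S := ℤ) (i := δ) (j := j)
      have := h1 j
      have := h2 j
      simp only [extendedCartan] at huv ⊢
      omega
    · simp only [extendedCartan] at huv ⊢
      have hne : j ≠ k := by
        rintro rfl
        simp at huv
      have := b.cartanMatrix_le_zero_of_ne k j hne.symm
      have := b.cartanMatrix_apply_eq_zero_iff_symm (i := j) (j := k)
      omega
  self u := by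
    rcases u with _ | j
    · rfl
    · simp [extendedCartan]
  pos v := by
    rcases v with _ | j
    · exact one_pos
    · exact mark_pos hδ hm j
  sum_eq u := by
    classical
    have hpair (γ : ι) : ∑ k, (m k : ℤ) * P.pairingIn ℤ k γ = P.pairingIn ℤ δ γ := by
      have : (∑ k, (m k : K) * (P.pairingIn ℤ k γ : K)) = (P.pairingIn ℤ δ γ : K) := by
        simp only [intCast_pairingIn]
        rw [hm]
        simp
      exact_mod_cast this
    zify
    rw [Fintype.sum_option]
    rcases u with _ | j
    · have h1 := hpair δ
      rw [P.pairingIn_same] at h1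
      simp only [extendedCartan, extendedMark]
      rw [← h1]
      simp [Int.toNat_of_nonneg (pairingIn_highestRoot_nonneg' hδ hm _)]
    · have h1 := hpair j
      simp only [extendedCartan, extendedMark]
      rw [Int.toNat_of_nonneg (pairingIn_highestRoot_nonneg hδ hm _), ← h1,
        ← Finset.add_sum_erase _ _ (Finset.mem_univ j),
        ← Finset.add_sum_erase _ (fun x ↦ (m x : ℤ) * ((-b.cartanMatrix x j).toNat : ℤ))
          (Finset.mem_univ j), P.pairingIn_same]
      have h2 : ∑ x ∈ Finset.univ.erase j, (m x : ℤ) * ((-b.cartanMatrix x j).toNat : ℤ) =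
          -∑ x ∈ Finset.univ.erase j, (m x : ℤ) * P.pairingIn ℤ x j := by
        rw [← Finset.sum_neg_distrib]
        refine Finset.sum_congr rfl fun x hx ↦ ?_
        rw [Int.toNat_of_nonneg (by
          have := b.cartanMatrix_le_zero_of_ne x j (Finset.ne_of_mem_erase hx)
          omega)]
        simp [RootPairing.Base.cartanMatrixIn_def]
      rw [h2, b.cartanMatrix_apply_same]
      simp
      ring

theorem pairing_eq_sum_repr (β γ : ι) :
    P.pairing β γ = ∑ k, b.toWeightBasis.repr (P.root β) k * P.pairing k γ := by
  have := congrArg (P.coroot' γ) (b.toWeightBasis.sum_repr (P.root β))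
  rw [P.root_coroot'_eq_pairing] at this
  rw [← this]
  simp

theorem pairing_eq_zero_of_extendedCartan_eq_zero {j k : b.support} (hjk : j ≠ k)
    (h : extendedCartan b δ (some j) (some k) = 0) : P.pairing j k = 0 := by
  have h1 := b.cartanMatrix_le_zero_of_ne j k hjk
  simp only [extendedCartan] at h
  have h2 : P.pairingIn ℤ j k = 0 := by
    rw [← b.cartanMatrixIn_def ℤ]
    change b.cartanMatrix j k = 0
    omega
  rw [← P.algebraMap_pairingIn ℤ, h2, map_zero]

/-- The support of a root lies inside or outside of a union of components. -/
theorem repr_eq_zero_of_closed {S : Set b.support}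
    (hS : ∀ j ∈ S, ∀ k ∉ S, P.pairing j k = 0 ∧ P.pairing k j = 0) (β : ι) :
    (∀ j ∉ S, b.toWeightBasis.repr (P.root β) j = 0) ∨
      ∀ j ∈ S, b.toWeightBasis.repr (P.root β) j = 0 := by
  classical
  refine b.induction_reflect β (p := fun β ↦
    (∀ j ∉ S, b.toWeightBasis.repr (P.root β) j = 0) ∨
      ∀ j ∈ S, b.toWeightBasis.repr (P.root β) j = 0) ?_ ?_ ?_
  · intro β h
    simpa [P.root_reflectionPerm] using h
  · intro k hk
    have h1 := b.toWeightBasis_repr_root ⟨k, hk⟩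
    simp only at h1
    rw [h1]
    by_cases h : (⟨k, hk⟩ : b.support) ∈ S
    · exact .inl fun j hj ↦ Finsupp.single_eq_of_ne (by rintro rfl; exact hj h)
    · exact .inr fun j hj ↦ Finsupp.single_eq_of_ne (by rintro rfl; exact h hj)
  · intro β k h hk
    lift k to b.support using hk
    have hrefl : b.toWeightBasis.repr (P.root (P.reflectionPerm k β)) =
        b.toWeightBasis.repr (P.root β) - P.pairing β k • Finsupp.single k 1 := by
      rw [P.root_reflectionPerm, P.reflection_apply, P.root_coroot'_eq_pairing, map_sub, map_smul,
        b.toWeightBasis_repr_root]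
    rw [hrefl]
    -- Stated for arbitrary T, so that it applies to S and to its complement.
    have key {T : Set b.support} (hT : ∀ j ∈ T, ∀ k ∉ T, P.pairing j k = 0)
        (h : ∀ j ∉ T, b.toWeightBasis.repr (P.root β) j = 0) :
        ∀ j ∉ T, (b.toWeightBasis.repr (P.root β) -
          P.pairing β k • (Finsupp.single k 1 : b.support →₀ K)) j = 0 := by
      intro j hj
      by_cases hkT : k ∈ T
      · rw [Finsupp.sub_apply, h j hj, Finsupp.smul_apply, Finsupp.single_eq_of_ne
          (by rintro rfl; exact hj hkT)]
        simp
      · have : P.pairing β k = 0 := by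
          rw [pairing_eq_sum_repr (b := b)]
          refine Finset.sum_eq_zero fun l _ ↦ ?_
          by_cases hl : l ∈ T
          · rw [hT l hl k hkT, mul_zero]
          · rw [h l hl, zero_mul]
        rw [this, zero_smul, sub_zero, h j hj]
    refine h.imp (fun h ↦ key (fun j hj k hk ↦ (hS j hj k hk).1) h) fun h ↦ ?_
    have := key (T := Sᶜ) (fun j hj k hk ↦ (hS k (not_not.mp hk) j hj).2) fun j hj ↦
      h j (not_not.mp hj)
    exact fun j hj ↦ this j (not_not.mpr hj)

/-- The support of δ is contained in a union of components or disjoint from it. Since all marks are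
positive the support is everything, and δ pairs nontrivially with some simple root, which attaches
-δ to the diagram. -/
theorem isConnectedFrom_extendedCartan (hδ : ∀ β, P.root δ - P.root β ∈
      AddSubmonoid.closure (P.root '' (b.support : Set ι)))
    (hm : P.root δ = ∑ j, m j • P.root j) :
    IsConnectedFrom (extendedCartan b δ) none := by
  have hd := isMarkedDiagram_extendedCartan hδ hm
  intro S h0 hS
  obtain ⟨j, hj, hjδ⟩ := b.exists_mem_support_pos_pairingIn_ne_zero δ
  lift j to b.support using hj
  have hjS : some j ∈ S := by
    refine hS none h0 _ (hd.ne_zero_symm _ _ ?_)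
    have := pairingIn_highestRoot_nonneg' hδ hm j
    simp only [extendedCartan]
    omega
  have hT : ∀ j ∈ {j : b.support | some j ∈ S}, ∀ k ∉ {j : b.support | some j ∈ S},
      P.pairing j k = 0 ∧ P.pairing k j = 0 := by
    intro j hj k hk
    have hjk : j ≠ k := by rintro rfl; exact hk hj
    have h1 : extendedCartan b δ (some j) (some k) = 0 := by
      by_contra h
      exact hk (hS _ hj _ h)
    have h2 : extendedCartan b δ (some k) (some j) = 0 := by
      by_contra h
      exact hd.ne_zero_symm _ _ h h1
    exact ⟨pairing_eq_zero_of_extendedCartan_eq_zero hjk h1,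
      pairing_eq_zero_of_extendedCartan_eq_zero hjk.symm h2⟩
  have hm0 (k : b.support) : b.toWeightBasis.repr (P.root δ) k ≠ 0 := by
    rw [repr_highestRoot hm]
    exact_mod_cast (mark_pos hδ hm k).ne'
  rcases repr_eq_zero_of_closed hT δ with h | h
  · refine Set.eq_univ_of_forall fun u ↦ ?_
    rcases u with _ | k
    · exact h0
    · by_contra hk
      exact hm0 k (h k hk)
  · exact absurd (h j hjS) (hm0 j)

/-- A numbering of the simple roots with given Cartan matrix and coefficients of `δ`. -/
def IsMarkedNumbering (b : P.Base) (m : b.support → ℕ) {n : ℕ} (C : Matrix (Fin n) (Fin n) ℤ)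
    (μ : Fin n → ℕ) (e : Fin n ≃ b.support) : Prop :=
  (∀ p q, b.cartanMatrix (e p) (e q) = C p q) ∧ ∀ p, m (e p) = μ p

theorem IsNumbering.exists_isMarkedNumbering {n : ℕ} {M : Matrix (Fin (n + 1)) (Fin (n + 1)) ℕ}
    {μ : Fin (n + 1) → ℕ} {x : Fin (n + 1) → Option b.support}
    (hx : IsNumbering (extendedCartan b δ) (extendedMark m) none M μ x)
    {C : Matrix (Fin n) (Fin n) ℤ}
    (hC : ∀ p q, C p q = if p = q then 2 else -(M p.succ q.succ : ℤ)) :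
    ∃ e, IsMarkedNumbering b m C (fun p ↦ μ p.succ) e := by
  obtain ⟨h0, hbij, hM, hμ⟩ := hx
  have hsome (p : Fin n) : ∃ j, x p.succ = some j := by
    rw [← Option.ne_none_iff_exists']
    intro h
    exact p.succ_ne_zero (hbij.1 (h.trans h0.symm))
  choose e he using hsome
  have hinj : Function.Injective e := fun p q h ↦ by
    have := hbij.1 ((he p).trans (h ▸ (he q).symm))
    exact Fin.succ_injective _ this
  have hsurj : Function.Surjective e := fun j ↦ by
    obtain ⟨p, hp⟩ := hbij.2 (some j)
    rcases p.eq_zero_or_eq_succ with rfl | ⟨q, rfl⟩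
    · rw [h0] at hp; cases hp
    · exact ⟨q, Option.some_injective _ ((he q).symm.trans hp)⟩
  refine ⟨Equiv.ofBijective e ⟨hinj, hsurj⟩, fun p q ↦ ?_, fun p ↦ ?_⟩
  · have h1 := hM p.succ q.succ
    rw [he, he] at h1
    change b.cartanMatrix (e p) (e q) = _
    rw [hC, ← h1]
    split_ifs with hpq
    · subst hpq
      exact b.cartanMatrix_apply_same _
    · have := b.cartanMatrix_le_zero_of_ne (e p) (e q) (hinj.ne hpq)
      simp only [extendedCartan]
      omega
  · have h1 := hμ p.succ
    rw [he] at h1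
    exact h1

/-- The simple systems whose highest root has a coefficient `4`. -/
theorem exists_isMarkedNumbering (hδ : ∀ β, P.root δ - P.root β ∈
      AddSubmonoid.closure (P.root '' (b.support : Set ι)))
    (hm : P.root δ = ∑ j, m j • P.root j) {i : b.support} (hi : m i = 4) :
    (∃ e, IsMarkedNumbering b m CartanMatrix.E₇ ![2, 2, 3, 4, 3, 2, 1] e ∧ e 3 = i) ∨
    (∃ e, IsMarkedNumbering b m CartanMatrix.E₈ ![2, 3, 4, 6, 5, 4, 3, 2] e ∧
      (e 2 = i ∨ e 5 = i)) ∨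
    ∃ e, IsMarkedNumbering b m CartanMatrix.F₄ ![2, 3, 4, 2] e ∧ e 2 = i := by
  rcases (isMarkedDiagram_extendedCartan hδ hm).classification
    (isConnectedFrom_extendedCartan hδ hm) rfl (i := some i) hi with ⟨x, hx⟩ | ⟨x, hx⟩ | ⟨x, hx⟩
  · obtain ⟨e, he⟩ := hx.exists_isMarkedNumbering (C := CartanMatrix.E₇)
      fun p q ↦ by fin_cases p <;> fin_cases q <;> rfl
    refine .inl ⟨e, he, ?_⟩
    obtain ⟨p, rfl⟩ := e.surjective i
    rw [he.2] at hi
    congr 1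
    revert p
    decide
  · obtain ⟨e, he⟩ := hx.exists_isMarkedNumbering (C := CartanMatrix.E₈)
      fun p q ↦ by fin_cases p <;> fin_cases q <;> rfl
    refine .inr (.inl ⟨e, he, ?_⟩)
    obtain ⟨p, rfl⟩ := e.surjective i
    rw [he.2] at hi
    refine Or.imp (congrArg e) (congrArg e) ?_
    revert p
    decide
  · obtain ⟨e, he⟩ := hx.exists_isMarkedNumbering (C := CartanMatrix.F₄)
      fun p q ↦ by fin_cases p <;> fin_cases q <;> rfl
    refine .inr (.inr ⟨e, he, ?_⟩)
    obtain ⟨p, rfl⟩ := e.surjective i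
    rw [he.2] at hi
    congr 1
    revert p
    decide

end HighestRoot

/-! ### The complexification, its conjugation and its automorphisms. -/

section RealStructure

variable {g : Type*} [LieRing g] [LieAlgebra ℝ g]

/-- Complex conjugation of `g_ℂ` with respect to the real form `g`. -/
noncomputable def conj (g : Type*) [LieRing g] [LieAlgebra ℝ g] :
    ℂ ⊗[ℝ] g →ₗ⁅ℝ⁆ ℂ ⊗[ℝ] g :=
  LieAlgebra.ExtendScalars.map (Complex.conjAe : ℂ →ₐ[ℝ] ℂ) LieHom.id

@[simp]
theorem conj_tmul (c : ℂ) (x : g) :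
    conj g (c ⊗ₜ[ℝ] x) = (starRingEnd ℂ c) ⊗ₜ[ℝ] x :=
  rfl

theorem conj_smul (c : ℂ) (y : ℂ ⊗[ℝ] g) : conj g (c • y) = starRingEnd ℂ c • conj g y := by
  induction y using TensorProduct.induction_on with
  | zero => simp
  | tmul d x => simp [TensorProduct.smul_tmul']
  | add a b ha hb => simp [ha, hb]

@[simp]
theorem conj_conj (y : ℂ ⊗[ℝ] g) : conj g (conj g y) = y := by
  induction y using TensorProduct.induction_on with
  | zero => simp
  | tmul d x => simp
  | add a b ha hb => simp [ha, hb]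

theorem conj_re_add_im (a b : g) :
    conj g ((1 : ℂ) ⊗ₜ[ℝ] a + Complex.I ⊗ₜ[ℝ] b) =
      (1 : ℂ) ⊗ₜ[ℝ] a - Complex.I ⊗ₜ[ℝ] b := by
  simp [TensorProduct.neg_tmul, sub_eq_add_neg]

theorem one_tmul_injective : Function.Injective fun x : g ↦ (1 : ℂ) ⊗ₜ[ℝ] x := by
  intro x y h
  simpa [part_tmul] using congrArg (part g Complex.reLm) h

theorem eq_one_tmul_of_conj_eq {y : ℂ ⊗[ℝ] g} (h : conj g y = y) :
    (1 : ℂ) ⊗ₜ[ℝ] part g Complex.reLm y = y := by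
  have h1 := eq_re_add_im y
  set a := part g Complex.reLm y
  set b := part g Complex.imLm y
  have h2 : conj g y = (1 : ℂ) ⊗ₜ[ℝ] a - Complex.I ⊗ₜ[ℝ] b := by rw [h1, conj_re_add_im]
  have h3 : (2 : ℂ) • y = (2 : ℂ) • (1 : ℂ) ⊗ₜ[ℝ] a := by
    rw [two_smul, two_smul]
    nth_rewrite 1 [← h]
    rw [h2, h1]; abel
  exact ((smul_right_inj two_ne_zero).mp h3).symm

/-- The real form is the fixed point set of the conjugation, so an automorphism commuting with the
conjugation preserves it. -/
theorem exists_eq_one_tmul_of_conj_comm {φ : ℂ ⊗[ℝ] g ≃ₗ⁅ℂ⁆ ℂ ⊗[ℝ] g}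
    (h : ∀ y, conj g (φ y) = φ (conj g y)) :
    ∃ τ : g ≃ₗ⁅ℝ⁆ g, ∀ x : g, (1 : ℂ) ⊗ₜ[ℝ] τ x = φ ((1 : ℂ) ⊗ₜ[ℝ] x) := by
  have h' (y) : conj g (φ.symm y) = φ.symm (conj g y) := by
    apply φ.injective
    change φ (conj g (φ.symm y)) = φ (φ.symm (conj g y))
    rw [← h, LieEquiv.apply_symm_apply, LieEquiv.apply_symm_apply]
  have h1 (x : g) : (1 : ℂ) ⊗ₜ[ℝ] part g Complex.reLm (φ ((1 : ℂ) ⊗ₜ[ℝ] x)) =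
      φ ((1 : ℂ) ⊗ₜ[ℝ] x) := eq_one_tmul_of_conj_eq (by simp [h])
  have h2 (x : g) : (1 : ℂ) ⊗ₜ[ℝ] part g Complex.reLm (φ.symm ((1 : ℂ) ⊗ₜ[ℝ] x)) =
      φ.symm ((1 : ℂ) ⊗ₜ[ℝ] x) := eq_one_tmul_of_conj_eq (by simp [h'])
  refine ⟨{
    toFun := fun x ↦ part g Complex.reLm (φ ((1 : ℂ) ⊗ₜ[ℝ] x))
    invFun := fun x ↦ part g Complex.reLm (φ.symm ((1 : ℂ) ⊗ₜ[ℝ] x))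
    map_add' := fun x y ↦ by simp [TensorProduct.tmul_add]
    map_smul' := fun c x ↦ by
      apply one_tmul_injective
      have h3 (z : g) : (1 : ℂ) ⊗ₜ[ℝ] (c • z) = (c : ℂ) • (1 : ℂ) ⊗ₜ[ℝ] z := by
        simp [TensorProduct.smul_tmul']
      change (1 : ℂ) ⊗ₜ[ℝ] _ = (1 : ℂ) ⊗ₜ[ℝ] _
      rw [RingHom.id_apply, h1, h3, h3, h1, map_smul]
    map_lie' := fun {x y} ↦ by
      apply one_tmul_injective
      have h3 (z w : g) : (1 : ℂ) ⊗ₜ[ℝ] ⁅z, w⁆ = ⁅(1 : ℂ) ⊗ₜ[ℝ] z, (1 : ℂ) ⊗ₜ[ℝ] w⁆ := by simp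
      change (1 : ℂ) ⊗ₜ[ℝ] part g Complex.reLm _ = (1 : ℂ) ⊗ₜ[ℝ] ⁅part g _ _, part g _ _⁆
      rw [h1, h3, h3, h1, h1, LieEquiv.map_lie]
    left_inv := fun x ↦ by
      apply one_tmul_injective
      change (1 : ℂ) ⊗ₜ[ℝ] part g _ (φ.symm ((1 : ℂ) ⊗ₜ[ℝ] part g _ _)) = (1 : ℂ) ⊗ₜ[ℝ] x
      rw [h2, h1, LieEquiv.symm_apply_apply]
    right_inv := fun x ↦ by
      apply one_tmul_injective
      change (1 : ℂ) ⊗ₜ[ℝ] part g _ (φ ((1 : ℂ) ⊗ₜ[ℝ] part g _ _)) = (1 : ℂ) ⊗ₜ[ℝ] x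
      rw [h1, h2, LieEquiv.apply_symm_apply] }, h1⟩

/-- The complex-linear extension of an automorphism of `g`. -/
noncomputable def extendC (τ : g ≃ₗ⁅ℝ⁆ g) : ℂ ⊗[ℝ] g ≃ₗ⁅ℂ⁆ ℂ ⊗[ℝ] g :=
  { LinearEquiv.baseChange ℝ ℂ g g τ.toLinearEquiv with
    map_lie' := fun {x y} ↦ by
      change (LinearEquiv.baseChange ℝ ℂ g g τ.toLinearEquiv) ⁅x, y⁆ =
        ⁅LinearEquiv.baseChange ℝ ℂ g g τ.toLinearEquiv x,
          LinearEquiv.baseChange ℝ ℂ g g τ.toLinearEquiv y⁆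
      induction x using TensorProduct.induction_on with
      | zero => rw [zero_lie, map_zero, zero_lie]
      | add a b ha hb => rw [add_lie, map_add, map_add, add_lie, ha, hb]
      | tmul c x =>
        induction y using TensorProduct.induction_on with
        | zero =>
          have h0 (z : ℂ ⊗[ℝ] g) : ⁅z, (0 : ℂ ⊗[ℝ] g)⁆ = 0 := by
            rw [← lie_skew, zero_lie, neg_zero]
          rw [h0, map_zero, h0]
        | add a b ha hb =>
          have h0 (u v w : ℂ ⊗[ℝ] g) : ⁅u, v + w⁆ = ⁅u, v⁆ + ⁅u, w⁆ := LieRing.lie_add u v w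
          rw [h0, map_add, map_add, h0, ha, hb]
        | tmul d y =>
          simp only [LieAlgebra.ExtendScalars.bracket_tmul, LinearEquiv.baseChange_tmul]
          congr 1
          exact LieEquiv.map_lie τ x y }

@[simp]
theorem extendC_tmul (τ : g ≃ₗ⁅ℝ⁆ g) (c : ℂ) (x : g) :
    extendC τ (c ⊗ₜ[ℝ] x) = c ⊗ₜ[ℝ] τ x :=
  rfl

theorem extendC_symm_apply (τ : g ≃ₗ⁅ℝ⁆ g) (y : ℂ ⊗[ℝ] g) :
    (extendC τ).symm y = extendC τ.symm y := by
  apply (extendC τ).injective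
  change extendC τ ((extendC τ).symm y) = extendC τ (extendC τ.symm y)
  rw [LieEquiv.apply_symm_apply]
  induction y using TensorProduct.induction_on with
  | zero => simp
  | tmul d x => simp
  | add a b ha hb => rw [map_add, map_add, ← ha, ← hb]

/-- The inclusion of `t` into `t_ℂ`. -/
noncomputable def incl (t : LieSubalgebra ℝ g) (x : t) : complexify t :=
  ⟨(1 : ℂ) ⊗ₜ[ℝ] (x : g), tmul_mem_complexify t x.2 1⟩

theorem exists_eq_incl_add (t : LieSubalgebra ℝ g) (y : complexify t) :
    ∃ a b : t, y = incl t a + Complex.I • incl t b := by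
  refine ⟨⟨_, part_mem t Complex.reLm y.2⟩, ⟨_, part_mem t Complex.imLm y.2⟩, Subtype.ext ?_⟩
  refine (eq_re_add_im (y : ℂ ⊗[ℝ] g)).trans ?_
  simp [incl, TensorProduct.smul_tmul']

theorem dual_ext_incl {t : LieSubalgebra ℝ g} {φ ψ : Module.Dual ℂ (complexify t)}
    (h : ∀ x, φ (incl t x) = ψ (incl t x)) : φ = ψ := by
  ext y
  obtain ⟨a, b, rfl⟩ := exists_eq_incl_add t y
  simp [h]

end RealStructure

section Compact

variable {g : Type*} [LieRing g] [LieAlgebra ℝ g] [FiniteDimensional ℝ g]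

theorem killingForm_tmul (a b : g) (c d : ℂ) :
    killingForm ℂ (ℂ ⊗[ℝ] g) (c ⊗ₜ[ℝ] a) (d ⊗ₜ[ℝ] b) = c * d * (killingForm ℝ g a b : ℂ) := by
  have := LieModule.traceForm_baseChange (R := ℝ) (A := ℂ) (L := g) (M := g)
  rw [killingForm, this]
  simp [mul_comm]

variable [IsCompactLie g]

/-- For e = a + √-1·b the value is κ(a, a) + κ(b, b). -/
theorem exists_killingForm_conj_eq {e : ℂ ⊗[ℝ] g} (he : e ≠ 0) :
    ∃ r : ℝ, r < 0 ∧ killingForm ℂ (ℂ ⊗[ℝ] g) e (conj g e) = r := by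
  have h1 := eq_re_add_im e
  set a := part g Complex.reLm e
  set b := part g Complex.imLm e
  refine ⟨killingForm ℝ g a a + killingForm ℝ g b b, ?_, ?_⟩
  · have hnonpos (x : g) : killingForm ℝ g x x ≤ 0 := by
      rcases eq_or_ne x 0 with rfl | hx
      · simp
      · exact (IsCompactLie.killing_neg x hx).le
    rcases eq_or_ne a 0 with ha | ha
    · have hb : b ≠ 0 := by
        rintro hb
        exact he (by rw [h1, ha, hb]; simp)
      linarith [hnonpos a, IsCompactLie.killing_neg b hb]
    · linarith [hnonpos b, IsCompactLie.killing_neg a ha]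
  · rw [h1, conj_re_add_im]
    simp only [map_add, map_sub, LinearMap.add_apply, killingForm_tmul]
    have := LieModule.traceForm_comm ℝ g g a b
    rw [← killingForm] at this
    rw [this]
    push_cast
    linear_combination (- (killingForm ℝ g b b : ℂ)) * Complex.I_mul_I

theorem isCompactConj_conj (t : LieSubalgebra ℝ g) :
    IsCompactConj (complexify t) ((conj g : ℂ ⊗[ℝ] g →ₗ[ℝ] ℂ ⊗[ℝ] g) : ℂ ⊗[ℝ] g →+ ℂ ⊗[ℝ] g) where
  conj_lie x y := LieHom.map_lie (conj g) x y
  conj_smul := conj_smul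
  invol := conj_conj
  map_mem y hy := by
    obtain ⟨a, b, h⟩ := exists_eq_incl_add t ⟨y, hy⟩
    have h' : y = (1 : ℂ) ⊗ₜ[ℝ] (a : g) + Complex.I • (1 : ℂ) ⊗ₜ[ℝ] (b : g) :=
      congrArg Subtype.val h
    have h2 : conj g y = (1 : ℂ) ⊗ₜ[ℝ] (a : g) - Complex.I • (1 : ℂ) ⊗ₜ[ℝ] (b : g) := by
      rw [h', map_add, conj_smul]
      simp [sub_eq_add_neg]
    change conj g y ∈ complexify t
    rw [h2]
    exact sub_mem (tmul_mem_complexify t a.2 1)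
      ((complexify t).smul_mem _ (tmul_mem_complexify t b.2 1))
  killing_neg x hx := exists_killingForm_conj_eq hx

end Compact

/-! ### The action of exp(ad x) on eigenvectors, and the centralizer of K. -/

open LieAlgebra LieModule

section ExpAd

variable {L : Type*} [LieRing L] [LieAlgebra ℂ L] {x : L} {F : L →ₗ[ℂ] L}

theorem ad_pow_apply_of_lie_eq_smul {y : L} {c : ℂ} (hy : ⁅x, y⁆ = c • y) (n : ℕ) :
    ((ad ℂ L x) ^ n) y = c ^ n • y := by
  induction n with
  | zero => simp
  | succ n ih =>
    rw [pow_succ', Module.End.mul_apply, ih, map_smul, ad_apply, hy, smul_smul, pow_succ]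

/-- Against each functional the defining series becomes the scalar exponential series, and
functionals separate points. -/
theorem IsExpAd.apply_of_lie_eq_smul (h : IsExpAd x F) {y : L} {c : ℂ} (hy : ⁅x, y⁆ = c • y) :
    F y = Complex.exp c • y := by
  rw [← sub_eq_zero, ← Module.forall_dual_apply_eq_zero_iff ℂ]
  intro φ
  have h1 := h φ y
  have h2 : HasSum (fun n : ℕ ↦ (n.factorial : ℂ)⁻¹ * φ (((ad ℂ L x) ^ n) y))
      (Complex.exp c * φ y) := by
    have := (NormedSpace.expSeries_div_hasSum_exp c).mul_right (φ y)
    rw [← Complex.exp_eq_exp_ℂ] at this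
    have h3 : (fun n : ℕ ↦ (n.factorial : ℂ)⁻¹ * φ (((ad ℂ L x) ^ n) y)) =
        fun n : ℕ ↦ c ^ n / n.factorial * φ y := by
      funext n
      rw [ad_pow_apply_of_lie_eq_smul hy, map_smul, smul_eq_mul]
      ring
    rw [h3]
    exact this
  rw [map_sub, map_smul, smul_eq_mul, h1.unique h2, sub_self]

theorem IsExpAd.apply_smul_self {c : ℂ} (h : IsExpAd (c • x) F) (d : ℂ) : F (d • x) = d • x := by
  rw [h.apply_of_lie_eq_smul (c := 0) (by simp)]
  simp

theorem smul_lie_eq_zero {y : L} (h : ⁅x, y⁆ = 0) (c : ℂ) : ⁅c • x, y⁆ = 0 := by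
  rw [smul_lie, h, smul_zero]

end ExpAd

section FixedPoints

variable {L : Type*} [LieRing L] [LieAlgebra ℂ L] [FiniteDimensional ℂ L]
  {H : LieSubalgebra ℂ L} [H.IsCartanSubalgebra] [IsKilling ℂ L] {K : H} {s : L →ₗ[ℂ] L}

theorem IsExpAd.apply_of_mem_rootSpace {c : ℂ} (h : IsExpAd (c • (K : L)) s)
    {α : Weight ℂ H L} {x : L} (hx : x ∈ rootSpace H α) :
    s x = Complex.exp (c * α K) • x :=
  h.apply_of_lie_eq_smul (by rw [smul_lie, lie_eq_smul_of_mem hx, smul_smul])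

theorem exp_half_pi_mul_four_mul (n : ℤ) :
    Complex.exp ((Real.pi / 2 : ℝ) * Complex.I * (n * 4)) = 1 := by
  rw [Complex.exp_eq_one_iff]
  exact ⟨n, by push_cast; ring⟩

/-- For |k| ≤ 3, exp(πik/2) = 1 only if k = 0. This is where a mark 3 differs from a mark 4. -/
theorem lie_eq_zero_of_apply_eq (h : IsExpAd (((Real.pi / 2 : ℝ) * Complex.I : ℂ) • (K : L)) s)
    (hK : ∀ α : Weight ℂ H L, ∃ k : ℤ, |k| ≤ 3 ∧ α K = k) {x : L} (hx : s x = x) :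
    ⁅(K : L), x⁆ = 0 := by
  set c : ℂ := (Real.pi / 2 : ℝ) * Complex.I with hc
  -- T inverts s - 1 up to ad K, so that ad K = T ∘ (s - 1). At the eigenvalue 0 the quotient 0/0
  -- takes the value 0, consistently with ad K being zero there.
  obtain ⟨T, hT⟩ := exists_map_eq_smul (fun z ↦ z / (Complex.exp (c * z) - 1)) K
  have key : ∀ y : L, ⁅(K : L), y⁆ = T (s y - y) := by
    refine induction_rootSpace (H := H) (fun y z hy hz ↦ ?_) (fun α y hy ↦ ?_) ?_
    · rw [lie_add, hy, hz, ← map_add, map_add s]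
      congr 1; abel
    · rw [lie_eq_smul_of_mem hy, h.apply_of_mem_rootSpace hy]
      have : Complex.exp (c * α K) • y - y = (Complex.exp (c * α K) - 1) • y := by
        rw [sub_smul, one_smul]
      rw [this, map_smul, hT α y hy, smul_smul]
      congr 1
      obtain ⟨k, hk, hαk⟩ := hK α
      rcases eq_or_ne k 0 with rfl | hk0
      · simp [hαk]
      · rw [mul_div_cancel₀]
        rw [hαk, sub_ne_zero, ne_eq, Complex.exp_eq_one_iff]
        rintro ⟨n, hn⟩
        have hpi : (Real.pi : ℂ) ≠ 0 := by exact_mod_cast Real.pi_ne_zero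
        have h4 : (k : ℂ) = 4 * n := by
          have h5 : (Real.pi * Complex.I : ℂ) * (k : ℂ) = (Real.pi * Complex.I : ℂ) * (4 * n) := by
            rw [hc] at hn; push_cast at hn; linear_combination 2 * hn
          exact mul_left_cancel₀ (mul_ne_zero hpi Complex.I_ne_zero) h5
        have h6 : k = 4 * n := by exact_mod_cast h4
        rw [abs_le] at hk
        omega
    · simp
  rw [key, hx, sub_self, map_zero]

end FixedPoints

/-! ### Automorphisms preserving the Cartan subalgebra. -/

section RootAutomorphism

variable {L : Type*} [LieRing L] [LieAlgebra ℂ L] [FiniteDimensional ℂ L]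
  {H : LieSubalgebra ℂ L} [H.IsCartanSubalgebra] [IsKilling ℂ L]
  {φ : L ≃ₗ⁅ℂ⁆ L} {F : H ≃ₗ[ℂ] H}

theorem map_mem_rootSpace (hF : ∀ y : H, φ y = (F y : L)) {α : Weight ℂ H L} {x : L}
    (hx : x ∈ rootSpace H α) : φ x ∈ rootSpace H (α ∘ F.symm) :=
  mem_rootSpace_of_forall fun y ↦ by
    have h1 : (y : L) = φ (F.symm y) := by rw [hF, LinearEquiv.apply_symm_apply]
    rw [h1, ← LieEquiv.map_lie, lie_eq_smul_of_mem hx, map_smul]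
    simp

/-- An automorphism that preserves a Cartan subalgebra permutes the roots and the coroots. -/
theorem exists_root_map (hF : ∀ y : H, φ y = (F y : L)) (α : H.root) : ∃ β : H.root,
    (IsKilling.rootSystem H).root β = (IsKilling.rootSystem H).root α ∘ₗ F.symm.toLinearMap ∧
      (IsKilling.rootSystem H).coroot β = F ((IsKilling.rootSystem H).coroot α) := by
  have hα : α.1.IsNonZero := LieSubalgebra.isNonZero_coe_root α
  obtain ⟨h, e, f, ht, he, hf⟩ := IsKilling.exists_isSl2Triple_of_weight_isNonZero hα
  have hh := ht.h_eq_coroot hα he hf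
  have he' := map_mem_rootSpace hF he
  have hf' := map_mem_rootSpace hF (α := -α.1) hf
  have he0 : φ e ≠ 0 := fun h0 ↦ ht.e_ne_zero (by simpa using h0)
  let β : Weight ℂ H L := ⟨α.1 ∘ F.symm, fun hb ↦ he0 (by
    rw [rootSpace, hb] at he'; simpa using he')⟩
  have hβ : β.IsNonZero := by
    intro h0
    apply hα
    ext y
    have := congrFun h0 (F y)
    simpa [β] using this
  have ht' : IsSl2Triple (φ h) (φ e) (φ f) := by
    refine ⟨fun h0 ↦ ht.h_ne_zero (by simpa using h0), ?_, ?_, ?_⟩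
    · rw [← LieEquiv.map_lie, ht.lie_e_f]
    · rw [← LieEquiv.map_lie, ht.lie_h_e_nsmul, map_nsmul]
    · rw [← LieEquiv.map_lie, ht.lie_h_f_nsmul, map_neg, map_nsmul]
  refine ⟨⟨β, by simpa [LieSubalgebra.root] using hβ⟩, ?_, ?_⟩
  · ext y
    rfl
  · have h1 := ht'.h_eq_coroot (α := β) hβ he' hf'
    rw [hh, hF] at h1
    exact (Subtype.ext h1).symm

theorem pairing_eq_of_root_eq (hF : ∀ y : H, φ y = (F y : L)) {α β α' β' : H.root}
    (hα : (IsKilling.rootSystem H).root α' =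
      (IsKilling.rootSystem H).root α ∘ₗ F.symm.toLinearMap)
    (hβ : (IsKilling.rootSystem H).root β' =
      (IsKilling.rootSystem H).root β ∘ₗ F.symm.toLinearMap) :
    (IsKilling.rootSystem H).pairing α' β' = (IsKilling.rootSystem H).pairing α β := by
  obtain ⟨γ, hγ, hγ'⟩ := exists_root_map hF β
  have : γ = β' := (IsKilling.rootSystem H).root.injective (hγ.trans hβ.symm)
  subst this
  rw [← RootPairing.root_coroot_eq_pairing, ← RootPairing.root_coroot_eq_pairing, hα, hγ']
  simp

variable {K : H} {s : L →ₗ[ℂ] L}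

theorem IsExpAd.apply_map {c : ℂ} (h : IsExpAd (c • (K : L)) s) (hF : ∀ y : H, φ y = (F y : L))
    {α : Weight ℂ H L} {x : L} (hx : x ∈ rootSpace H α) :
    s (φ x) = Complex.exp (c * α (F.symm K)) • φ x :=
  h.apply_of_lie_eq_smul (by
    have h1 : (K : L) = φ (F.symm K) := by rw [hF, LinearEquiv.apply_symm_apply]
    rw [smul_lie, h1, ← LieEquiv.map_lie, lie_eq_smul_of_mem hx, map_smul, smul_smul])

/-- On the image of the root space of α, s acts by exp(πi·α(F⁻¹K)/2); on the root space itself, by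
exp(πi·α(K)/2). The scalars agree when the two values differ by a multiple of 4, and testing simple
roots is enough. -/
theorem comm_of_root_apply (hF : ∀ y : H, φ y = (F y : L))
    (h : IsExpAd (((Real.pi / 2 : ℝ) * Complex.I : ℂ) • (K : L)) s)
    (b : (IsKilling.rootSystem H).Base)
    (hK : ∀ j : b.support, ∃ n : ℤ, (IsKilling.rootSystem H).root j (F.symm K - K) = n * 4)
    (x : L) : φ (s x) = s (φ x) := by
  refine induction_rootSpace (H := H) (p := fun x ↦ φ (s x) = s (φ x))
    (fun y z hy hz ↦ ?_) (fun α y hy ↦ ?_) (by simp) x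
  · rw [map_add, map_add, map_add, map_add, hy, hz]
  · obtain ⟨n, hn⟩ := exists_int_apply b hK α
    have hα : α (F.symm K) = α K + n * 4 := by
      rw [← hn, ← Weight.toLinear_apply, ← Weight.toLinear_apply, ← Weight.toLinear_apply, map_sub]
      ring
    rw [h.apply_map hF hy, h.apply_of_mem_rootSpace hy, map_smul, hα, mul_add, Complex.exp_add,
      exp_half_pi_mul_four_mul, mul_one]

/-- The same comparison with the opposite sign, written as sφs = φ so that no inverse of the linear
map s is needed. -/
theorem anticomm_of_root_apply (hF : ∀ y : H, φ y = (F y : L))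
    (h : IsExpAd (((Real.pi / 2 : ℝ) * Complex.I : ℂ) • (K : L)) s)
    (b : (IsKilling.rootSystem H).Base)
    (hK : ∀ j : b.support, ∃ n : ℤ, (IsKilling.rootSystem H).root j (F.symm K + K) = n * 4)
    (x : L) : s (φ (s x)) = φ x := by
  refine induction_rootSpace (H := H) (p := fun x ↦ s (φ (s x)) = φ x)
    (fun y z hy hz ↦ ?_) (fun α y hy ↦ ?_) (by simp) x
  · rw [map_add, map_add, map_add, map_add, hy, hz]
  · obtain ⟨n, hn⟩ := exists_int_apply b hK α
    have hα : α K + α (F.symm K) = n * 4 := by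
      rw [← hn, ← Weight.toLinear_apply, ← Weight.toLinear_apply, ← Weight.toLinear_apply, map_add]
      ring
    rw [h.apply_of_mem_rootSpace hy, map_smul, map_smul, h.apply_map hF hy, smul_smul,
      ← Complex.exp_add, ← mul_add, hα, exp_half_pi_mul_four_mul, one_smul]

end RootAutomorphism

/-! ### Restriction of automorphisms to the torus. -/

open LieAlgebra LieModule

section Restriction

variable {g : Type*} [LieRing g] [LieAlgebra ℝ g] {t : LieSubalgebra ℝ g}
  {τ : g ≃ₗ⁅ℝ⁆ g} {f : t ≃ₗ[ℝ] t}

@[simp]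
theorem onT_neg (φ : Module.Dual ℂ (complexify t)) : onT (-φ) = -onT φ := rfl

theorem onT_injective : Function.Injective (onT : Module.Dual ℂ (complexify t) → t →ₗ[ℝ] ℂ) :=
  fun _ _ h ↦ dual_ext_incl fun x ↦ LinearMap.congr_fun h x

theorem restrict_symm (h : ∀ x : t, τ (x : g) = (f x : g)) (x : t) :
    τ.symm (x : g) = (f.symm x : g) := by
  apply τ.injective
  change τ (τ.symm x) = τ (f.symm x)
  rw [LieEquiv.apply_symm_apply, h, LinearEquiv.apply_symm_apply]

theorem extendC_incl (h : ∀ x : t, τ (x : g) = (f x : g)) (x : t) :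
    extendC τ (incl t x) = (incl t (f x) : ℂ ⊗[ℝ] g) := by
  change extendC τ ((1 : ℂ) ⊗ₜ[ℝ] (x : g)) = (1 : ℂ) ⊗ₜ[ℝ] (f x : g)
  rw [extendC_tmul, h]

theorem extendC_mem (h : ∀ x : t, τ (x : g) = (f x : g)) {y : ℂ ⊗[ℝ] g}
    (hy : y ∈ complexify t) : extendC τ y ∈ complexify t := by
  obtain ⟨a, b, hab⟩ := exists_eq_incl_add t ⟨y, hy⟩
  have h' : y = (incl t a : ℂ ⊗[ℝ] g) + Complex.I • (incl t b : ℂ ⊗[ℝ] g) :=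
    congrArg Subtype.val hab
  rw [h', map_add, map_smul, extendC_incl h, extendC_incl h]
  exact add_mem (SetLike.coe_mem _) ((complexify t).smul_mem _ (SetLike.coe_mem _))

/-- The action on `t_ℂ` of an automorphism of `g` preserving `t`. -/
noncomputable def extendT (h : ∀ x : t, τ (x : g) = (f x : g)) :
    complexify t ≃ₗ[ℂ] complexify t where
  toFun y := ⟨extendC τ y, extendC_mem h y.2⟩
  map_add' x y := Subtype.ext (map_add (extendC τ) _ _)
  map_smul' c x := Subtype.ext (map_smul (extendC τ) _ _)
  invFun y := ⟨extendC τ.symm y, extendC_mem (restrict_symm h) y.2⟩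
  left_inv y := Subtype.ext (by
    change extendC τ.symm (extendC τ y) = y
    rw [← extendC_symm_apply]
    exact LieEquiv.symm_apply_apply _ _)
  right_inv y := Subtype.ext (by
    change extendC τ (extendC τ.symm y) = y
    rw [← extendC_symm_apply]
    exact LieEquiv.apply_symm_apply _ _)

theorem extendC_coe (h : ∀ x : t, τ (x : g) = (f x : g)) (y : complexify t) :
    extendC τ y = (extendT h y : ℂ ⊗[ℝ] g) :=
  rfl

theorem extendT_incl (h : ∀ x : t, τ (x : g) = (f x : g)) (x : t) :
    extendT h (incl t x) = incl t (f x) :=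
  Subtype.ext (extendC_incl h x)

theorem extendT_symm_incl (h : ∀ x : t, τ (x : g) = (f x : g)) (x : t) :
    (extendT h).symm (incl t x) = incl t (f.symm x) := by
  rw [LinearEquiv.symm_apply_eq, extendT_incl, LinearEquiv.apply_symm_apply]

theorem act_onT (h : ∀ x : t, τ (x : g) = (f x : g)) (φ : Module.Dual ℂ (complexify t)) :
    act f (onT φ) = onT (φ ∘ₗ (extendT h).symm.toLinearMap) := by
  ext x
  change φ (incl t (f.symm x)) = φ ((extendT h).symm (incl t x))
  rw [extendT_symm_incl]

end Restriction

theorem map_fixedPoints_eq {g : Type*} [LieRing g] [LieAlgebra ℝ g] {σ τ : g ≃ₗ⁅ℝ⁆ g}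
    (hτ : ∀ x, τ (τ x) = x) (h : ∀ x, σ x = x → σ (τ x) = τ x) :
    (fixedPoints σ).map τ.toLieHom = fixedPoints σ := by
  ext x
  rw [LieSubalgebra.mem_map]
  constructor
  · rintro ⟨y, hy, rfl⟩
    exact h y hy
  · intro hx
    exact ⟨τ x, h x hx, hτ x⟩

/-! ### Commutation with σ, and exclusion of the mark 3. -/

section Commutation

variable {g : Type*} [LieRing g] [LieAlgebra ℝ g] [FiniteDimensional ℝ g] [IsCompactLie g]
  {t : LieSubalgebra ℝ g} [IsMaximalAbelian t] {K : complexify t} {σ τ : g ≃ₗ⁅ℝ⁆ g}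
  {f : t ≃ₗ[ℝ] t}

theorem comm_of_root_apply_extendT (h : ∀ x : t, τ (x : g) = (f x : g))
    (hσ : IsExpAd (((Real.pi / 2 : ℝ) * Complex.I : ℂ) • (K : ℂ ⊗[ℝ] g))
      ((σ.toLinearEquiv : g →ₗ[ℝ] g).baseChange ℂ)) (b : (roots t).Base)
    (hK : ∀ j : b.support, ∃ n : ℤ, (roots t).root j ((extendT h).symm K - K) = n * 4) (x : g) :
    τ (σ x) = σ (τ x) := by
  apply one_tmul_injective
  exact comm_of_root_apply (extendC_coe h) hσ b hK ((1 : ℂ) ⊗ₜ[ℝ] x)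

theorem anticomm_of_root_apply_extendT (h : ∀ x : t, τ (x : g) = (f x : g))
    (hσ : IsExpAd (((Real.pi / 2 : ℝ) * Complex.I : ℂ) • (K : ℂ ⊗[ℝ] g))
      ((σ.toLinearEquiv : g →ₗ[ℝ] g).baseChange ℂ)) (b : (roots t).Base)
    (hK : ∀ j : b.support, ∃ n : ℤ, (roots t).root j ((extendT h).symm K + K) = n * 4) (x : g) :
    σ (τ (σ x)) = τ x := by
  apply one_tmul_injective
  exact anticomm_of_root_apply (extendC_coe h) hσ b hK ((1 : ℂ) ⊗ₜ[ℝ] x)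

variable {b : (roots t).Base} {i : b.support}

theorem ext_of_simple_apply {x y : complexify t}
    (h : ∀ j : b.support, (roots t).root j x = (roots t).root j y) : x = y := by
  have h1 : ∀ φ : Module.Dual ℂ (complexify t), φ x = φ y := by
    intro φ
    have h2 : Module.Dual.eval ℂ _ x = Module.Dual.eval ℂ _ y :=
      b.toWeightBasis.ext fun j ↦ by
        rw [b.toWeightBasis_apply]
        exact h j
    exact LinearMap.congr_fun h2 φ
  rw [← sub_eq_zero, ← Module.forall_dual_apply_eq_zero_iff ℂ]
  intro φ
  rw [map_sub, h1, sub_self]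

theorem root_apply_eq_repr (hKi : (roots t).root i K = 1)
    (hK : ∀ j : b.support, j ≠ i → (roots t).root j K = 0) (φ : Module.Dual ℂ (complexify t)) :
    φ K = b.toWeightBasis.repr φ i := by
  classical
  have h := congrArg (fun ψ : Module.Dual ℂ (complexify t) ↦ ψ K) (b.toWeightBasis.sum_repr φ)
  simp only [LinearMap.sum_apply, LinearMap.smul_apply, smul_eq_mul, b.toWeightBasis_apply] at h
  rw [← h, Finset.sum_eq_single i]
  · rw [hKi, mul_one]
  · intro j _ hj
    rw [hK j hj, mul_zero]
  · simp

/-- If mᵢ = 3, fixed vectors of σ commute with K. The element √-1·K is real, nonzero and fixed by σ,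
so it spans a line in the center of the fixed point algebra. -/
theorem mark_ne_three (δ : (complexify t).root) (hδ : IsHighestRoot b δ)
    (m : b.support → ℕ) (hm : (roots t).root δ = ∑ j, m j • (roots t).root j)
    (hKi : (roots t).root i K = 1)
    (hK : ∀ j : b.support, j ≠ i → (roots t).root j K = 0)
    (hσ : IsExpAd (((Real.pi / 2 : ℝ) * Complex.I : ℂ) • (K : ℂ ⊗[ℝ] g))
      ((σ.toLinearEquiv : g →ₗ[ℝ] g).baseChange ℂ))
    (hz : Module.finrank ℝ (LieAlgebra.center ℝ (fixedPoints σ)) = 0) : m i ≠ 3 := by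
  intro h3
  have hroot (α : (complexify t).root) : ∃ k : ℤ, |k| ≤ 3 ∧ (roots t).root α K = k := by
    obtain ⟨k, hk⟩ := exists_int_repr_root (b := b) α i
    refine ⟨k, ?_, by rw [root_apply_eq_repr hKi hK, hk]⟩
    have h1 := repr_le_mark hδ hm hk
    have h2 := neg_mark_le_repr hδ hm hk
    rw [abs_le]
    omega
  have hweight (α : Weight ℂ (complexify t) (ℂ ⊗[ℝ] g)) : ∃ k : ℤ, |k| ≤ 3 ∧ α K = k := by
    by_cases hα : α.IsZero
    · exact ⟨0, by simp, by rw [hα]; simp⟩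
    · exact hroot ⟨α, by simpa [LieSubalgebra.root] using hα⟩
  have hθ := isCompactConj_conj t
  -- Roots take integer values on K, and `star_apply` then says that the conjugate of K has the
  -- opposite values; so K is imaginary.
  have hconj : (⟨conj g K, hθ.map_mem K K.2⟩ : complexify t) = -K := by
    refine ext_of_simple_apply (b := b) fun j ↦ ?_
    have h1 := hθ.star_apply j.1.1 K
    obtain ⟨k, -, hk⟩ := hroot j
    have hk' : j.1.1 K = k := hk
    rw [hk'] at h1
    have h2 := congrArg (starRingEnd ℂ) h1
    rw [Complex.conj_conj] at h2
    rw [map_neg, hk]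
    refine Eq.trans (b := j.1.1 ⟨conj g K, hθ.map_mem K K.2⟩) rfl (h2.trans ?_)
    simp
  have hIK : conj g (Complex.I • (K : ℂ ⊗[ℝ] g)) = Complex.I • (K : ℂ ⊗[ℝ] g) := by
    rw [conj_smul, show conj g K = -(K : ℂ ⊗[ℝ] g) from congrArg Subtype.val hconj]
    simp
  have hZ := eq_one_tmul_of_conj_eq hIK
  set Z : g := part g Complex.reLm (Complex.I • (K : ℂ ⊗[ℝ] g))
  have hZ0 : Z ≠ 0 := by
    intro h0
    rw [h0, TensorProduct.tmul_zero] at hZ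
    have hK0 : (K : ℂ ⊗[ℝ] g) = 0 := (smul_eq_zero.mp hZ.symm).resolve_left Complex.I_ne_zero
    have : K = 0 := Subtype.ext hK0
    rw [this, map_zero] at hKi
    exact zero_ne_one hKi
  have hZσ : Z ∈ fixedPoints σ := by
    change σ Z = Z
    apply one_tmul_injective
    have h1 := hσ.apply_smul_self Complex.I
    rw [← hZ] at h1
    exact h1
  have hcenter : (⟨Z, hZσ⟩ : fixedPoints σ) ∈ LieAlgebra.center ℝ (fixedPoints σ) := by
    rw [LieModule.mem_maxTrivSubmodule]
    rintro ⟨x, hx⟩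
    apply Subtype.ext
    change ⁅x, Z⁆ = 0
    rw [← lie_skew, neg_eq_zero]
    apply one_tmul_injective
    have h1 := lie_eq_zero_of_apply_eq hσ hweight (x := (1 : ℂ) ⊗ₜ[ℝ] x)
      (congrArg (fun y : g ↦ (1 : ℂ) ⊗ₜ[ℝ] y) hx)
    have h2 := smul_lie_eq_zero h1 Complex.I
    rw [← hZ, LieAlgebra.ExtendScalars.bracket_tmul, one_mul] at h2
    exact h2.trans (TensorProduct.tmul_zero _ _).symm
  rw [Module.finrank_zero_iff] at hz
  have := congrArg Subtype.val (Subsingleton.elim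
    (⟨⟨Z, hZσ⟩, hcenter⟩ : LieAlgebra.center ℝ (fixedPoints σ)) 0)
  exact hZ0 (congrArg Subtype.val this)

end Commutation

/-! ### A pruned search for maps satisfying pairwise conditions. -/

section PartialMaps

variable {α : Type*}

/-- The partial maps with domain `ps` and values in `xs` whose graph is pairwise compatible. -/
def partialMaps (r : α → α → α → α → Bool) (xs : List α) : List α → List (List (α × α))
  | [] => [[]]
  | p :: ps => (partialMaps r xs ps).flatMap fun a ↦
      (xs.filter fun x ↦ a.all fun qy ↦ r p x qy.1 qy.2).map fun x ↦ (p, x) :: a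

/-- Completeness of the search. Incompatible prefixes are dropped early, so the kernel can evaluate
the list without running through all functions. -/
theorem map_mem_partialMaps {r : α → α → α → α → Bool} {xs : List α} (hxs : ∀ x, x ∈ xs)
    {π : α → α} (h : ∀ p q, r p (π p) q (π q) = true) (ps : List α) :
    ps.map (fun p ↦ (p, π p)) ∈ partialMaps r xs ps := by
  induction ps with
  | nil => simp [partialMaps]
  | cons p ps ih =>
    rw [partialMaps, List.mem_flatMap]
    refine ⟨_, ih, ?_⟩
    rw [List.mem_map]
    refine ⟨π p, ?_, rfl⟩
    rw [List.mem_filter]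
    refine ⟨hxs _, ?_⟩
    simp [h]

end PartialMaps

/-! ### The extended system in simple root coordinates. -/

section Coordinates

variable {n : ℕ}

/-- The coordinates of `α₀ = -δ, α₁, …, αₙ` with respect to the simple roots. -/
def extVec (μ : Fin n → ℕ) : Fin (n + 1) → Fin n → ℤ :=
  Fin.cons (fun q ↦ -(μ q : ℤ)) fun p ↦ Pi.single p 1

/-- Orthogonality of the members of the extended system `α₀, …, αₙ`. -/
def extOrth (C : Matrix (Fin n) (Fin n) ℤ) (μ : Fin n → ℕ) : Fin (n + 1) → Fin (n + 1) → Bool :=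
  Fin.cons (Fin.cons false fun q ↦ decide (∑ r, μ r * C r q = 0)) fun p ↦
    Fin.cons (decide (∑ r, μ r * C r p = 0)) fun q ↦ decide (C p q = 0)

theorem extVec_injective (μ : Fin n → ℕ) : Function.Injective (extVec μ) := by
  intro p q h
  rcases p.eq_zero_or_eq_succ with rfl | ⟨p, rfl⟩ <;>
    rcases q.eq_zero_or_eq_succ with rfl | ⟨q, rfl⟩
  · rfl
  · have := congrFun h q
    simp [extVec] at this
    omega
  · have := congrFun h p
    simp [extVec] at this
    omega
  · have := congrFun h p
    simp [extVec, Pi.single_apply] at this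
    rw [this]

/-- The conditions on a pair of values of a permutation of the extended system. -/
def extCompat (C : Matrix (Fin n) (Fin n) ℤ) (μ : Fin n → ℕ) (k p x q y : Fin (n + 1)) : Bool :=
  decide ((x = k ↔ p = k) ∧ (x = q ↔ y = p) ∧ (x = y ↔ p = q) ∧
    (p ≠ k → q ≠ k → extOrth C μ x y = extOrth C μ p q))

end Coordinates

/-! ### The matrix of an involution of the root system. -/

section Numbering

set_option linter.unusedSectionVars false

variable {ι K M N : Type*} [Finite ι] [Field K] [CharZero K] [AddCommGroup M] [Module K M]
  [AddCommGroup N] [Module K N] {P : RootPairing ι K M N} [P.IsRootSystem] {b : P.Base}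
  {n : ℕ} {e : Fin n ≃ b.support}

theorem repr_sum_zsmul (e : Fin n ≃ b.support) (v : Fin n → ℤ) (p : Fin n) :
    b.toWeightBasis.repr (∑ q, v q • P.root (e q)) (e p) = v p := by
  classical
  simp [Finsupp.single_apply]

theorem sum_zsmul_injective (e : Fin n ≃ b.support) :
    Function.Injective fun v : Fin n → ℤ ↦ ∑ q, v q • P.root (e q) := by
  intro v w h
  funext p
  have := congrArg (fun x ↦ b.toWeightBasis.repr x (e p)) h
  simp only [repr_sum_zsmul] at this
  exact_mod_cast this

theorem exists_root_eq_sum (e : Fin n ≃ b.support) (β : ι) :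
    ∃ v : Fin n → ℤ, P.root β = ∑ q, v q • P.root (e q) := by
  choose v hv using fun q ↦ exists_int_repr_root (b := b) β (e q)
  refine ⟨v, b.toWeightBasis.repr.injective (Finsupp.ext fun j ↦ ?_)⟩
  obtain ⟨p, rfl⟩ := e.surjective j
  rw [repr_sum_zsmul, hv]

variable [P.IsCrystallographic] [P.IsReduced] {δ : ι} {m : b.support → ℕ}
  {C : Matrix (Fin n) (Fin n) ℤ} {μ : Fin n → ℕ}

/-- The index of the root `α₀ = -δ, α₁, …, αₙ`. -/
def extIdx (δ : ι) (e : Fin n ≃ b.support) : Fin (n + 1) → ι :=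
  Fin.cons (P.reflectionPerm δ δ) fun p ↦ e p

theorem highestRoot_eq_sum (he : IsMarkedNumbering b m C μ e)
    (hm : P.root δ = ∑ j, m j • P.root j) : P.root δ = ∑ q, μ q • P.root (e q) := by
  rw [hm, ← e.sum_comp]
  exact Finset.sum_congr rfl fun q _ ↦ by rw [he.2]

theorem root_extIdx (he : IsMarkedNumbering b m C μ e)
    (hm : P.root δ = ∑ j, m j • P.root j) (p : Fin (n + 1)) :
    P.root (extIdx δ e p) = ∑ q, extVec μ p q • P.root (e q) := by
  rcases p.eq_zero_or_eq_succ with rfl | ⟨p, rfl⟩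
  · simp only [extIdx, extVec, Fin.cons_zero, P.root_reflectionPerm, P.reflection_apply_self,
      neg_smul, natCast_zsmul, Finset.sum_neg_distrib]
    rw [highestRoot_eq_sum he hm]
  · simp [extIdx, extVec, Pi.single_apply]

theorem extIdx_injective (he : IsMarkedNumbering b m C μ e)
    (hm : P.root δ = ∑ j, m j • P.root j) : Function.Injective (extIdx δ e) := fun p q h ↦ by
  apply extVec_injective μ
  apply sum_zsmul_injective e
  simp only [← root_extIdx he hm, h]

theorem pairing_highestRoot_eq (he : IsMarkedNumbering b m C μ e)
    (hm : P.root δ = ∑ j, m j • P.root j) (q : Fin n) :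
    P.pairing δ (e q) = ((∑ r, μ r * C r q : ℤ) : K) := by
  rw [← P.root_coroot'_eq_pairing, highestRoot_eq_sum he hm]
  simp only [map_sum, map_nsmul, P.root_coroot'_eq_pairing, Int.cast_sum, Int.cast_mul,
    Int.cast_natCast, nsmul_eq_mul]
  refine Finset.sum_congr rfl fun r _ ↦ ?_
  rw [← he.1, ← P.algebraMap_pairingIn ℤ]
  rfl

theorem pairing_extIdx_eq_zero_iff (he : IsMarkedNumbering b m C μ e)
    (hm : P.root δ = ∑ j, m j • P.root j) (p q : Fin (n + 1)) :
    P.pairing (extIdx δ e p) (extIdx δ e q) = 0 ↔ extOrth C μ p q = true := by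
  rcases p.eq_zero_or_eq_succ with rfl | ⟨p, rfl⟩ <;>
    rcases q.eq_zero_or_eq_succ with rfl | ⟨q, rfl⟩
  · simp [extIdx, extOrth]
  · simp only [extIdx, extOrth, Fin.cons_zero, Fin.cons_succ, P.pairing_reflectionPerm_self_left,
      neg_eq_zero, pairing_highestRoot_eq he hm, decide_eq_true_eq]
    norm_cast
  · simp only [extIdx, extOrth, Fin.cons_zero, Fin.cons_succ, P.pairing_reflectionPerm_self_right,
      neg_eq_zero, decide_eq_true_eq]
    rw [P.pairing_eq_zero_iff, pairing_highestRoot_eq he hm]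
    norm_cast
  · simp only [extIdx, extOrth, Fin.cons_succ, decide_eq_true_eq]
    rw [← he.1, ← P.algebraMap_pairingIn ℤ]
    simp [RootPairing.Base.cartanMatrixIn_def]

/-- The matrix, with respect to the simple roots, of an involution that permutes the roots
`α₀, …, αₙ` other than `αₖ`. -/
theorem exists_matrix_of_involution (he : IsMarkedNumbering b m C μ e)
    (hm : P.root δ = ∑ j, m j • P.root j) {A : M ≃ₗ[K] M}
    (hA : ∀ β, ∃ γ, A (P.root β) = P.root γ)
    (hpair : ∀ β γ β' γ', A (P.root β) = P.root β' → A (P.root γ) = P.root γ' →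
      P.pairing β' γ' = P.pairing β γ)
    (hinv : ∀ x, A (A x) = x) {k : Fin n}
    (hS : ∀ p ≠ k.succ, ∃ q ≠ k.succ, A (P.root (extIdx δ e p)) = P.root (extIdx δ e q)) :
    ∃ (π : Fin (n + 1) → Fin (n + 1)) (Q : Fin n → Fin n → ℤ),
      (∀ p q, extCompat C μ k.succ p (π p) q (π q) = true) ∧
      (∀ p ≠ k, Q p = extVec μ (π p.succ)) ∧
      (∀ q, ∑ p, μ p * Q p q = -extVec μ (π 0) q) ∧
      ∀ p, A (P.root (e p)) = ∑ q, Q p q • P.root (e q) := by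
  classical
  choose! ρ hρ hAρ using hS
  -- A need not fix αₖ, nor send it into the extended system; π is completed at this index
  -- artificially, to be an involution of all n + 1 indices.
  let π (p : Fin (n + 1)) : Fin (n + 1) := if p = k.succ then k.succ else ρ p
  have hπ {p : Fin (n + 1)} (hp : p ≠ k.succ) :
      A (P.root (extIdx δ e p)) = P.root (extIdx δ e (π p)) := by
    simp only [π, if_neg hp]
    exact hAρ p hp
  have hπk (p : Fin (n + 1)) : π p = k.succ ↔ p = k.succ := by
    simp only [π]
    split_ifs with h
    · simp [h]
    · simp [h, hρ p h]
  have hππ (p : Fin (n + 1)) : π (π p) = p := by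
    by_cases hp : p = k.succ
    · have h1 := (hπk p).mpr hp
      rw [h1, (hπk _).mpr rfl, hp]
    · apply extIdx_injective he hm
      apply P.root.injective
      rw [← hπ (fun h ↦ hp ((hπk p).mp h)), ← hπ hp, hinv]
  choose γ hγ using hA
  choose Q hQ using fun p ↦ exists_root_eq_sum e (γ (e p))
  have hAQ (p : Fin n) : A (P.root (e p)) = ∑ q, Q p q • P.root (e q) := by rw [hγ, hQ]
  refine ⟨π, Q, fun p q ↦ ?_, fun p hp ↦ ?_, fun q ↦ ?_, hAQ⟩
  · simp only [extCompat, decide_eq_true_eq]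
    refine ⟨hπk p, ⟨fun h ↦ by rw [← h, hππ], fun h ↦ by rw [← h, hππ]⟩,
      ⟨fun h ↦ by rw [← hππ p, h, hππ], fun h ↦ by rw [h]⟩, fun hp hq ↦ ?_⟩
    rw [Bool.eq_iff_iff, ← pairing_extIdx_eq_zero_iff he hm, ← pairing_extIdx_eq_zero_iff he hm,
      hpair _ _ _ _ (hπ hp) (hπ hq)]
  · apply sum_zsmul_injective e
    have h1 := hπ (p := p.succ) (fun h ↦ hp (Fin.succ_injective _ h))
    rw [root_extIdx he hm (π p.succ)] at h1
    simp only [← h1, ← hAQ]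
    simp [extIdx]
  -- A is applied to α₀ = -∑ μₚαₚ and coordinates are compared. This is the only information on the
  -- row k of Q.
  · have h1 := hπ (p := 0) (Fin.succ_ne_zero k).symm
    rw [root_extIdx he hm (π 0)] at h1
    have h2 : P.root (extIdx δ e 0) = -∑ p, μ p • P.root (e p) := by
      rw [← highestRoot_eq_sum he hm]
      simp [extIdx, P.root_reflectionPerm]
    rw [h2, map_neg, map_sum] at h1
    have h3 : ∑ q, (∑ p, (μ p : ℤ) * Q p q) • P.root (e q) =
        ∑ q, (-extVec μ (π 0) q) • P.root (e q) := by
      simp only [neg_smul, Finset.sum_neg_distrib]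
      rw [← h1, neg_neg]
      simp only [map_nsmul, hAQ, Finset.smul_sum, Finset.sum_smul]
      rw [Finset.sum_comm]
      simp only [mul_smul, natCast_zsmul]
    exact congrFun (sum_zsmul_injective e h3) q

end Numbering

/-! ### Candidate permutations and the matrices they determine. -/

section Search

variable {n : ℕ}

theorem mem_of_extCompat {C : Matrix (Fin n) (Fin n) ℤ} {μ : Fin n → ℕ} {k : Fin (n + 1)}
    {π : Fin (n + 1) → Fin (n + 1)} (h : ∀ p q, extCompat C μ k p (π p) q (π q) = true)
    {S : List (Fin (n + 1) → Fin (n + 1))}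
    (hS : ∀ a ∈ partialMaps (extCompat C μ k) (List.finRange _) (List.finRange _),
      ∃ ρ ∈ S, a = (List.finRange _).map fun p ↦ (p, ρ p)) : π ∈ S := by
  obtain ⟨ρ, hρ, h1⟩ := hS _ (map_mem_partialMaps List.mem_finRange h _)
  have : π = ρ := by
    funext p
    have := List.map_inj_left.mp h1 p (List.mem_finRange p)
    exact congrArg Prod.snd this
  rwa [this]

variable {μ : Fin n → ℕ} {k : Fin n} {π : Fin (n + 1) → Fin (n + 1)} {Q R : Fin n → Fin n → ℤ}

/-- `Q` is the matrix of a linear map that permutes the members of the extended system other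
than `αₖ` as `π` does. -/
def IsExtMatrix (μ : Fin n → ℕ) (k : Fin n) (π : Fin (n + 1) → Fin (n + 1))
    (Q : Fin n → Fin n → ℤ) : Prop :=
  (∀ p ≠ k, Q p = extVec μ (π p.succ)) ∧ ∀ q, ∑ p, μ p * Q p q = -extVec μ (π 0) q

instance : Decidable (IsExtMatrix μ k π Q) := by
  unfold IsExtMatrix
  infer_instance

/-- All rows but the row k are prescribed by π, and the relation of the marks determines μₖ times
that row. -/
theorem IsExtMatrix.eq (hQ : IsExtMatrix μ k π Q) (hR : IsExtMatrix μ k π R) (hk : μ k ≠ 0) :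
    Q = R := by
  have h1 (p : Fin n) (hp : p ≠ k) : Q p = R p := (hQ.1 p hp).trans (hR.1 p hp).symm
  funext p q
  by_cases hp : p = k
  · subst hp
    have h2 := (hQ.2 q).trans (hR.2 q).symm
    rw [← Finset.add_sum_erase _ _ (Finset.mem_univ p),
      ← Finset.add_sum_erase _ (fun r ↦ (μ r : ℤ) * R r q) (Finset.mem_univ p),
      Finset.sum_congr rfl fun r hr ↦ by rw [h1 r (Finset.ne_of_mem_erase hr)]] at h2
    exact mul_left_cancel₀ (by exact_mod_cast hk) (add_right_cancel h2)
  · rw [h1 p hp]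

/-- The integrality condition for solving for the row k; with μₖ = 4 it is what discards
permutations that are diagram symmetries but do not come from the root lattice. -/
theorem IsExtMatrix.dvd (hQ : IsExtMatrix μ k π Q) (q : Fin n) :
    (μ k : ℤ) ∣ extVec μ (π 0) q + ∑ p ∈ Finset.univ.erase k, μ p * extVec μ (π p.succ) q := by
  refine ⟨-Q k q, ?_⟩
  have h2 := hQ.2 q
  rw [← Finset.add_sum_erase _ _ (Finset.mem_univ k),
    Finset.sum_congr rfl fun r hr ↦ by rw [hQ.1 r (Finset.ne_of_mem_erase hr)]] at h2
  linear_combination h2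

end Search

/-! ### The table as integer matrices. -/

section Tables

/-- Type I. -/
def matrixI : Fin 7 → Fin 7 → ℤ :=
  ![![0, 0, 0, 0, 0, 1, 0], ![0, 1, 0, 0, 0, 0, 0], ![0, 0, 0, 0, 1, 0, 0],
    ![0, 0, 0, 1, 0, 0, 0], ![0, 0, 1, 0, 0, 0, 0], ![1, 0, 0, 0, 0, 0, 0],
    ![-2, -2, -3, -4, -3, -2, -1]]

/-- Type II. -/
def matrixII : Fin 7 → Fin 7 → ℤ :=
  ![![1, 0, 0, 0, 0, 0, 0], ![0, 1, 0, 0, 0, 0, 0], ![-2, -2, -3, -4, -3, -2, -1],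
    ![1, 1, 2, 3, 2, 1, 0], ![0, 0, 0, 0, 0, 0, 1], ![0, 0, 0, 0, 0, 1, 0],
    ![0, 0, 0, 0, 1, 0, 0]]

/-- Type III. -/
def matrixIII : Fin 7 → Fin 7 → ℤ :=
  ![![0, 0, 0, 0, 0, 1, 0], ![0, 1, 0, 0, 0, 0, 0], ![0, 0, 0, 0, 0, 0, 1],
    ![1, 1, 2, 3, 2, 1, 0], ![-2, -2, -3, -4, -3, -2, -1], ![1, 0, 0, 0, 0, 0, 0],
    ![0, 0, 1, 0, 0, 0, 0]]

/-- Type IV. -/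
def matrixIV : Fin 8 → Fin 8 → ℤ :=
  ![![1, 0, 0, 0, 0, 0, 0, 0], ![-2, -3, -4, -6, -5, -4, -3, -2], ![1, 2, 3, 4, 3, 2, 1, 0],
    ![0, 0, 0, 0, 0, 0, 0, 1], ![0, 0, 0, 0, 0, 0, 1, 0], ![0, 0, 0, 0, 0, 1, 0, 0],
    ![0, 0, 0, 0, 1, 0, 0, 0], ![0, 0, 0, 1, 0, 0, 0, 0]]

/-- Type V. -/
def matrixV : Fin 8 → Fin 8 → ℤ :=
  ![![1, 0, 0, 0, 0, 0, 0, 0], ![0, 0, 0, 0, 1, 0, 0, 0], ![0, 0, 1, 0, 0, 0, 0, 0],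
    ![0, 0, 0, 1, 0, 0, 0, 0], ![0, 1, 0, 0, 0, 0, 0, 0], ![1, 1, 2, 3, 3, 3, 2, 1],
    ![-2, -3, -4, -6, -5, -4, -3, -2], ![0, 0, 0, 0, 0, 0, 0, 1]]

/-- Type VI. -/
def matrixVI : Fin 4 → Fin 4 → ℤ :=
  ![![1, 0, 0, 0], ![-2, -3, -4, -2], ![1, 2, 3, 1], ![0, 0, 0, 1]]

/-- The identity matrix. -/
def matrixOne (n : ℕ) : Fin n → Fin n → ℤ := fun p ↦ Pi.single p 1

theorem isExtMatrix_E7 {π : Fin 8 → Fin 8} {Q : Fin 7 → Fin 7 → ℤ}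
    (h : ∀ p q, extCompat CartanMatrix.E₇ ![2, 2, 3, 4, 3, 2, 1] 4 p (π p) q (π q) = true)
    (hQ : IsExtMatrix ![2, 2, 3, 4, 3, 2, 1] 3 π Q) :
    Q = matrixOne 7 ∨ Q = matrixI ∨ Q = matrixII ∨ Q = matrixIII := by
  -- Index 0 is α₀. Without α₄ the extended diagram is A₃ + A₃ + A₁; the last two permutations
  -- reverse only one A₃, and the divisibility by 4 fails for them.
  have h1 := mem_of_extCompat h (S := [id, ![7, 6, 2, 5, 4, 3, 1, 0], ![3, 1, 2, 0, 4, 7, 6, 5],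
    ![5, 6, 2, 7, 4, 0, 1, 3], ![3, 1, 2, 0, 4, 5, 6, 7], ![0, 1, 2, 3, 4, 7, 6, 5]])
    (by decide +kernel)
  simp only [List.mem_cons, List.not_mem_nil, or_false] at h1
  rcases h1 with rfl | rfl | rfl | rfl | rfl | rfl
  · exact .inl (hQ.eq (by decide +kernel) (by decide))
  · exact .inr (.inl (hQ.eq (by decide +kernel) (by decide)))
  · exact .inr (.inr (.inl (hQ.eq (by decide +kernel) (by decide))))
  · exact .inr (.inr (.inr (hQ.eq (by decide +kernel) (by decide))))
  · exact absurd (hQ.dvd) (by decide +kernel)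
  · exact absurd (hQ.dvd) (by decide +kernel)

theorem isExtMatrix_E8_two {π : Fin 9 → Fin 9} {Q : Fin 8 → Fin 8 → ℤ}
    (h : ∀ p q, extCompat CartanMatrix.E₈ ![2, 3, 4, 6, 5, 4, 3, 2] 3 p (π p) q (π q) = true)
    (hQ : IsExtMatrix ![2, 3, 4, 6, 5, 4, 3, 2] 2 π Q) :
    Q = matrixOne 8 ∨ Q = matrixIV := by
  have h1 := mem_of_extCompat h (S := [id, ![2, 1, 0, 3, 8, 7, 6, 5, 4]]) (by decide +kernel)
  simp only [List.mem_cons, List.not_mem_nil, or_false] at h1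
  rcases h1 with rfl | rfl
  · exact .inl (hQ.eq (by decide +kernel) (by decide))
  · exact .inr (hQ.eq (by decide +kernel) (by decide))

theorem isExtMatrix_E8_five {π : Fin 9 → Fin 9} {Q : Fin 8 → Fin 8 → ℤ}
    (h : ∀ p q, extCompat CartanMatrix.E₈ ![2, 3, 4, 6, 5, 4, 3, 2] 6 p (π p) q (π q) = true)
    (hQ : IsExtMatrix ![2, 3, 4, 6, 5, 4, 3, 2] 5 π Q) :
    Q = matrixOne 8 ∨ Q = matrixV := by
  -- Without α₆ the extended diagram is D₅ + A₃; the last two permutations flip only one of the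
  -- components and fail the divisibility.
  have h1 := mem_of_extCompat h (S := [id, ![7, 1, 5, 3, 4, 2, 6, 0, 8],
    ![7, 1, 2, 3, 4, 5, 6, 0, 8], ![0, 1, 5, 3, 4, 2, 6, 7, 8]]) (by decide +kernel)
  simp only [List.mem_cons, List.not_mem_nil, or_false] at h1
  rcases h1 with rfl | rfl | rfl | rfl
  · exact .inl (hQ.eq (by decide +kernel) (by decide))
  · exact .inr (hQ.eq (by decide +kernel) (by decide))
  · exact absurd (hQ.dvd) (by decide +kernel)
  · exact absurd (hQ.dvd) (by decide +kernel)

theorem isExtMatrix_F4 {π : Fin 5 → Fin 5} {Q : Fin 4 → Fin 4 → ℤ}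
    (h : ∀ p q, extCompat CartanMatrix.F₄ ![2, 3, 4, 2] 3 p (π p) q (π q) = true)
    (hQ : IsExtMatrix ![2, 3, 4, 2] 2 π Q) :
    Q = matrixOne 4 ∨ Q = matrixVI := by
  have h1 := mem_of_extCompat h (S := [id, ![2, 1, 0, 3, 4]]) (by decide +kernel)
  simp only [List.mem_cons, List.not_mem_nil, or_false] at h1
  rcases h1 with rfl | rfl
  · exact .inl (hQ.eq (by decide +kernel) (by decide))
  · exact .inr (hQ.eq (by decide +kernel) (by decide))

end Tables

/-! ### Reflection words in coordinates. -/

open LieAlgebra LieModule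

section Words

variable {n : ℕ}

/-- A simple reflection in the coordinates with respect to the simple roots. -/
def reflVec (C : Matrix (Fin n) (Fin n) ℤ) (v : Fin n → ℤ) (j : Fin n) : Fin n → ℤ :=
  fun p ↦ v p - if p = j then ∑ q, v q * C q j else 0

/-- The transpose of `conjWord` in the coordinates with respect to the simple roots. -/
def wordVec (C : Matrix (Fin n) (Fin n) ℤ) (J : List (Fin n)) :
    List (Fin n) → (Fin n → ℤ) → Fin n → ℤ
  | [], v => J.foldl (reflVec C) v
  | j :: l, v => reflVec C (wordVec C J l (reflVec C v j)) j

variable {L : Type*} [LieRing L] [LieAlgebra ℂ L] [FiniteDimensional ℂ L]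
  {H : LieSubalgebra ℂ L} [H.IsCartanSubalgebra] [IsKilling ℂ L]
  {b : (IsKilling.rootSystem H).Base} {C : Matrix (Fin n) (Fin n) ℤ} {e : Fin n ≃ b.support}

theorem sum_apply_coreflection (hC : ∀ p q, b.cartanMatrix (e p) (e q) = C p q) (v : Fin n → ℤ)
    (j : Fin n) (y : H) :
    (∑ q, v q • (IsKilling.rootSystem H).root (e q))
        ((IsKilling.rootSystem H).coreflection (e j) y) =
      (∑ q, reflVec C v j q • (IsKilling.rootSystem H).root (e q)) y := by
  have h1 (q : Fin n) : (IsKilling.rootSystem H).root (e q)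
      ((IsKilling.rootSystem H).coroot (e j)) = C q j := by
    have h2 := (IsKilling.rootSystem H).algebraMap_pairingIn ℤ (e q) (e j)
    rw [← hC]
    exact h2.symm
  have hs (v : Fin n → ℤ) (y : H) : (∑ q, v q • (IsKilling.rootSystem H).root (e q)) y =
      ∑ q, (v q : ℂ) * (IsKilling.rootSystem H).root (e q) y := by
    rw [LinearMap.sum_apply]
    exact Finset.sum_congr rfl fun q _ ↦ by rw [LinearMap.smul_apply, zsmul_eq_mul]
  have h3 : (IsKilling.rootSystem H).coreflection (e j) y =
      y - (IsKilling.rootSystem H).root (e j) y • (IsKilling.rootSystem H).coroot (e j) :=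
    RootPairing.coreflection_apply _ _ _
  rw [hs, hs, h3]
  simp only [map_sub, map_smul, h1, reflVec, Int.cast_sub, mul_sub, sub_mul,
    Finset.sum_sub_distrib, Int.cast_ite, Int.cast_zero, ite_mul, zero_mul, Finset.sum_ite_eq',
    Finset.mem_univ, if_true, smul_eq_mul, Int.cast_sum, Int.cast_mul, Finset.sum_mul]
  congr 1
  exact Finset.sum_congr rfl fun q _ ↦ by ring

/-- Moving a reflection from the vector to the linear form transposes it, so the outermost letter of
the word acts first on the coordinates v. -/
theorem sum_apply_conjWord (hC : ∀ p q, b.cartanMatrix (e p) (e q) = C p q) (J l : List (Fin n))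
    (v : Fin n → ℤ) (y : H) :
    (∑ q, v q • (IsKilling.rootSystem H).root (e q)) (conjWord (J.map e) (l.map e) y) =
      (∑ q, wordVec C J l v q • (IsKilling.rootSystem H).root (e q)) y := by
  induction l generalizing v y with
  | nil =>
    simp only [List.map_nil, conjWord, wordVec]
    induction J generalizing v y with
    | nil => rfl
    | cons j J ih =>
      simp only [List.map_cons, List.prod_cons, List.foldl_cons]
      rw [LinearEquiv.mul_apply, sum_apply_coreflection hC, ih]
  | cons j l ih =>
    simp only [List.map_cons, conjWord, wordVec]
    rw [LinearEquiv.mul_apply, LinearEquiv.mul_apply, sum_apply_coreflection hC, ih,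
      sum_apply_coreflection hC]

end Words

/-! ### Absence of diagram automorphisms for E₇, E₈ and F₄. -/

section Rigidity

variable {ι K M N : Type*} [Field K] [AddCommGroup M] [Module K M]
  [AddCommGroup N] [Module K N] {P : RootPairing ι K M N} [P.IsCrystallographic] {b : P.Base}
  {n : ℕ} {C : Matrix (Fin n) (Fin n) ℤ} {e e' : Fin n ≃ b.support}

/-- The numbering of the simple roots is determined by a Cartan matrix without automorphisms. -/
theorem numbering_unique (he : ∀ p q, b.cartanMatrix (e p) (e q) = C p q)
    (he' : ∀ p q, b.cartanMatrix (e' p) (e' q) = C p q)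
    (hC : ∀ a ∈ partialMaps (fun p x q y ↦ decide (C x y = C p q)) (List.finRange n)
      (List.finRange n), a = (List.finRange n).map fun p ↦ (p, p)) : e = e' := by
  have h1 := hC _ (map_mem_partialMaps (π := fun p ↦ e'.symm (e p)) List.mem_finRange
    (fun p q ↦ by
      rw [decide_eq_true_eq, ← he p q, ← he']; simp) _)
  ext p
  have := congrArg Prod.snd (List.map_inj_left.mp h1 p (List.mem_finRange p))
  simp only [Equiv.symm_apply_eq] at this
  rw [this]

end Rigidity

theorem rigid_E7 : ∀ a ∈ partialMaps (fun p x q y ↦ decide (CartanMatrix.E₇ x y =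
    CartanMatrix.E₇ p q)) (List.finRange 7) (List.finRange 7),
    a = (List.finRange 7).map fun p ↦ (p, p) := by
  decide +kernel

theorem rigid_E8 : ∀ a ∈ partialMaps (fun p x q y ↦ decide (CartanMatrix.E₈ x y =
    CartanMatrix.E₈ p q)) (List.finRange 8) (List.finRange 8),
    a = (List.finRange 8).map fun p ↦ (p, p) := by
  decide +kernel

theorem rigid_F4 : ∀ a ∈ partialMaps (fun p x q y ↦ decide (CartanMatrix.F₄ x y =
    CartanMatrix.F₄ p q)) (List.finRange 4) (List.finRange 4),
    a = (List.finRange 4).map fun p ↦ (p, p) := by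
  decide +kernel

/-! ### Rows of the table compared with the matrices. -/

section Rows

variable {V : Type*} [AddCommGroup V]

/-- The row of the table for Type I. -/
def rowI (a : Fin 8 → V) : Fin 7 → V :=
  ![a 6, a 2, a 5, a 4, a 3, a 1, a 0]

theorem rowI_apply (x : Fin 7 → V) (p : Fin 7) :
    rowI (Fin.cons (-∑ q, (![2, 2, 3, 4, 3, 2, 1] : Fin 7 → ℕ) q • x q) x) p =
      ∑ q, matrixI p q • x q := by
  rw [Fin.sum_univ_seven, Fin.sum_univ_seven]
  fin_cases p <;> simp [rowI, matrixI, Fin.cons] <;> abel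

/-- The row of the table for Type II. -/
def rowII (a : Fin 8 → V) : Fin 7 → V :=
  ![a 1, a 2, a 0,
    a 1 + a 2 + 2 • a 3 + 3 • a 4 + 2 • a 5 + a 6,
    a 7, a 6, a 5]

theorem rowII_apply (x : Fin 7 → V) (p : Fin 7) :
    rowII (Fin.cons (-∑ q, (![2, 2, 3, 4, 3, 2, 1] : Fin 7 → ℕ) q • x q) x) p =
      ∑ q, matrixII p q • x q := by
  rw [Fin.sum_univ_seven, Fin.sum_univ_seven]
  fin_cases p <;> simp [rowII, matrixII, Fin.cons] <;> abel

/-- The row of the table for Type III. -/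
def rowIII (a : Fin 8 → V) : Fin 7 → V :=
  ![a 6, a 2, a 7,
    a 1 + a 2 + 2 • a 3 + 3 • a 4 + 2 • a 5 + a 6,
    a 0, a 1, a 3]

theorem rowIII_apply (x : Fin 7 → V) (p : Fin 7) :
    rowIII (Fin.cons (-∑ q, (![2, 2, 3, 4, 3, 2, 1] : Fin 7 → ℕ) q • x q) x) p =
      ∑ q, matrixIII p q • x q := by
  rw [Fin.sum_univ_seven, Fin.sum_univ_seven]
  fin_cases p <;> simp [rowIII, matrixIII, Fin.cons] <;> abel

/-- The row of the table for Type IV. -/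
def rowIV (a : Fin 9 → V) : Fin 8 → V :=
  ![a 1, a 0,
    a 1 + 2 • a 2 + 3 • a 3 + 4 • a 4 + 3 • a 5 + 2 • a 6 + a 7,
    a 8, a 7, a 6, a 5, a 4]

theorem rowIV_apply (x : Fin 8 → V) (p : Fin 8) :
    rowIV (Fin.cons (-∑ q, (![2, 3, 4, 6, 5, 4, 3, 2] : Fin 8 → ℕ) q • x q) x) p =
      ∑ q, matrixIV p q • x q := by
  rw [Fin.sum_univ_eight, Fin.sum_univ_eight]
  fin_cases p <;> simp [rowIV, matrixIV, Fin.cons] <;> abel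

/-- The row of the table for Type V. -/
def rowV (a : Fin 9 → V) : Fin 8 → V :=
  ![a 1, a 5, a 3, a 4, a 2,
    a 1 + a 2 + 2 • a 3 + 3 • a 4 + 3 • a 5 + 3 • a 6 + 2 • a 7 + a 8,
    a 0, a 8]

theorem rowV_apply (x : Fin 8 → V) (p : Fin 8) :
    rowV (Fin.cons (-∑ q, (![2, 3, 4, 6, 5, 4, 3, 2] : Fin 8 → ℕ) q • x q) x) p =
      ∑ q, matrixV p q • x q := by
  rw [Fin.sum_univ_eight, Fin.sum_univ_eight]
  fin_cases p <;> simp [rowV, matrixV, Fin.cons] <;> abel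

/-- The row of the table for Type VI. -/
def rowVI (a : Fin 5 → V) : Fin 4 → V :=
  ![a 1, a 0,
    a 1 + 2 • a 2 + 3 • a 3 + a 4,
    a 4]

theorem rowVI_apply (x : Fin 4 → V) (p : Fin 4) :
    rowVI (Fin.cons (-∑ q, (![2, 3, 4, 2] : Fin 4 → ℕ) q • x q) x) p =
      ∑ q, matrixVI p q • x q := by
  rw [Fin.sum_univ_four, Fin.sum_univ_four]
  fin_cases p <;> simp [rowVI, matrixVI, Fin.cons] <;> abel

end Rows

/-! ### Assembling the classification, the converse and the commutation rules. -/

open LieAlgebra LieModule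

section Sums

variable {g : Type*} [LieRing g] [LieAlgebra ℝ g] {t : LieSubalgebra ℝ g} {n : ℕ}

theorem onT_sum_zsmul (v : Fin n → ℤ) (φ : Fin n → Module.Dual ℂ (complexify t)) :
    onT (∑ q, v q • φ q) = ∑ q, v q • onT (φ q) := by
  ext x
  change (∑ q, v q • φ q) (incl t x) = _
  rw [LinearMap.sum_apply, LinearMap.sum_apply]
  rfl

theorem onT_sum_nsmul (v : Fin n → ℕ) (φ : Fin n → Module.Dual ℂ (complexify t)) :
    onT (∑ q, v q • φ q) = ∑ q, v q • onT (φ q) := by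
  simpa using onT_sum_zsmul (fun q ↦ (v q : ℤ)) φ

end Sums

section Main

variable {g : Type*} [LieRing g] [LieAlgebra ℝ g] [FiniteDimensional ℝ g] [IsCompactLie g]
  {t : LieSubalgebra ℝ g} [IsMaximalAbelian t] {b : (roots t).Base} {δ : (complexify t).root}
  {m : b.support → ℕ} {i : b.support} {K : complexify t} {σ τ : g ≃ₗ⁅ℝ⁆ g} {f : t ≃ₗ[ℝ] t}
  {n : ℕ} {C : Matrix (Fin n) (Fin n) ℤ} {μ : Fin n → ℕ} {e : Fin n ≃ b.support} {k : Fin n}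
  {R : Fin n → Fin n → ℤ}

/-- `f` acts on the simple roots by the matrix `R`. -/
def HasMatrix (e : Fin n ≃ b.support) (f : t ≃ₗ[ℝ] t) (R : Fin n → Fin n → ℤ) : Prop :=
  ∀ p, act f (onT ((roots t).root (e p))) = onT (∑ q, R p q • (roots t).root (e q))

theorem hasMatrix_iff (he : IsMarkedNumbering b m C μ e)
    (hm : (roots t).root δ = ∑ j, m j • (roots t).root j)
    {image : (Fin (n + 1) → (t →ₗ[ℝ] ℂ)) → Fin n → (t →ₗ[ℝ] ℂ)}
    (hrow : ∀ (x : Fin n → (t →ₗ[ℝ] ℂ)) p,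
      image (Fin.cons (-∑ q, μ q • x q) x) p = ∑ q, R p q • x q) :
    HasMatrix e f R ↔ ∀ p : Fin n, act f (onT ((roots t).root (e p))) =
      image (Fin.cons (-onT ((roots t).root δ)) fun q ↦ onT ((roots t).root (e q))) p := by
  refine forall_congr' fun p ↦ ?_
  rw [highestRoot_eq_sum he hm, onT_sum_nsmul, hrow, onT_sum_zsmul]

theorem HasMatrix.root_apply_symm (hf : HasMatrix e f R) (h : ∀ x : t, τ (x : g) = (f x : g))
    (p : Fin n) (y : complexify t) : (roots t).root (e p) ((extendT h).symm y) =
      (∑ q, R p q • (roots t).root (e q)) y := by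
  have h1 := hf p
  rw [act_onT h] at h1
  exact LinearMap.congr_fun (onT_injective h1) y

theorem sum_zsmul_apply (hek : e k = i) (hKi : (roots t).root i K = 1)
    (hK : ∀ j : b.support, j ≠ i → (roots t).root j K = 0) (v : Fin n → ℤ) :
    (∑ q, v q • (roots t).root (e q)) K = v k := by
  rw [root_apply_eq_repr hKi hK, ← hek, repr_sum_zsmul]

theorem root_apply_eq_single (hek : e k = i) (hKi : (roots t).root i K = 1)
    (hK : ∀ j : b.support, j ≠ i → (roots t).root j K = 0) (p : Fin n) :
    (roots t).root (e p) K = ((Pi.single p 1 : Fin n → ℤ) k : ℂ) := by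
  rw [← sum_zsmul_apply hek hKi hK]
  congr 1
  simp [Pi.single_apply]

/-- K is dual to αₖ, so evaluating forms at K extracts the column k. The criterion on τ⁻¹K - K
becomes a congruence modulo 4 between this column and that of the identity. -/
theorem comm_of_hasMatrix (hf : HasMatrix e f R) (h : ∀ x : t, τ (x : g) = (f x : g))
    (hek : e k = i) (hKi : (roots t).root i K = 1)
    (hK : ∀ j : b.support, j ≠ i → (roots t).root j K = 0)
    (hσ : IsExpAd (((Real.pi / 2 : ℝ) * Complex.I : ℂ) • (K : ℂ ⊗[ℝ] g))
      ((σ.toLinearEquiv : g →ₗ[ℝ] g).baseChange ℂ))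
    (hR : ∀ p, 4 ∣ R p k - (Pi.single p 1 : Fin n → ℤ) k) (x : g) : τ (σ x) = σ (τ x) := by
  refine comm_of_root_apply_extendT h hσ b (fun j ↦ ?_) x
  obtain ⟨p, rfl⟩ := e.surjective j
  obtain ⟨c, hc⟩ := hR p
  refine ⟨c, ?_⟩
  rw [map_sub, hf.root_apply_symm, sum_zsmul_apply hek hKi hK, root_apply_eq_single hek hKi hK,
    ← Int.cast_sub, hc]
  push_cast; ring

theorem anticomm_of_hasMatrix (hf : HasMatrix e f R) (h : ∀ x : t, τ (x : g) = (f x : g))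
    (hek : e k = i) (hKi : (roots t).root i K = 1)
    (hK : ∀ j : b.support, j ≠ i → (roots t).root j K = 0)
    (hσ : IsExpAd (((Real.pi / 2 : ℝ) * Complex.I : ℂ) • (K : ℂ ⊗[ℝ] g))
      ((σ.toLinearEquiv : g →ₗ[ℝ] g).baseChange ℂ))
    (hR : ∀ p, 4 ∣ R p k + (Pi.single p 1 : Fin n → ℤ) k) (x : g) : σ (τ (σ x)) = τ x := by
  refine anticomm_of_root_apply_extendT h hσ b (fun j ↦ ?_) x
  obtain ⟨p, rfl⟩ := e.surjective j
  obtain ⟨c, hc⟩ := hR p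
  refine ⟨c, ?_⟩
  rw [map_add, hf.root_apply_symm, sum_zsmul_apply hek hKi hK, root_apply_eq_single hek hKi hK,
    ← Int.cast_add, hc]
  push_cast; ring

theorem mem_fundamentalRootsH_iff (hi : m i = 4) (hek : e k = i) (φ : t →ₗ[ℝ] ℂ) :
    φ ∈ fundamentalRootsH b δ m i ↔
      ∃ p ≠ k.succ, φ = onT ((roots t).root (extIdx δ e p)) := by
  have h0 : (roots t).root (extIdx δ e 0) = -(roots t).root δ := by
    change (roots t).root ((roots t).reflectionPerm δ δ) = _
    rw [RootPairing.root_reflectionPerm, RootPairing.reflection_apply_self]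
  constructor
  · rintro (⟨j, hj, rfl⟩ | ⟨-, rfl⟩)
    · obtain ⟨p, rfl⟩ := e.surjective j
      exact ⟨p.succ, fun h ↦ hj (by rw [← hek, Fin.succ_injective _ h]), rfl⟩
    · exact ⟨0, (Fin.succ_ne_zero k).symm, by rw [h0, onT_neg]⟩
  · rintro ⟨p, hp, rfl⟩
    rcases p.eq_zero_or_eq_succ with rfl | ⟨p, rfl⟩
    · exact .inr ⟨hi, by rw [h0, onT_neg]⟩
    · exact .inl ⟨e p, fun h ↦ hp (by rw [e.injective (h.trans hek.symm)]), rfl⟩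

theorem eq_refl_of_hasMatrix_one (hf : HasMatrix e f (matrixOne n)) :
    f = LinearEquiv.refl ℝ t := by
  have h1 (x : t) : f.symm x = x := by
    have h2 : incl t (f.symm x) = incl t x := by
      refine ext_of_simple_apply (b := b) fun j ↦ ?_
      obtain ⟨p, rfl⟩ := e.surjective j
      have h3 := LinearMap.congr_fun (hf p) x
      simp only [matrixOne, Pi.single_apply, ite_smul, one_smul, zero_smul, Finset.sum_ite_eq',
        Finset.mem_univ, if_true] at h3
      exact h3
    exact Subtype.ext (one_tmul_injective (congrArg Subtype.val h2))
  exact LinearEquiv.ext fun x ↦ ((LinearEquiv.symm_apply_eq f).mp (h1 x)).symm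

theorem ne_refl_of_hasMatrix (hf : HasMatrix e f R) (hR : R ≠ matrixOne n) :
    f ≠ LinearEquiv.refl ℝ t := by
  rintro rfl
  refine hR (funext fun p ↦ sum_zsmul_injective e ?_)
  have h1 : onT ((roots t).root (e p)) = onT (∑ q, R p q • (roots t).root (e q)) := hf p
  simp only [← onT_injective h1]
  simp [matrixOne, Pi.single_apply]

/-- The transpose inverse of the action on the complexified torus supplies the involution for
`exists_matrix_of_involution`; stability of Π(𝔥) supplies its permutation. -/
theorem IsAdmissible.exists_hasMatrix (hτ : IsAdmissible b δ m i σ τ f)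
    (he : IsMarkedNumbering b m C μ e) (hm : (roots t).root δ = ∑ j, m j • (roots t).root j)
    (hi : m i = 4) (hek : e k = i) :
    ∃ (π : Fin (n + 1) → Fin (n + 1)) (Q : Fin n → Fin n → ℤ),
      (∀ p q, extCompat C μ k.succ p (π p) q (π q) = true) ∧ IsExtMatrix μ k π Q ∧
        HasMatrix e f Q := by
  have h := hτ.restrict
  have hff (x : t) : f (f x) = x := by
    apply Subtype.ext
    rw [← h, ← h, hτ.involutive]
  have hff' (x : t) : f.symm (f.symm x) = x := by
    rw [LinearEquiv.symm_apply_eq, LinearEquiv.symm_apply_eq, hff]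
  have hA (φ : Module.Dual ℂ (complexify t)) :
      onT ((extendT h).symm.dualMap φ) = act f (onT φ) := (act_onT h φ).symm
  obtain ⟨π, Q, h1, h2, h3, h4⟩ := exists_matrix_of_involution he hm
    (A := (extendT h).symm.dualMap) (k := k)
    (fun β ↦ by
      obtain ⟨γ, hγ, -⟩ := exists_root_map (extendC_coe h) β
      exact ⟨γ, hγ.symm⟩)
    (fun β γ β' γ' hβ hγ ↦ pairing_eq_of_root_eq (extendC_coe h) hβ.symm hγ.symm)
    (fun φ ↦ by
      apply onT_injective
      rw [hA, hA]
      ext x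
      change φ (incl t (f.symm (f.symm x))) = φ (incl t x)
      rw [hff'])
    (fun p hp ↦ by
      have h5 : act f (onT ((roots t).root (extIdx δ e p))) ∈ fundamentalRootsH b δ m i := by
        rw [← hτ.map_fundamental]
        exact ⟨_, (mem_fundamentalRootsH_iff hi hek _).mpr ⟨p, hp, rfl⟩, rfl⟩
      obtain ⟨q, hq, h6⟩ := (mem_fundamentalRootsH_iff hi hek _).mp h5
      rw [← hA] at h6
      exact ⟨q, hq, onT_injective h6⟩)
  exact ⟨π, Q, h1, ⟨h2, h3⟩, fun p ↦ by rw [← hA, h4]⟩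

/-- The lists J and l are a certificate that the prescribed matrix is that of a conjugated product
of orthogonal simple reflections. The lift then exists, and the congruence modulo 4 makes it
preserve the fixed points of σ. -/
theorem exists_isAdmissible (he : IsMarkedNumbering b m C μ e)
    (hm : (roots t).root δ = ∑ j, m j • (roots t).root j)
    (hi : m i = 4) (hek : e k = i) (hKi : (roots t).root i K = 1)
    (hK : ∀ j : b.support, j ≠ i → (roots t).root j K = 0)
    (hσ : IsExpAd (((Real.pi / 2 : ℝ) * Complex.I : ℂ) • (K : ℂ ⊗[ℝ] g))
      ((σ.toLinearEquiv : g →ₗ[ℝ] g).baseChange ℂ))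
    (hf : HasMatrix e f R) (J l : List (Fin n))
    (hJ : J.Pairwise fun p q ↦ decide (p ≠ q ∧ C p q = 0) = true)
    (hw : ∀ p, wordVec C J l (Pi.single p 1) = R p)
    (hR : (∀ p, 4 ∣ R p k - (Pi.single p 1 : Fin n → ℤ) k) ∨
      ∀ p, 4 ∣ R p k + (Pi.single p 1 : Fin n → ℤ) k)
    (hS : ∀ p ≠ k.succ, ∃ q ≠ k.succ, ∀ s, ∑ r, extVec μ p r * R r s = extVec μ q s) :
    ∃ τ : g ≃ₗ⁅ℝ⁆ g, IsAdmissible b δ m i σ τ f := by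
  obtain ⟨φ, hφθ, hφ, hφH⟩ := exists_involutive_lift (isCompactConj_conj t) b (J.map e) (l.map e)
    (by
      rw [List.pairwise_map]
      exact hJ.imp fun h ↦ ⟨fun h' ↦ (of_decide_eq_true h).1 (e.injective h'),
        by rw [he.1, (of_decide_eq_true h).2]⟩)
  obtain ⟨τ, hτ⟩ := exists_eq_one_tmul_of_conj_comm hφθ
  have hinv (x : g) : τ (τ x) = x := by
    apply one_tmul_injective
    change (1 : ℂ) ⊗ₜ[ℝ] τ (τ x) = (1 : ℂ) ⊗ₜ[ℝ] x
    rw [hτ, hτ, hφ]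
  -- The matrix R describes forms composed with f⁻¹, hence the inverse here. As the lift τ is
  -- involutive, f⁻¹ = f follows in `hrestrict`.
  have hword (x : t) : conjWord (J.map e) (l.map e) (incl t x) = incl t (f.symm x) := by
    refine ext_of_simple_apply (b := b) fun j ↦ ?_
    obtain ⟨p, rfl⟩ := e.surjective j
    have h1 := sum_apply_conjWord he.1 J l (Pi.single p 1) (incl t x)
    rw [hw] at h1
    have h2 : ∑ q, (Pi.single p 1 : Fin n → ℤ) q • (roots t).root (e q) =
        (roots t).root (e p) := by
      simp [Pi.single_apply]
    rw [h2] at h1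
    exact h1.trans (LinearMap.congr_fun (hf p) x).symm
  have hsymm (x : t) : τ (x : g) = (f.symm x : g) := by
    apply one_tmul_injective
    change (1 : ℂ) ⊗ₜ[ℝ] τ (x : g) = (incl t (f.symm x) : ℂ ⊗[ℝ] g)
    rw [hτ, ← hword]
    exact hφH (incl t x)
  have hff (x : t) : f.symm (f.symm x) = x := by
    apply Subtype.ext
    rw [← hsymm, ← hsymm, hinv]
  have hrestrict (x : t) : τ (x : g) = (f x : g) := by
    rw [hsymm]
    congr 1
    exact (LinearEquiv.symm_apply_eq f).mp (hff x)
  have hact (ψ : t →ₗ[ℝ] ℂ) : act f (act f ψ) = ψ := by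
    ext x
    change ψ (f.symm (f.symm x)) = ψ x
    rw [hff]
  have hmaps (ψ) (hψ : ψ ∈ fundamentalRootsH b δ m i) : act f ψ ∈ fundamentalRootsH b δ m i := by
    rw [mem_fundamentalRootsH_iff hi hek] at hψ ⊢
    obtain ⟨p, hp, rfl⟩ := hψ
    obtain ⟨q, hq, hpq⟩ := hS p hp
    refine ⟨q, hq, ?_⟩
    rw [root_extIdx he hm, root_extIdx he hm, act_onT hrestrict]
    congr 1
    ext y
    have hs (v : Fin n → ℤ) (z : complexify t) : (∑ q, v q • (roots t).root (e q)) z =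
        ∑ q, (v q : ℂ) * (roots t).root (e q) z := by
      rw [LinearMap.sum_apply]
      exact Finset.sum_congr rfl fun q _ ↦ by rw [LinearMap.smul_apply, zsmul_eq_mul]
    rw [LinearMap.comp_apply]
    change (∑ q, extVec μ p q • (roots t).root (e q)) ((extendT hrestrict).symm y) = _
    rw [hs, hs]
    simp only [hf.root_apply_symm hrestrict, hs, Finset.mul_sum, ← hpq]
    rw [Finset.sum_comm]
    simp only [Int.cast_sum, Int.cast_mul, Finset.sum_mul, mul_assoc]
  refine ⟨τ, hinv, ?_, hrestrict, ?_⟩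
  · refine map_fixedPoints_eq hinv fun x hx ↦ ?_
    rcases hR with hR | hR
    · rw [← comm_of_hasMatrix hf hrestrict hek hKi hK hσ hR, hx]
    · have := anticomm_of_hasMatrix hf hrestrict hek hKi hK hσ hR x
      rwa [hx] at this
  · refine Set.Subset.antisymm ?_ fun ψ hψ ↦ ⟨_, hmaps ψ hψ, hact ψ⟩
    rintro _ ⟨ψ, hψ, rfl⟩
    exact hmaps ψ hψ

/-- A row of the table only specifies the Cartan matrix. The marks come back from the
classification: the rank selects the type, and rigidity of the diagram identifies the two
numberings. -/
theorem isMarkedNumbering_of_E7 (hδ : IsHighestRoot b δ)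
    (hm : (roots t).root δ = ∑ j, m j • (roots t).root j) (hi : m i = 4) {e : Fin 7 ≃ b.support}
    (he : ∀ p q, b.cartanMatrix (e p) (e q) = CartanMatrix.E₇ p q) :
    IsMarkedNumbering b m CartanMatrix.E₇ ![2, 2, 3, 4, 3, 2, 1] e := by
  rcases exists_isMarkedNumbering hδ hm hi with ⟨e', he', -⟩ | ⟨e', -⟩ | ⟨e', -⟩
  · rwa [numbering_unique he he'.1 rigid_E7]
  · exact absurd (Fin.equiv_iff_eq.mp ⟨e.trans e'.symm⟩) (by decide)
  · exact absurd (Fin.equiv_iff_eq.mp ⟨e.trans e'.symm⟩) (by decide)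

theorem isMarkedNumbering_of_E8 (hδ : IsHighestRoot b δ)
    (hm : (roots t).root δ = ∑ j, m j • (roots t).root j) (hi : m i = 4) {e : Fin 8 ≃ b.support}
    (he : ∀ p q, b.cartanMatrix (e p) (e q) = CartanMatrix.E₈ p q) :
    IsMarkedNumbering b m CartanMatrix.E₈ ![2, 3, 4, 6, 5, 4, 3, 2] e := by
  rcases exists_isMarkedNumbering hδ hm hi with ⟨e', -⟩ | ⟨e', he', -⟩ | ⟨e', -⟩
  · exact absurd (Fin.equiv_iff_eq.mp ⟨e.trans e'.symm⟩) (by decide)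
  · rwa [numbering_unique he he'.1 rigid_E8]
  · exact absurd (Fin.equiv_iff_eq.mp ⟨e.trans e'.symm⟩) (by decide)

theorem isMarkedNumbering_of_F4 (hδ : IsHighestRoot b δ)
    (hm : (roots t).root δ = ∑ j, m j • (roots t).root j) (hi : m i = 4) {e : Fin 4 ≃ b.support}
    (he : ∀ p q, b.cartanMatrix (e p) (e q) = CartanMatrix.F₄ p q) :
    IsMarkedNumbering b m CartanMatrix.F₄ ![2, 3, 4, 2] e := by
  rcases exists_isMarkedNumbering hδ hm hi with ⟨e', -⟩ | ⟨e', -⟩ | ⟨e', he', -⟩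
  · exact absurd (Fin.equiv_iff_eq.mp ⟨e.trans e'.symm⟩) (by decide)
  · exact absurd (Fin.equiv_iff_eq.mp ⟨e.trans e'.symm⟩) (by decide)
  · rwa [numbering_unique he he'.1 rigid_F4]

/-- The restriction to `t` of an admissible involution is in the table. -/
theorem IsAdmissible.exists_isOfType (hτ : IsAdmissible b δ m i σ τ f) (hδ : IsHighestRoot b δ)
    (hm : (roots t).root δ = ∑ j, m j • (roots t).root j) (hi : m i = 4)
    (hf : f ≠ LinearEquiv.refl ℝ t) : ∃ T, IsOfType b δ i f T := by
  rcases exists_isMarkedNumbering hδ hm hi with ⟨e, he, hek⟩ | ⟨e, he, hek | hek⟩ | ⟨e, he, hek⟩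
  · obtain ⟨π, Q, h1, h2, hQ⟩ := hτ.exists_hasMatrix he hm hi hek
    rcases isExtMatrix_E7 h1 h2 with rfl | rfl | rfl | rfl
    · exact absurd (eq_refl_of_hasMatrix_one hQ) hf
    · exact ⟨.I, e, he.1, hek, (hasMatrix_iff (image := rowI) he hm rowI_apply).mp hQ⟩
    · exact ⟨.II, e, he.1, hek, (hasMatrix_iff (image := rowII) he hm rowII_apply).mp hQ⟩
    · exact ⟨.III, e, he.1, hek, (hasMatrix_iff (image := rowIII) he hm rowIII_apply).mp hQ⟩
  · obtain ⟨π, Q, h1, h2, hQ⟩ := hτ.exists_hasMatrix he hm hi hek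
    rcases isExtMatrix_E8_two h1 h2 with rfl | rfl
    · exact absurd (eq_refl_of_hasMatrix_one hQ) hf
    · exact ⟨.IV, e, he.1, hek, (hasMatrix_iff (image := rowIV) he hm rowIV_apply).mp hQ⟩
  · obtain ⟨π, Q, h1, h2, hQ⟩ := hτ.exists_hasMatrix he hm hi hek
    rcases isExtMatrix_E8_five h1 h2 with rfl | rfl
    · exact absurd (eq_refl_of_hasMatrix_one hQ) hf
    · exact ⟨.V, e, he.1, hek, (hasMatrix_iff (image := rowV) he hm rowV_apply).mp hQ⟩
  · obtain ⟨π, Q, h1, h2, hQ⟩ := hτ.exists_hasMatrix he hm hi hek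
    rcases isExtMatrix_F4 h1 h2 with rfl | rfl
    · exact absurd (eq_refl_of_hasMatrix_one hQ) hf
    · exact ⟨.VI, e, he.1, hek, (hasMatrix_iff (image := rowVI) he hm rowVI_apply).mp hQ⟩

/-- Every row of the table is the restriction to `t` of an admissible involution. -/
theorem exists_isAdmissible_of_isOfType (hδ : IsHighestRoot b δ)
    (hm : (roots t).root δ = ∑ j, m j • (roots t).root j) (hi : m i = 4)
    (hKi : (roots t).root i K = 1) (hK : ∀ j : b.support, j ≠ i → (roots t).root j K = 0)
    (hσ : IsExpAd (((Real.pi / 2 : ℝ) * Complex.I : ℂ) • (K : ℂ ⊗[ℝ] g))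
      ((σ.toLinearEquiv : g →ₗ[ℝ] g).baseChange ℂ)) {T : RowType} (hT : IsOfType b δ i f T) :
    f ≠ LinearEquiv.refl ℝ t ∧ ∃ τ : g ≃ₗ⁅ℝ⁆ g, IsAdmissible b δ m i σ τ f := by
  -- In each case f is w(∏ J)w⁻¹, with w the product of the simple reflections listed in l, numbered
  -- from 0. The length of J is the dimension of the -1 eigenspace of f. The kernel checks the
  -- orthogonality of J, the resulting matrix, the congruence modulo 4 and the stability of Π(𝔥).
  cases T <;> obtain ⟨e, he, hek, hf⟩ := hT
  · have he' := isMarkedNumbering_of_E7 hδ hm hi he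
    replace hf := (hasMatrix_iff (image := rowI) he' hm rowI_apply).mpr hf
    exact ⟨ne_refl_of_hasMatrix hf (by decide +kernel),
      exists_isAdmissible he' hm hi hek hKi hK hσ hf [1, 4, 6] [6, 5, 4, 3, 1, 2, 0, 3, 2, 4, 3, 5]
        (by decide +kernel) (by decide +kernel) (by decide +kernel) (by decide +kernel)⟩
  · have he' := isMarkedNumbering_of_E7 hδ hm hi he
    replace hf := (hasMatrix_iff (image := rowII) he' hm rowII_apply).mpr hf
    exact ⟨ne_refl_of_hasMatrix hf (by decide +kernel),
      exists_isAdmissible he' hm hi hek hKi hK hσ hf [4, 6] [2, 0, 3, 1, 2, 3, 4, 3, 1, 2, 3, 5]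
        (by decide +kernel) (by decide +kernel) (by decide +kernel) (by decide +kernel)⟩
  · have he' := isMarkedNumbering_of_E7 hδ hm hi he
    replace hf := (hasMatrix_iff (image := rowIII) he' hm rowIII_apply).mpr hf
    exact ⟨ne_refl_of_hasMatrix hf (by decide +kernel),
      exists_isAdmissible he' hm hi hek hKi hK hσ hf [1, 2, 4]
        [4, 3, 1, 2, 0, 3, 5, 4, 3, 1, 2, 0, 6, 5, 4, 3]
        (by decide +kernel) (by decide +kernel) (by decide +kernel) (by decide +kernel)⟩
  · have he' := isMarkedNumbering_of_E8 hδ hm hi he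
    replace hf := (hasMatrix_iff (image := rowIV) he' hm rowIV_apply).mpr hf
    exact ⟨ne_refl_of_hasMatrix hf (by decide +kernel),
      exists_isAdmissible he' hm hi hek hKi hK hσ hf [1, 2, 4]
        [1, 3, 2, 0, 4, 3, 1, 2, 3, 5, 4, 3, 1, 2, 0, 3, 6, 5, 4, 3, 1, 2, 0, 7, 6, 5, 4, 3]
        (by decide +kernel) (by decide +kernel) (by decide +kernel) (by decide +kernel)⟩
  · have he' := isMarkedNumbering_of_E8 hδ hm hi he
    replace hf := (hasMatrix_iff (image := rowV) he' hm rowV_apply).mpr hf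
    exact ⟨ne_refl_of_hasMatrix hf (by decide +kernel),
      exists_isAdmissible he' hm hi hek hKi hK hσ hf [1, 2]
        [6, 5, 4, 3, 1, 2, 0, 3, 2, 4, 3, 1, 5, 4, 3, 2, 0, 7, 6, 5, 4, 3]
        (by decide +kernel) (by decide +kernel) (by decide +kernel) (by decide +kernel)⟩
  · have he' := isMarkedNumbering_of_F4 hδ hm hi he
    replace hf := (hasMatrix_iff (image := rowVI) he' hm rowVI_apply).mpr hf
    exact ⟨ne_refl_of_hasMatrix hf (by decide +kernel),
      exists_isAdmissible he' hm hi hek hKi hK hσ hf [3] [1, 0, 2, 1, 2]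
        (by decide +kernel) (by decide +kernel) (by decide +kernel) (by decide +kernel)⟩

theorem comm_of_isOfType_I (hδ : IsHighestRoot b δ)
    (hm : (roots t).root δ = ∑ j, m j • (roots t).root j) (hi : m i = 4)
    (hKi : (roots t).root i K = 1) (hK : ∀ j : b.support, j ≠ i → (roots t).root j K = 0)
    (hσ : IsExpAd (((Real.pi / 2 : ℝ) * Complex.I : ℂ) • (K : ℂ ⊗[ℝ] g))
      ((σ.toLinearEquiv : g →ₗ[ℝ] g).baseChange ℂ))
    (h : ∀ x : t, τ (x : g) = (f x : g)) (hT : IsOfType b δ i f .I) (x : g) :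
    τ (σ x) = σ (τ x) := by
  obtain ⟨e, he, hek, hf⟩ := hT
  replace hf := (hasMatrix_iff (image := rowI) (isMarkedNumbering_of_E7 hδ hm hi he)
      hm rowI_apply).mpr hf
  exact comm_of_hasMatrix hf h hek hKi hK hσ (by decide +kernel) x

theorem anticomm_of_isOfType (hδ : IsHighestRoot b δ)
    (hm : (roots t).root δ = ∑ j, m j • (roots t).root j) (hi : m i = 4)
    (hKi : (roots t).root i K = 1) (hK : ∀ j : b.support, j ≠ i → (roots t).root j K = 0)
    (hσ : IsExpAd (((Real.pi / 2 : ℝ) * Complex.I : ℂ) • (K : ℂ ⊗[ℝ] g))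
      ((σ.toLinearEquiv : g →ₗ[ℝ] g).baseChange ℂ))
    (h : ∀ x : t, τ (x : g) = (f x : g)) {T : RowType} (hT0 : T ≠ .I) (hT : IsOfType b δ i f T)
    (x : g) : σ (τ (σ x)) = τ x := by
  cases T
  case I => exact absurd rfl hT0
  all_goals obtain ⟨e, he, hek, hf⟩ := hT
  · replace hf := (hasMatrix_iff (image := rowII) (isMarkedNumbering_of_E7 hδ hm hi he)
      hm rowII_apply).mpr hf
    exact anticomm_of_hasMatrix hf h hek hKi hK hσ (by decide +kernel) x
  · replace hf := (hasMatrix_iff (image := rowIII) (isMarkedNumbering_of_E7 hδ hm hi he)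
      hm rowIII_apply).mpr hf
    exact anticomm_of_hasMatrix hf h hek hKi hK hσ (by decide +kernel) x
  · replace hf := (hasMatrix_iff (image := rowIV) (isMarkedNumbering_of_E8 hδ hm hi he)
      hm rowIV_apply).mpr hf
    exact anticomm_of_hasMatrix hf h hek hKi hK hσ (by decide +kernel) x
  · replace hf := (hasMatrix_iff (image := rowV) (isMarkedNumbering_of_E8 hδ hm hi he)
      hm rowV_apply).mpr hf
    exact anticomm_of_hasMatrix hf h hek hKi hK hσ (by decide +kernel) x
  · replace hf := (hasMatrix_iff (image := rowVI) (isMarkedNumbering_of_F4 hδ hm hi he)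
      hm rowVI_apply).mpr hf
    exact anticomm_of_hasMatrix hf h hek hKi hK hσ (by decide +kernel) x

end Main

end FourSymmetric

theorem proposition4p1 {g : Type*} [LieRing g] [LieAlgebra ℝ g] [FiniteDimensional ℝ g]
    [LieAlgebra.IsSimple ℝ g] [IsCompactLie g]
    (t : LieSubalgebra ℝ g) [IsMaximalAbelian t]
    (b : (roots t).Base)
    (δ : (complexify t).root) (hδ : IsHighestRoot b δ)
    (m : b.support → ℕ) (hm : (roots t).root δ = ∑ j, m j • (roots t).root j)
    (i : b.support) (hi : m i = 3 ∨ m i = 4)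
    (K : complexify t) (hKi : (roots t).root i K = 1)
    (hK : ∀ j : b.support, j ≠ i → (roots t).root j K = 0)
    (σ : g ≃ₗ⁅ℝ⁆ g)
    (hσ : IsExpAd (((Real.pi / 2 : ℝ) * Complex.I : ℂ) • (K : TensorProduct ℝ ℂ g))
      ((σ.toLinearEquiv : g →ₗ[ℝ] g).baseChange ℂ))
    (hz : Module.finrank ℝ (LieAlgebra.center ℝ (fixedPoints σ)) = 0) :
    (∀ f : t ≃ₗ[ℝ] t,
      (f ≠ LinearEquiv.refl ℝ t ∧ ∃ τ : g ≃ₗ⁅ℝ⁆ g, IsAdmissible b δ m i σ τ f) ↔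
        ∃ T : RowType, IsOfType b δ i f T) ∧
    (∀ (τ : g ≃ₗ⁅ℝ⁆ g) (f : t ≃ₗ[ℝ] t), IsAdmissible b δ m i σ τ f →
      (IsOfType b δ i f .I → ∀ x, τ (σ x) = σ (τ x)) ∧
      (∀ T : RowType, T ≠ .I → IsOfType b δ i f T → ∀ x, τ (σ x) = σ.symm (τ x))) := by
  have hi4 : m i = 4 := hi.resolve_left (mark_ne_three δ hδ m hm hKi hK hσ hz)
  refine ⟨fun f ↦ ⟨fun ⟨hf, τ, hτ⟩ ↦ hτ.exists_isOfType hδ hm hi4 hf, fun ⟨T, hT⟩ ↦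
    exists_isAdmissible_of_isOfType hδ hm hi4 hKi hK hσ hT⟩, fun τ f hτ ↦ ⟨fun hT x ↦
    comm_of_isOfType_I hδ hm hi4 hKi hK hσ hτ.restrict hT x, fun T hT0 hT x ↦ ?_⟩⟩
  apply σ.injective
  change σ (τ (σ x)) = σ (σ.symm (τ x))
  rw [LieEquiv.apply_symm_apply]
  exact anticomm_of_isOfType hδ hm hi4 hKi hK hσ hτ.restrict hT0 hT x
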